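/- Let $K=\mathbb Q(i)$, $i^2=-1$, with ring of integers $\mathbb Z_K$, and let $c$ be the nontrivial automorphism of $K$. An idele class character of a number field is a continuous homomorphism from its idele group to the unit circle that is trivial on the principal ideles; it is quadratic if it has order exactly $2$. For an idele class character $\chi$ of $K$, let $\chi_v$ be its restriction to $K_v^\times$, let $\chi^c(x)=\chi(c(x))$, and let $\mathfrak f_\chi=\prod_v v^{n(\chi_v)}$ be its conductor, where $v$ runs over the finite places and $n(\chi_v)\ge 0$ is the least $n$ such that $\chi_v$ is trivial on $\mathcal U_v\cap(1+\mathcal M_v^{n})$, with $\mathcal U_v$ the units and $\mathcal M_v$ the maximal ideal of the ring of integers of $K_v$. We say that $\chi$ arises from base change if $\chi=\nu\circ N_{K/\mathbb Q}$ for an idele class character $\nu$ of $\mathbb Q$. For each prime $p$ that splits in $K$ choose one place of $K$ above $p$, and let $S_K$ be the set of chosen places. For a nonzero ideal $\mathfrak f=\prod_v v^{m(v)}$ of $\mathbb Z_K$ consider the following conditions. (A)$_i$ No place above an odd inert prime divides $\mathfrak f$. (B)$_i$ At most one place $v$ above a ramified prime $\equiv 3 \bmod 4$ divides $\mathfrak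 f$, and then $m(v)=1$. (This holds automatically for $K=\mathbb Q(i)$.) (C)$_i$ If a place $v$ above a split prime $p$ divides $\mathfrak f$, then $v\in S_K$, and $m(v)=1$ if $p$ is odd, $m(v)=2$ or $3$ if $p=2$. (The prime $2$ does not split in $\mathbb Q(i)$.) (D)$_i'$ If the place $v$ above $2$ divides $\mathfrak f$, then $m(v)=2$ or $5$. Moreover, for a character $\chi$ with $\mathfrak f_\chi=\mathfrak f$, $\chi_v(i)=-1$ if $m(v)=2$, and $\chi_v(1+\pi_v^3)=1$ if $m(v)=5$, where $\pi_v=i-1$. A character $\chi$ is said to satisfy these conditions if they hold for $\mathfrak f=\mathfrak f_\chi$ and $\chi$. Then: (I) For every quadratic idele class character $\chi$ of $K$ there is an idele class character $\mu$ of $K$ arising from base change such that $(\chi\mu)^2=1$ and $\chi\mu$ satisfies (A)$_i$, (B)$_i$, (C)$_i$ and (D)$_i'$. (II) A quadratic idele class character $\chi$ of $K$ with $\mathfrak f_\chi\neq(1)$ that satisfies (A)$_i$, (B)$_i$, (C)$_i$ and (D)$_i'$ does not arise from base change; moreover $\chi^c=\chi\cdot\delta$ for some quadratic idele class character $\delta$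 of $K$. (III) No two distinct quadratic idele class characters of $K$ satisfying (A)$_i$, (B)$_i$, (C)$_i$ and (D)$_i'$ differ by multiplication by an idele class character of $K$ arising from base change. (IV) Let $\mathfrak f=\prod_v v^{m(v)}$ be a nonzero ideal of $\mathbb Z_K$, $\mathfrak f\ne(1)$, whose exponents $m(v)$ satisfy (A)$_i$, (B)$_i$, (C)$_i$ and the first sentence of (D)$_i'$. Let $r(\mathfrak f)$ be the number of places $v\mid\mathfrak f$ that lie above a prime $p\equiv 5\bmod 8$. There is a quadratic idele class character $\chi$ of $K$ with conductor $\mathfrak f$ satisfying (A)$_i$, (B)$_i$, (C)$_i$ and (D)$_i'$ if and only if both of the following hold: $r(\mathfrak f)$ is even if no $v\mid\mathfrak f$ lies above $2$; and $r(\mathfrak f)$ is odd if some $v\mid\mathfrak f$ lies above $2$ and has $m(v)=2$. -/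

import Mathlib

open NumberField IsDedekindDomain

noncomputable section

namespace IdeleClass

section InfiniteAdeleMap

variable (L K : Type*) [Field L] [Field K] [Algebra L K]

instance (w : InfinitePlace K) : w.LiesOver (w.comap (algebraMap L K)) := ⟨rfl⟩

/-- The map of infinite adele rings induced by the inclusions `L_u → K_w` for the infinite
places `w` of `K` above the infinite places `u` of `L`. -/
def infiniteAdeleMap : InfiniteAdeleRing L →+* InfiniteAdeleRing K :=
  RingHom.pi fun w : InfinitePlace K =>
    (LiesOver.completionMap (v := w.comap (algebraMap L K)) (w := w)).comp
      (Pi.evalRingHom (fun u : InfinitePlace L => u.Completion) (w.comap (algebraMap L K)))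

theorem continuous_infiniteAdeleMap : Continuous (infiniteAdeleMap L K) :=
  continuous_pi fun _ => LiesOver.continuous_completionMap.comp (continuous_apply _)

end InfiniteAdeleMap

section AdeleMap

/-! Functoriality of the adele ring: for an extension `K / L` of number fields, the inclusion
of the adeles of `L` in the adeles of `K`. -/

variable (L K : Type*) [Field L] [NumberField L] [Field K] [NumberField K] [Algebra L K]

/-- The place of `L` below a finite place `v` of `K`. -/
abbrev below (v : HeightOneSpectrum (𝓞 K)) : HeightOneSpectrum (𝓞 L) := v.under (𝓞 L)

instance (v : HeightOneSpectrum (𝓞 K)) : v.asIdeal.LiesOver (below L K v).asIdeal := ⟨rfl⟩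

/-- For a finite place `v` of `K` above the place `w` of `L`, the continuous extension
`L_w → K_v` of the inclusion `L → K`. -/
def finiteMap (v : HeightOneSpectrum (𝓞 K)) :
    (below L K v).adicCompletion L →+* v.adicCompletion K :=
  ((HeightOneSpectrum.adicCompletion.equiv K v).symm.toRingHom.comp
    (UniformSpace.Completion.mapRingHom
      (algebraMap (WithVal ((below L K v).valuation L)) (WithVal (v.valuation K)))
      (HeightOneSpectrum.uniformContinuous_algebraMap_liesOver L K
        (below L K v) v).continuous)).comp
    (HeightOneSpectrum.adicCompletion.equiv L (below L K v)).toRingHom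

theorem continuous_finiteMap (v : HeightOneSpectrum (𝓞 K)) : Continuous (finiteMap L K v) :=
  (HeightOneSpectrum.adicCompletion.continuous_ofCompletion K v).comp <|
    UniformSpace.Completion.continuous_map.comp
      (HeightOneSpectrum.adicCompletion.continuous_toCompletion L (below L K v))

theorem finiteMap_coe (v : HeightOneSpectrum (𝓞 K)) (x : L) :
    finiteMap L K v (x : (below L K v).adicCompletion L) =
      ((algebraMap L K x : K) : v.adicCompletion K) :=
  HeightOneSpectrum.adicCompletion.ext K v <|
    UniformSpace.Completion.mapRingHom_coe _ _

theorem finiteMap_mapsTo (v : HeightOneSpectrum (𝓞 K)) :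
    Set.MapsTo (finiteMap L K v) ((below L K v).adicCompletionIntegers L)
      (v.adicCompletionIntegers K) := by
  have hopen : IsOpen ((below L K v).adicCompletionIntegers L :
      Set ((below L K v).adicCompletion L)) := Valued.isOpen_valuationSubring _
  have hclosed : IsClosed (finiteMap L K v ⁻¹' (v.adicCompletionIntegers K :
      Set (v.adicCompletion K))) :=
    (Valued.isClosed_valuationSubring _).preimage (continuous_finiteMap L K v)
  refine (Dense.open_subset_closure_inter ((below L K v).denseRange_algebraMap L) hopen).trans
    (closure_minimal ?_ hclosed)
  rintro _ ⟨hx, x, rfl⟩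
  rw [SetLike.mem_coe, HeightOneSpectrum.mem_adicCompletionIntegers] at hx
  change finiteMap L K v _ ∈ v.adicCompletionIntegers K
  rw [HeightOneSpectrum.mem_adicCompletionIntegers]
  have h1 : finiteMap L K v (algebraMap L ((below L K v).adicCompletion L) x) =
      ((algebraMap L K x : K) : v.adicCompletion K) := finiteMap_coe L K v x
  have h2 : (below L K v).valuation L x ≤ 1 := by
    rwa [← HeightOneSpectrum.valuedAdicCompletion_eq_valuation']
  rw [h1, HeightOneSpectrum.valuedAdicCompletion_eq_valuation',
    ← HeightOneSpectrum.valuation_liesOver K (below L K v) v]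
  exact pow_le_one' h2 _

theorem tendsto_below : Filter.Tendsto (below L K) Filter.cofinite Filter.cofinite := by
  refine Filter.Tendsto.cofinite_of_finite_preimage_singleton fun w => ?_
  have : w.asIdeal.IsMaximal := w.isMaximal
  refine Set.Finite.of_finite_image (f := HeightOneSpectrum.asIdeal) ?_
    (fun _ _ _ _ h => HeightOneSpectrum.ext h)
  refine (IsDedekindDomain.primesOver_finite (B := 𝓞 K) w.asIdeal).subset ?_
  rintro _ ⟨v, hv, rfl⟩
  refine ⟨v.isPrime, ⟨?_⟩⟩
  rw [← (show below L K v = w from hv)]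
  rfl

/-- The map of finite adele rings with components `finiteMap`. -/
def finiteAdeleMap : FiniteAdeleRing (𝓞 L) L →+* FiniteAdeleRing (𝓞 K) K :=
  RestrictedProduct.mapAlongRingHom
    (fun w : HeightOneSpectrum (𝓞 L) => w.adicCompletion L)
    (fun v : HeightOneSpectrum (𝓞 K) => v.adicCompletion K)
    (S₁ := fun w : HeightOneSpectrum (𝓞 L) => ValuationSubring (w.adicCompletion L))
    (S₂ := fun v : HeightOneSpectrum (𝓞 K) => ValuationSubring (v.adicCompletion K))
    (B₁ := fun w : HeightOneSpectrum (𝓞 L) => w.adicCompletionIntegers L)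
    (B₂ := fun v : HeightOneSpectrum (𝓞 K) => v.adicCompletionIntegers K)
    (𝓕₁ := Filter.cofinite) (𝓕₂ := Filter.cofinite)
    (below L K) (tendsto_below L K) (finiteMap L K)
    (Filter.Eventually.of_forall (finiteMap_mapsTo L K))

theorem continuous_finiteAdeleMap : Continuous (finiteAdeleMap L K) :=
  RestrictedProduct.mapAlong_continuous
    (fun w : HeightOneSpectrum (𝓞 L) => w.adicCompletion L)
    (fun v : HeightOneSpectrum (𝓞 K) => v.adicCompletion K)
    (below L K) (tendsto_below L K) (fun v => finiteMap L K v)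
    (Filter.Eventually.of_forall (finiteMap_mapsTo L K)) (continuous_finiteMap L K)

/-- The inclusion of the adele ring of `L` in the adele ring of `K`. -/
def adeleMap : AdeleRing (𝓞 L) L →+* AdeleRing (𝓞 K) K :=
  RingHom.prodMap (infiniteAdeleMap L K) (finiteAdeleMap L K)

theorem continuous_adeleMap : Continuous (adeleMap L K) :=
  (continuous_infiniteAdeleMap L K).prodMap (continuous_finiteAdeleMap L K)

theorem adeleMap_algebraMap (x : L) :
    adeleMap L K (algebraMap L (AdeleRing (𝓞 L) L) x) =
      algebraMap K (AdeleRing (𝓞 K) K) (algebraMap L K x) := by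
  refine Prod.ext (funext fun w => ?_) (FiniteAdeleRing.ext _ fun v => ?_)
  · exact LiesOver.completionMap_coe (v := w.comap (algebraMap L K)) (w := w)
      (WithAbs.toAbs _ x)
  · exact finiteMap_coe L K v x

end AdeleMap

section Ideles

variable (K : Type*) [Field K] [NumberField K]

/-- The group of ideles of `K`, with its usual topology (the topology of a group of units). -/
abbrev IdeleGroup : Type _ := (AdeleRing (𝓞 K) K)ˣ

/-- The diagonal embedding of `Kˣ` in the ideles. -/
def principalIdele : Kˣ →* IdeleGroup K :=
  Units.map (algebraMap K (AdeleRing (𝓞 K) K) : K →* AdeleRing (𝓞 K) K)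

/-- The group of idele class characters of `K`: the continuous homomorphisms from the ideles to
the unit circle that are trivial on `Kˣ`. -/
def ideleClassCharacters : Subgroup (IdeleGroup K →ₜ* Circle) where
  carrier := {χ | ∀ a : Kˣ, χ (principalIdele K a) = 1}
  one_mem' _ := rfl
  mul_mem' {χ ψ} hχ hψ a := by
    rw [ContinuousMonoidHom.mul_apply, hχ a, hψ a, one_mul]
  inv_mem' {χ} hχ a := by
    change (χ (principalIdele K a))⁻¹ = 1
    rw [hχ a, inv_one]

/-- The type of idele class characters of `K`, a commutative group under multiplication. -/
abbrev IdeleClassCharacter : Type _ := ideleClassCharacters K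

/-- The norm of ideles from `K` to `ℚ`: the norm of the algebra of adeles of `K` over the ring
of adeles of `ℚ`, which is free of rank `[K : ℚ]`. -/
def ideleNorm : IdeleGroup K →* IdeleGroup ℚ :=
  letI : Algebra (AdeleRing (𝓞 ℚ) ℚ) (AdeleRing (𝓞 K) K) := (adeleMap ℚ K).toAlgebra
  Units.map (Algebra.norm (AdeleRing (𝓞 ℚ) ℚ))

variable {K}

/-- The automorphism of the ring of adeles induced by an automorphism `σ` of `K`; at a finite
place `v` it is the map `K_{σ⁻¹ v} → K_v` extending `σ`. -/
def galAdele (σ : K ≃ₐ[ℚ] K) : AdeleRing (𝓞 K) K →+* AdeleRing (𝓞 K) K :=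
  @adeleMap K K _ _ _ _ (σ : K →+* K).toAlgebra

theorem continuous_galAdele (σ : K ≃ₐ[ℚ] K) : Continuous (galAdele σ) :=
  @continuous_adeleMap K K _ _ _ _ (σ : K →+* K).toAlgebra

theorem galAdele_algebraMap (σ : K ≃ₐ[ℚ] K) (x : K) :
    galAdele σ (algebraMap K (AdeleRing (𝓞 K) K) x) =
      algebraMap K (AdeleRing (𝓞 K) K) (σ x) :=
  @adeleMap_algebraMap K K _ _ _ _ (σ : K →+* K).toAlgebra x

/-- The action of an automorphism of `K` on the ideles of `K`. -/
def galIdele (σ : K ≃ₐ[ℚ] K) : IdeleGroup K →ₜ* IdeleGroup K :=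
  ⟨Units.map (galAdele σ : AdeleRing (𝓞 K) K →* AdeleRing (𝓞 K) K),
    Continuous.units_map _ (continuous_galAdele σ)⟩

/-- The conjugate `x ↦ χ (σ x)` of an idele class character. -/
def conjChar (σ : K ≃ₐ[ℚ] K) (χ : IdeleClassCharacter K) : IdeleClassCharacter K :=
  ⟨χ.1.comp (galIdele σ), fun a => by
    have h : galIdele σ (principalIdele K a) =
        principalIdele K (Units.map (σ : K →* K) a) :=
      Units.ext (galAdele_algebraMap σ a)
    change χ.1 (galIdele σ (principalIdele K a)) = 1
    rw [h]
    exact χ.2 _⟩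

/-- `χ` arises from base change: `χ = ν ∘ N` for an idele class character `ν` of `ℚ`. -/
def IsBaseChange (χ : IdeleClassCharacter K) : Prop :=
  ∃ ν : IdeleClassCharacter ℚ, ∀ x : IdeleGroup K, χ.1 x = ν.1 (ideleNorm K x)

/-- `χ` is quadratic, that is, of exact order two. -/
def IsQuadratic (χ : IdeleClassCharacter K) : Prop := orderOf χ = 2

open Classical in
/-- The adele with component `x` at the finite place `v` and component `1` elsewhere. -/
def localAdele (v : HeightOneSpectrum (𝓞 K)) :
    v.adicCompletion K →* AdeleRing (𝓞 K) K where
  toFun x := ((1 : InfiniteAdeleRing K),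
    (RestrictedProduct.mulSingle (fun w : HeightOneSpectrum (𝓞 K) =>
      w.adicCompletionIntegers K) v x : FiniteAdeleRing (𝓞 K) K))
  map_one' := Prod.ext rfl (RestrictedProduct.mulSingle_one _ _)
  map_mul' _ _ := Prod.ext (one_mul _).symm (RestrictedProduct.mulSingle_mul _ _ _ _)

/-- The local component `χ_v` at a finite place `v`, a character of `K_vˣ`. -/
def localChar (χ : IdeleClassCharacter K) (v : HeightOneSpectrum (𝓞 K)) :
    (v.adicCompletion K)ˣ →* Circle :=
  (χ.1 : IdeleGroup K →* Circle).comp (Units.map (localAdele v))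

/-- The value `χ_v(a)` at a nonzero element `a` of `K`, seen in `K_v`. -/
def localValue (χ : IdeleClassCharacter K) (v : HeightOneSpectrum (𝓞 K)) (a : Kˣ) : Circle :=
  localChar χ v (Units.map (algebraMap K (v.adicCompletion K) : K →* v.adicCompletion K) a)

/-- The exponent of the conductor of `χ` at `v`: the least `n ≥ 0` such that `χ_v` is trivial on
the units `u` of the valuation ring with `u ≡ 1` modulo the `n`-th power of the maximal ideal.
It is zero exactly when `χ` is unramified at `v`. -/
def conductorExponent (χ : IdeleClassCharacter K) (v : HeightOneSpectrum (𝓞 K)) : ℕ :=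
  sInf {n : ℕ | ∀ u : (v.adicCompletion K)ˣ, Valued.v (u : v.adicCompletion K) = 1 →
    Valued.v ((u : v.adicCompletion K) - 1) ≤ WithZero.exp (-(n : ℤ)) → localChar χ v u = 1}

/-- The conductor of `χ`, an ideal of the ring of integers. -/
def conductorIdeal (χ : IdeleClassCharacter K) : Ideal (𝓞 K) :=
  ∏ᶠ v : HeightOneSpectrum (𝓞 K), v.asIdeal ^ conductorExponent χ v

end Ideles

section Conditions

variable {K : Type*} [Field K] [NumberField K]

/-- The place `v` lies above the prime number `p`. -/
def Above (v : HeightOneSpectrum (𝓞 K)) (p : ℕ) : Prop := (p : 𝓞 K) ∈ v.asIdeal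

variable (K) in
/-- The prime number `p` splits in the quadratic field `K`: there are two places above it. -/
def IsSplit (p : ℕ) : Prop :=
  p.Prime ∧ ∃ v w : HeightOneSpectrum (𝓞 K), v ≠ w ∧ Above v p ∧ Above w p

variable (K) in
/-- The prime number `p` is inert in `K`: it generates a prime ideal. -/
def IsInert (p : ℕ) : Prop := p.Prime ∧ (Ideal.span {(p : 𝓞 K)}).IsPrime

variable (K) in
/-- The prime number `p` ramifies in `K`: it is divisible by the square of a prime ideal. -/
def IsRamified (p : ℕ) : Prop :=
  p.Prime ∧ ∃ v : HeightOneSpectrum (𝓞 K), v.asIdeal ^ 2 ∣ Ideal.span {(p : 𝓞 K)}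

/-- `S` consists of exactly one place above each prime number that splits in `K`. -/
def IsChoiceOfSplitPlaces (S : Set (HeightOneSpectrum (𝓞 K))) : Prop :=
  (∀ p : ℕ, IsSplit K p → ∃! v, v ∈ S ∧ Above v p) ∧ ∀ v ∈ S, ∃ p : ℕ, IsSplit K p ∧ Above v p

/-- `m(v)`, the exponent of `v` in the nonzero ideal `f`. -/
def ordAt (v : HeightOneSpectrum (𝓞 K)) (f : Ideal (𝓞 K)) : ℕ := multiplicity v.asIdeal f

/-- Condition (A): no place above an odd inert prime divides `f`. -/
def CondA (f : Ideal (𝓞 K)) : Prop :=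
  ∀ (p : ℕ) (v : HeightOneSpectrum (𝓞 K)), IsInert K p → p ≠ 2 → Above v p → ¬ v.asIdeal ∣ f

/-- Condition (B): at most one place above a ramified prime `p ≡ 3 mod 4` divides `f`, and it
does so with exponent one. -/
def CondB (f : Ideal (𝓞 K)) : Prop :=
  {v : HeightOneSpectrum (𝓞 K) | v.asIdeal ∣ f ∧
      ∃ p : ℕ, IsRamified K p ∧ p % 4 = 3 ∧ Above v p}.Subsingleton ∧
    ∀ (p : ℕ) (v : HeightOneSpectrum (𝓞 K)), IsRamified K p → p % 4 = 3 → Above v p →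
      v.asIdeal ∣ f → ordAt v f = 1

/-- Condition (C): a place above a split prime `p` that divides `f` belongs to `S`, and its
exponent is `1` if `p` is odd, and `2` or `3` if `p = 2`. -/
def CondC (S : Set (HeightOneSpectrum (𝓞 K))) (f : Ideal (𝓞 K)) : Prop :=
  ∀ (p : ℕ) (v : HeightOneSpectrum (𝓞 K)), IsSplit K p → Above v p → v.asIdeal ∣ f →
    v ∈ S ∧ (p ≠ 2 → ordAt v f = 1) ∧ (p = 2 → ordAt v f = 2 ∨ ordAt v f = 3)

/-- The part of condition (D') on exponents: a place above `2` that divides `f` has exponent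
`2` or `5`. -/
def CondDExponent (f : Ideal (𝓞 K)) : Prop :=
  ∀ v : HeightOneSpectrum (𝓞 K), Above v 2 → v.asIdeal ∣ f → ordAt v f = 2 ∨ ordAt v f = 5

/-- A square root of `-1` as a unit of the field. -/
def muFour (i : K) (hi : i ^ 2 = -1) : Kˣ :=
  Units.mk0 i (by rintro rfl; norm_num at hi)

/-- The element `1 + π ^ 3` for `π = i - 1`, as a unit of the field. -/
def onePlusPiCubed (i : K) (hi : i ^ 2 = -1) : Kˣ :=
  Units.mk0 (1 + (i - 1) ^ 3) (by
    intro h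
    have h1 : (1 + (i - 1) ^ 3) * (3 - 2 * i) = 13 := by
      linear_combination (-2 * i ^ 2 + 9 * i - 13) * hi
    rw [h, zero_mul] at h1
    norm_num at h1)

/-- The part of condition (D') on local values: for a place `v` above `2`, one has
`χ_v(i) = -1` if `m(v) = 2`, and `χ_v(1 + π ^ 3) = 1` with `π = i - 1` if `m(v) = 5`. -/
def CondDValue (i : K) (hi : i ^ 2 = -1) (χ : IdeleClassCharacter K) : Prop :=
  ∀ v : HeightOneSpectrum (𝓞 K), Above v 2 →
    (ordAt v (conductorIdeal χ) = 2 → localValue χ v (muFour i hi) = -1) ∧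
    (ordAt v (conductorIdeal χ) = 5 → localValue χ v (onePlusPiCubed i hi) = 1)

/-- The conditions on an integral ideal `f` in (A), (B), (C) and (D'). -/
def IdealConditions (S : Set (HeightOneSpectrum (𝓞 K))) (f : Ideal (𝓞 K)) : Prop :=
  CondA f ∧ CondB f ∧ CondC S f ∧ CondDExponent f

/-- The character `χ`, with its conductor, satisfies (A), (B), (C) and (D'). -/
def IsNormalized (i : K) (hi : i ^ 2 = -1) (S : Set (HeightOneSpectrum (𝓞 K)))
    (χ : IdeleClassCharacter K) : Prop :=
  IdealConditions S (conductorIdeal χ) ∧ CondDValue i hi χ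

/-- `r(f)`, the number of places dividing `f` that lie above a prime `p ≡ 5 mod 8`. -/
def numFiveModEight (f : Ideal (𝓞 K)) : ℕ :=
  {v : HeightOneSpectrum (𝓞 K) | v.asIdeal ∣ f ∧
    ∃ p : ℕ, p.Prime ∧ p % 8 = 5 ∧ Above v p}.ncard

end Conditions

end IdeleClass

end

/-! Since `ℤ[i]` is principal, every idele is a principal idele times an idele that is a unit at all
finite places (`exists_principal_mul_integral`). An idele class character is thus determined on
these integral ideles, and a continuous character of them extends as soon as it kills the global
units (`exists_extension`). For `K` these units are the powers of `i`, and at the complex place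
everything is a square. So a quadratic character amounts to quadratic characters of the local unit
groups, finitely many of them nontrivial, whose values at `i` multiply to `1`
(`prod_toLocal_eq_one`, `exists_char_of_local`).

Locally, at an odd place the only ramified quadratic character on units is the residue symbol, with
exponent `1`. At the place above `2`, with `π = i - 1`, the residue field has two elements, so each
step of the filtration by higher units has order two; the steps `1, 2, 3, 4` are generated by `i`,
`-1 = i ^ 2`, `1 + π ^ 3` and `5`, and quadratic characters are trivial from level `5` on. Such a
character is given on units by its signs at `i`, `1 + π ^ 3` and `5`. Normalization then means that
odd ramified places are split and lie in `S`, and that the sign at `1 + π ^ 3` is `+1`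
(`isNormalized_iff`); the exponents `0, 2, 5` above `2` follow.

Base change characters are invariant under conjugation. Let `χ` and `η` be normalized with `χη`
invariant. At odd places `χη` is unramified, because of two conjugate places only one is in `S`. The
product formula at `i` makes its sign at `i` above `2` trivial; the sign at `1 + π ^ 3` is trivial
by normalization, hence by invariance so is the sign at the norm `13`, and `5 * 13 = 1 + 2 ^ 6`
gives the sign at `5`. So `χη = 1` (`eq_one_of_conj`). This gives uniqueness of the normalized twist
and, with `η = 1`, shows that a quadratic normalized character is not invariant.

To reach a normalized character, one multiplies by base changes of quadratic characters of `ℚ`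
ramified at one prime and possibly at infinity (`exists_baseChange`). They remove ramification at
the unwanted odd places, and one of them changes the sign at `1 + π ^ 3`, because `13` is not a
square modulo `8`. The real place of `ℚ` absorbs the unit `-1`, so these characters always exist.
Evaluating them on local ideles requires the adelic norm in the form `x * c x`, which rests on the
adeles of `K` fixed by `c` being those of `ℚ` (`exists_adeleMap_eq`, `adeleMap_ideleNorm`).

The parity statement is the product formula at `i`. An odd place in the conductor contributes `-1`
exactly when `p ≡ 5 mod 8`, since `i` is then a non-square in the residue field. Above `2` the
contribution is `-1` for exponent `2` and free for exponent `5` (`parity_of_exists`,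
`exists_of_parity`). -/

set_option linter.unusedSectionVars false

noncomputable section

namespace IdeleClass

/-! ### Integral adeles, their units, and components of ideles -/

section IntegralIdeles

variable (F : Type*) [Field F] [NumberField F]

/-- The ring of adeles that are integral at all finite places, with its product topology. -/
abbrev IntegralAdeles : Type _ :=
  InfiniteAdeleRing F × (∀ v : HeightOneSpectrum (𝓞 F), v.adicCompletionIntegers F)

/-- The inclusion of the integral adeles in the adeles. -/
def integralAdeleMap : IntegralAdeles F →+* AdeleRing (𝓞 F) F where
  toFun x := (x.1, (RestrictedProduct.structureMap _ _ _ x.2 : FiniteAdeleRing (𝓞 F) F))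
  map_one' := rfl
  map_mul' _ _ := rfl
  map_zero' := rfl
  map_add' _ _ := rfl

theorem isOpenEmbedding_integralAdeleMap : Topology.IsOpenEmbedding (integralAdeleMap F) := by
  have h : Topology.IsOpenEmbedding (RestrictedProduct.structureMap
      (fun v : HeightOneSpectrum (𝓞 F) => v.adicCompletion F)
      (fun v => (v.adicCompletionIntegers F : Set (v.adicCompletion F))) Filter.cofinite) :=
    RestrictedProduct.isOpenEmbedding_structureMap
      (fun _ => Valued.isOpen_valuationSubring _)
  exact Topology.IsOpenEmbedding.id.prodMap h

/-- The inclusion of the units of the integral adeles in the ideles. -/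
def integralIdele : (IntegralAdeles F)ˣ →* IdeleGroup F :=
  Units.map (integralAdeleMap F).toMonoidHom

theorem continuous_integralIdele : Continuous (integralIdele F) :=
  (isOpenEmbedding_integralAdeleMap F).continuous.units_map _

theorem isOpenEmbedding_integralIdele : Topology.IsOpenEmbedding (integralIdele F) := by
  have h := isOpenEmbedding_integralAdeleMap F
  have h1 : Topology.IsEmbedding ((integralAdeleMap F).toMonoidHom :
    IntegralAdeles F → AdeleRing (𝓞 F) F) := h.isEmbedding
  exact .of_isEmbedding_isOpenMap h1.units_map (Units.isOpenMap_map h.injective h.isOpenMap)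

variable {F}

/-- The component at `v` of a unit of the integral adeles. -/
def unitAt (v : HeightOneSpectrum (𝓞 F)) : (IntegralAdeles F)ˣ →* (v.adicCompletion F)ˣ :=
  Units.map (((v.adicCompletionIntegers F).subtype.comp
    (Pi.evalRingHom (fun v : HeightOneSpectrum (𝓞 F) => v.adicCompletionIntegers F) v)).comp
      (RingHom.snd (InfiniteAdeleRing F) _)).toMonoidHom

theorem valued_unitAt (v : HeightOneSpectrum (𝓞 F)) (u : (IntegralAdeles F)ˣ) :
    Valued.v (unitAt v u : v.adicCompletion F) = 1 := by
  refine (HeightOneSpectrum.adicCompletionIntegers.isUnit_iff_valued_eq_one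
    (a := u.val.2 v)).1 ?_
  exact (u.isUnit.map (RingHom.snd _ _)).map (Pi.evalRingHom _ v)

/-- The unit of the integral adeles with prescribed components. -/
def integralUnit (y : (InfiniteAdeleRing F)ˣ) (u : ∀ v : HeightOneSpectrum (𝓞 F),
    (v.adicCompletion F)ˣ) (hu : ∀ v, Valued.v (u v : v.adicCompletion F) = 1) :
    (IntegralAdeles F)ˣ where
  val := (y, fun v => ⟨u v, (hu v).le⟩)
  inv := (y⁻¹.val, fun v => ⟨(u v)⁻¹.val, by
    rw [HeightOneSpectrum.mem_adicCompletionIntegers, Units.val_inv_eq_inv_val, map_inv₀, hu v,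
      inv_one]⟩)
  val_inv := Prod.ext y.mul_inv (funext fun v => Subtype.ext (u v).mul_inv)
  inv_val := Prod.ext y.inv_mul (funext fun v => Subtype.ext (u v).inv_mul)

theorem unitAt_integralUnit (y : (InfiniteAdeleRing F)ˣ) (u : ∀ v : HeightOneSpectrum (𝓞 F),
    (v.adicCompletion F)ˣ) (hu : ∀ v, Valued.v (u v : v.adicCompletion F) = 1)
    (v : HeightOneSpectrum (𝓞 F)) : unitAt v (integralUnit y u hu) = u v :=
  Units.ext rfl

/-- The idele with component `x` at `v` and `1` elsewhere. -/
abbrev localIdele (v : HeightOneSpectrum (𝓞 F)) : (v.adicCompletion F)ˣ →* IdeleGroup F :=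
  Units.map (localAdele v)

theorem localAdele_snd_same (v : HeightOneSpectrum (𝓞 F)) (x : v.adicCompletion F) :
    (localAdele v x).2 v = x := by
  classical
  exact RestrictedProduct.mulSingle_eq_same _ _ _

theorem localAdele_snd_of_ne {v w : HeightOneSpectrum (𝓞 F)} (h : w ≠ v)
    (x : v.adicCompletion F) : (localAdele v x).2 w = 1 := by
  classical
  exact RestrictedProduct.mulSingle_eq_of_ne _ _ h

/-- The infinite component and the finite components of an adele, as ring homomorphisms. -/
def adeleFst : AdeleRing (𝓞 F) F →+* InfiniteAdeleRing F := RingHom.fst _ _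

def adeleAt (v : HeightOneSpectrum (𝓞 F)) : AdeleRing (𝓞 F) F →+* v.adicCompletion F :=
  (RestrictedProduct.evalRingHom (fun v : HeightOneSpectrum (𝓞 F) => v.adicCompletion F) v).comp
    (RingHom.snd (InfiniteAdeleRing F) (FiniteAdeleRing (𝓞 F) F))

theorem adele_ext {x y : AdeleRing (𝓞 F) F} (h1 : adeleFst x = adeleFst y)
    (h2 : ∀ v, adeleAt v x = adeleAt v y) : x = y :=
  Prod.ext h1 (FiniteAdeleRing.ext _ h2)

end IntegralIdeles

/-! ### Class number one: decomposing ideles and extending characters -/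

section Structure

variable {F : Type*} [Field F] [NumberField F]

theorem adeleAt_principalIdele (v : HeightOneSpectrum (𝓞 F)) (a : Fˣ) :
    adeleAt v (principalIdele F a).val = ((a : F) : v.adicCompletion F) := rfl

theorem adeleAt_integralIdele (v : HeightOneSpectrum (𝓞 F)) (u : (IntegralAdeles F)ˣ) :
    adeleAt v (integralIdele F u).val = unitAt v u := rfl

theorem adeleFst_integralIdele (u : (IntegralAdeles F)ˣ) :
    adeleFst (integralIdele F u).val = u.val.1 := rfl

theorem adeleAt_localIdele_same (v : HeightOneSpectrum (𝓞 F)) (x : (v.adicCompletion F)ˣ) :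
    adeleAt v (localIdele v x).val = x := localAdele_snd_same v x.val

theorem adeleAt_localIdele_of_ne {v w : HeightOneSpectrum (𝓞 F)} (h : w ≠ v)
    (x : (v.adicCompletion F)ˣ) : adeleAt w (localIdele v x).val = 1 :=
  localAdele_snd_of_ne h x.val

theorem adeleFst_localIdele (v : HeightOneSpectrum (𝓞 F)) (x : (v.adicCompletion F)ˣ) :
    adeleFst (localIdele v x).val = 1 := rfl

theorem adeleAt_ne_zero (v : HeightOneSpectrum (𝓞 F)) (x : IdeleGroup F) :
    adeleAt v x.val ≠ 0 := (x.isUnit.map (adeleAt v)).ne_zero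

theorem eventually_valued_adeleAt_eq_one (x : IdeleGroup F) :
    ∀ᶠ v in Filter.cofinite, Valued.v (adeleAt v x.val) = 1 :=
  (FiniteAdeleRing.isUnit_iff.1
    (x.isUnit.map (RingHom.snd (InfiniteAdeleRing F) (FiniteAdeleRing (𝓞 F) F)))).2

/-- The units of the integral adeles are the ideles that are units at all finite places. -/
theorem exists_integralIdele_eq (x : IdeleGroup F)
    (hx : ∀ v, Valued.v (adeleAt v x.val) = 1) : ∃ u, integralIdele F u = x := by
  refine ⟨integralUnit (Units.map adeleFst.toMonoidHom x)
    (fun v => Units.map (adeleAt v).toMonoidHom x) hx, ?_⟩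
  exact Units.ext (adele_ext rfl fun v => rfl)

/-- A generator of the prime at `w` has valuation `exp (-1)` at `w` and `1` elsewhere, so the
exponents can be adjusted one place at a time. -/
theorem exists_valuation_eq [IsPrincipalIdealRing (𝓞 F)] (s : Finset (HeightOneSpectrum (𝓞 F)))
    (n : HeightOneSpectrum (𝓞 F) → ℤ) :
    ∃ a : Fˣ, ∀ v : HeightOneSpectrum (𝓞 F), (v ∈ s → v.valuation F a = WithZero.exp (n v)) ∧
      (v ∉ s → v.valuation F (a : F) = 1) := by
  classical
  induction s using Finset.induction_on with
  | empty => exact ⟨1, fun v => ⟨fun h => absurd h (Finset.notMem_empty _), fun _ => by simp⟩⟩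
  | insert w s hw ih =>
    obtain ⟨a, ha⟩ := ih
    obtain ⟨ϖ, hϖ⟩ := (IsPrincipalIdealRing.principal w.asIdeal).principal
    have hϖ' : w.asIdeal = Ideal.span {ϖ} := hϖ
    have hϖ0 : ϖ ≠ 0 := by
      rintro rfl
      exact w.ne_bot (by rw [hϖ']; simp)
    have hw1 : w.valuation F (algebraMap (𝓞 F) F ϖ) = WithZero.exp (-1 : ℤ) := by
      rw [HeightOneSpectrum.valuation_of_algebraMap]
      exact w.intValuation_singleton hϖ0 hϖ'
    have hv1 : ∀ v : HeightOneSpectrum (𝓞 F), v ≠ w →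
        v.valuation F (algebraMap (𝓞 F) F ϖ) = 1 := by
      intro v hv
      rw [HeightOneSpectrum.valuation_eq_one_iff_notMem]
      intro h
      have h1 : w.asIdeal ≤ v.asIdeal := by
        rw [hϖ', Ideal.span_singleton_le_iff_mem]; exact h
      exact hv (HeightOneSpectrum.ext (w.isMaximal.eq_of_le v.isPrime.ne_top h1).symm)
    refine ⟨Units.mk0 (algebraMap (𝓞 F) F ϖ) (by simpa using hϖ0) ^ (-n w) * a, fun v => ?_⟩
    rw [Units.val_mul, map_mul, Units.val_zpow_eq_zpow_val, map_zpow₀, Units.val_mk0]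
    by_cases hv : v = w
    · subst hv
      refine ⟨fun _ => ?_, fun h => absurd (Finset.mem_insert_self _ _) h⟩
      rw [hw1, (ha v).2 hw, mul_one, ← WithZero.exp_zsmul]
      simp
    · rw [hv1 v hv, one_zpow, one_mul, Finset.mem_insert]
      simpa [hv] using ha v

/-- Class number one in idelic form: dividing by an element of `F` with the valuations of `x` leaves
a unit at every finite place. -/
theorem exists_principal_mul_integral [IsPrincipalIdealRing (𝓞 F)] (x : IdeleGroup F) :
    ∃ a u, x = principalIdele F a * integralIdele F u := by
  have hfin := eventually_valued_adeleAt_eq_one x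
  rw [Filter.eventually_cofinite] at hfin
  obtain ⟨a, ha⟩ := exists_valuation_eq hfin.toFinset
    (fun v => WithZero.log (Valued.v (adeleAt v x.val)))
  have hval : ∀ v : HeightOneSpectrum (𝓞 F), v.valuation F (a : F) = Valued.v (adeleAt v x.val) := by
    intro v
    by_cases hv : v ∈ hfin.toFinset
    · rw [(ha v).1 hv, WithZero.exp_log]
      exact (Valuation.ne_zero_iff _).2 (adeleAt_ne_zero v x)
    · rw [(ha v).2 hv]
      simpa using (not_not.1 fun h => hv (hfin.mem_toFinset.2 h)).symm
  obtain ⟨u, hu⟩ := exists_integralIdele_eq ((principalIdele F a)⁻¹ * x) (by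
    intro v
    have h1 : adeleAt v (principalIdele F a).val * adeleAt v ((principalIdele F a)⁻¹ * x).val =
        adeleAt v x.val := by
      rw [← map_mul, ← Units.val_mul, mul_inv_cancel_left]
    have h2 := congrArg Valued.v h1
    rw [map_mul, adeleAt_principalIdele, HeightOneSpectrum.valuedAdicCompletion_eq_valuation',
      hval] at h2
    exact (mul_eq_left₀ ((Valuation.ne_zero_iff _).2 (adeleAt_ne_zero v x))).1 h2)
  exact ⟨a, u, by rw [hu, mul_inv_cancel_left]⟩

/-- A continuous character of the units of the integral adeles that is trivial on the global
units extends to an idele class character, when the class number is one. -/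
theorem exists_extension [IsPrincipalIdealRing (𝓞 F)] (Ψ : (IntegralAdeles F)ˣ →* Circle)
    (hc : Continuous Ψ)
    (h : ∀ (a : Fˣ) (u : (IntegralAdeles F)ˣ), principalIdele F a = integralIdele F u → Ψ u = 1) :
    ∃ χ : IdeleClassCharacter F, ∀ u, χ.1 (integralIdele F u) = Ψ u := by
  choose a u hau using exists_principal_mul_integral (F := F)
  -- Two decompositions of `x` differ by a global unit, on which `Ψ` is trivial. So `Ψ (u x)` does
  -- not depend on the choice, and multiplicativity follows.
  have key : ∀ (x : IdeleGroup F) (b : Fˣ) (w : (IntegralAdeles F)ˣ),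
      x = principalIdele F b * integralIdele F w → Ψ (u x) = Ψ w := by
    intro x b w hx
    have h1 := h (b⁻¹ * a x) (w * (u x)⁻¹) (by
      rw [map_mul, map_mul, map_inv, map_inv, eq_mul_inv_iff_mul_eq, mul_assoc, ← hau x, hx,
        inv_mul_cancel_left])
    rw [map_mul, map_inv] at h1
    exact (mul_inv_eq_one.1 h1).symm
  let χ : IdeleGroup F →* Circle := MonoidHom.mk' (fun x => Ψ (u x)) (fun x y => by
    rw [← map_mul]
    refine key _ (a x * a y) _ ?_
    rw [map_mul, map_mul, mul_mul_mul_comm, ← hau, ← hau])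
  have hχ : ∀ w, χ (integralIdele F w) = Ψ w := fun w =>
    key _ 1 w (by rw [map_one, one_mul])
  have hcont : Continuous χ := by
    refine continuous_of_continuousAt_one χ ?_
    -- The integral ideles are open, so continuity at `1` may be tested on them.
    have h1 : ContinuousAt (χ ∘ integralIdele F) 1 := by
      have : χ ∘ integralIdele F = Ψ := funext hχ
      rw [this]; exact hc.continuousAt
    have := (isOpenEmbedding_integralIdele F).continuousAt_iff.1 h1
    rwa [map_one] at this
  refine ⟨⟨⟨χ, hcont⟩, fun b => ?_⟩, hχ⟩
  change χ (principalIdele F b) = 1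
  have : Ψ (u (principalIdele F b)) = Ψ 1 := key _ b 1 (by rw [map_one, mul_one])
  rw [map_one] at this
  exact this

end Structure

/-! ### Quadratic characters have an open kernel and finitely many local factors -/

section OpenKernel

variable {F : Type*} [Field F] [NumberField F]

theorem circle_eq_one_or_neg_one {z : Circle} (h : z ^ 2 = 1) : z = 1 ∨ z = -1 := by
  have h1 : (z : ℂ) ^ 2 = 1 := by exact_mod_cast congrArg (Subtype.val) h
  rcases (sq_eq_sq_iff_eq_or_eq_neg.1 (h1.trans (one_pow 2).symm)) with h | h
  · left; exact Subtype.ext h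
  · right; exact Subtype.ext (by simpa using h)

theorem circle_neg_one_ne_one : (-1 : Circle) ≠ 1 := by
  intro h
  have h1 := congrArg (Subtype.val) h
  simp at h1
  norm_num [Complex.ext_iff] at h1

theorem exists_ball_subset (v : HeightOneSpectrum (𝓞 F)) {a : v.adicCompletion F}
    {s : Set (v.adicCompletion F)} (hs : s ∈ nhds a) :
    ∃ n : ℕ, ∀ x : v.adicCompletion F, Valued.v (x - a) ≤ WithZero.exp (-(n : ℤ)) → x ∈ s := by
  obtain ⟨γ, hγ⟩ := Valued.mem_nhds.1 hs
  have h0 : MonoidWithZeroHom.ValueGroup₀.embedding γ.1 ≠ 0 := by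
    rw [Ne, map_eq_zero]
    exact γ.ne_zero
  -- The summand `1` turns the strict inequality that defines a valuation neighbourhood into a
  -- non-strict bound.
  refine ⟨(1 - WithZero.log (MonoidWithZeroHom.ValueGroup₀.embedding γ.1)).toNat,
    fun x hx => hγ ?_⟩
  rw [Set.mem_ofPred_eq, Valuation.restrict_lt_iff_lt_embedding]
  refine hx.trans_lt ?_
  rw [← WithZero.exp_log h0, WithZero.exp_lt_exp, WithZero.log_exp]
  have := Int.self_le_toNat (1 - WithZero.log (MonoidWithZeroHom.ValueGroup₀.embedding γ.1))
  omega

theorem ball_mem_nhds (v : HeightOneSpectrum (𝓞 F)) (a : v.adicCompletion F) (n : ℤ) :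
    {x : v.adicCompletion F | Valued.v (x - a) ≤ WithZero.exp n} ∈ nhds a := by
  obtain ⟨z, hz⟩ := HeightOneSpectrum.valuedAdicCompletion_surjective F v (WithZero.exp n)
  have hz0 : (Valued.v : Valuation (v.adicCompletion F) _).restrict z ≠ 0 := by
    rw [Valuation.ne_zero_iff, ← Valuation.ne_zero_iff (Valued.v : Valuation _ _), hz]
    exact WithZero.exp_ne_zero
  refine Valued.mem_nhds.2 ⟨Units.mk0 _ hz0, fun x hx => ?_⟩
  rw [Set.mem_ofPred_eq, Units.val_mk0, Valuation.restrict_lt_iff, hz] at hx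
  exact hx.le

/-- A sign is `1` once it differs from `-1`, so it is enough to have a neighbourhood of `1` mapped
away from `-1`. Basic neighbourhoods in the product topology constrain only finitely many finite
places. -/
theorem exists_open_kernel (f : (IntegralAdeles F)ˣ →* Circle) (hc : Continuous f)
    (hf : ∀ u, f u ^ 2 = 1) : ∃ (T : Finset (HeightOneSpectrum (𝓞 F))) (n : ℕ),
      ∀ u : (IntegralAdeles F)ˣ, u.val.1 = 1 →
        (∀ v ∈ T, Valued.v ((unitAt v u : v.adicCompletion F) - 1) ≤ WithZero.exp (-(n : ℤ))) →
        f u = 1 := by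
  classical
  have h1 : f ⁻¹' {-1}ᶜ ∈ nhds 1 := by
    refine (isOpen_compl_singleton.preimage hc).mem_nhds ?_
    simpa using circle_neg_one_ne_one.symm
  rw [Units.isInducing_embedProduct.nhds_eq_comap, Filter.mem_comap] at h1
  obtain ⟨W, hW, hWf⟩ := h1
  rw [map_one, Prod.one_eq_mk, nhds_prod_eq, Filter.mem_prod_iff] at hW
  obtain ⟨A, hA, B, hB, hAB⟩ := hW
  have hB' : MulOpposite.op ⁻¹' B ∈ nhds (1 : IntegralAdeles F) :=
    MulOpposite.continuous_op.continuousAt.preimage_mem_nhds hB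
  have hC := Filter.inter_mem hA hB'
  rw [Prod.one_eq_mk, nhds_prod_eq, Filter.mem_prod_iff] at hC
  obtain ⟨S, hS, P, hP, hSP⟩ := hC
  rw [nhds_pi, Filter.mem_pi] at hP
  obtain ⟨I, hI, t, ht, hIt⟩ := hP
  have h2 : ∀ v : HeightOneSpectrum (𝓞 F), ∃ n : ℕ, ∀ x : v.adicCompletionIntegers F,
      Valued.v ((x : v.adicCompletion F) - 1) ≤ WithZero.exp (-(n : ℤ)) → x ∈ t v := by
    intro v
    obtain ⟨s, hs, hst⟩ := mem_nhds_subtype _ _ _ |>.1 (ht v)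
    obtain ⟨n, hn⟩ := exists_ball_subset v hs
    exact ⟨n, fun x hx => hst (hn x hx)⟩
  choose n hn using h2
  refine ⟨hI.toFinset, hI.toFinset.sup n, fun u hu1 hu => ?_⟩
  have key : ∀ u : (IntegralAdeles F)ˣ, u.val.1 = 1 → (∀ v ∈ hI.toFinset,
      Valued.v ((unitAt v u : v.adicCompletion F) - 1) ≤
        WithZero.exp (-((hI.toFinset.sup n : ℕ) : ℤ))) → u.val ∈ A ∩ MulOpposite.op ⁻¹' B := by
    intro u hu1 hu
    refine hSP ⟨?_, hIt fun v hv => hn v _ ((hu v (hI.mem_toFinset.2 hv)).trans ?_)⟩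
    · rw [hu1]; exact mem_of_mem_nhds hS
    · rw [WithZero.exp_le_exp, neg_le_neg_iff, Nat.cast_le]
      exact Finset.le_sup (hI.mem_toFinset.2 hv)
  -- The unit topology also controls inverses. No smaller ball is needed, since `u⁻¹ - 1 = -u⁻¹ * (u
  -- - 1)` has the same valuation as `u - 1` when `u` is a unit.
  have hinv : (u⁻¹).val ∈ A ∩ MulOpposite.op ⁻¹' B := by
    refine key _ ?_ fun v hv => ?_
    · have : (u⁻¹).val.1 * u.val.1 = 1 := congrArg Prod.fst u.inv_mul
      rwa [hu1, mul_one] at this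
    · rw [map_inv, Units.val_inv_eq_inv_val]
      have h0 : (unitAt v u : v.adicCompletion F) ≠ 0 := (unitAt v u).ne_zero
      have : (unitAt v u : v.adicCompletion F)⁻¹ - 1 =
          -((unitAt v u : v.adicCompletion F)⁻¹ * ((unitAt v u : v.adicCompletion F) - 1)) := by
        field_simp
        ring
      rw [this, Valuation.map_neg, map_mul, map_inv₀, valued_unitAt, inv_one, one_mul]
      exact hu v hv
  have h3 : f u ≠ -1 := hWf (hAB ⟨(key u hu1 hu).1, hinv.2⟩)
  exact (circle_eq_one_or_neg_one (hf u)).resolve_right h3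

/-- A quadratic character on the units of the integral adeles is the product of its local
components over a finite set of places. -/
theorem exists_finset_eq_prod (χ : IdeleClassCharacter F) (hχ : χ ^ 2 = 1) :
    ∃ (T : Finset (HeightOneSpectrum (𝓞 F))) (n : ℕ),
      (∀ u : (IntegralAdeles F)ˣ, u.val.1 = 1 →
        χ.1 (integralIdele F u) = ∏ v ∈ T, localChar χ v (unitAt v u)) ∧
      (∀ v ∉ T, ∀ x : (v.adicCompletion F)ˣ, Valued.v (x : v.adicCompletion F) = 1 →
        localChar χ v x = 1) ∧
      ∀ (v : HeightOneSpectrum (𝓞 F)) (x : (v.adicCompletion F)ˣ),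
        Valued.v (x : v.adicCompletion F) = 1 →
        Valued.v ((x : v.adicCompletion F) - 1) ≤ WithZero.exp (-(n : ℤ)) →
        localChar χ v x = 1 := by
  classical
  have hsq : ∀ x, χ.1 x ^ 2 = 1 := fun x => by
    have := congrArg (fun ψ : IdeleClassCharacter F => ψ.1 x) hχ
    exact this
  obtain ⟨T, n, hT⟩ := exists_open_kernel ((χ.1 : IdeleGroup F →* Circle).comp (integralIdele F))
    (χ.1.continuous_toFun.comp (continuous_integralIdele F)) (fun u => hsq _)
  have hloc : ∀ (v : HeightOneSpectrum (𝓞 F)) (x : (v.adicCompletion F)ˣ),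
      Valued.v (x : v.adicCompletion F) = 1 →
      (v ∈ T → Valued.v ((x : v.adicCompletion F) - 1) ≤ WithZero.exp (-(n : ℤ))) →
      localChar χ v x = 1 := by
    intro v x hx hxn
    let u := integralUnit (1 : (InfiniteAdeleRing F)ˣ)
      (Function.update (fun w : HeightOneSpectrum (𝓞 F) => (1 : (w.adicCompletion F)ˣ)) v x)
      (fun w => by
        by_cases h : w = v
        · subst h; simpa using hx
        · simp [h])
    have h1 : localIdele v x = integralIdele F u := by
      refine Units.ext (adele_ext rfl fun w => ?_)
      by_cases h : w = v
      · subst h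
        rw [adeleAt_localIdele_same, adeleAt_integralIdele, unitAt_integralUnit,
          Function.update_self]
      · rw [adeleAt_localIdele_of_ne h, adeleAt_integralIdele, unitAt_integralUnit,
          Function.update_of_ne h, Units.val_one]
    change χ.1 (localIdele v x) = 1
    rw [h1]
    refine hT u rfl fun w hw => ?_
    rw [unitAt_integralUnit]
    by_cases h : w = v
    · subst h
      rw [Function.update_self]; exact hxn hw
    · rw [Function.update_of_ne h, Units.val_one, sub_self, map_zero]
      exact zero_le
  refine ⟨T, n, fun u hu => ?_, fun v hv x hx => hloc v x hx fun h => absurd h hv,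
    fun v x hx hxn => hloc v x hx fun _ => hxn⟩
  -- `u'` is `u` with its components in `T` replaced by `1`; it lies in the kernel, so only the
  -- local factors at `T` survive.
  let u' := integralUnit (1 : (InfiniteAdeleRing F)ˣ)
    (fun w => if w ∈ T then 1 else unitAt w u) (fun w => by
      split_ifs
      · simp
      · exact valued_unitAt w u)
  have h1 : integralIdele F u = (∏ v ∈ T, localIdele v (unitAt v u)) * integralIdele F u' := by
    refine Units.ext (adele_ext ?_ fun w => ?_)
    · rw [Units.val_mul, Units.coe_prod, map_mul, map_prod, adeleFst_integralIdele, hu,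
        adeleFst_integralIdele, Finset.prod_eq_one fun v _ => adeleFst_localIdele v _, one_mul]
      rfl
    · rw [Units.val_mul, Units.coe_prod, map_mul, map_prod, adeleAt_integralIdele,
        adeleAt_integralIdele, unitAt_integralUnit]
      by_cases hw : w ∈ T
      · rw [Finset.prod_eq_single_of_mem w hw fun v _ hv => adeleAt_localIdele_of_ne hv.symm _,
          adeleAt_localIdele_same, if_pos hw, Units.val_one, mul_one]
      · rw [Finset.prod_eq_one fun v hv => adeleAt_localIdele_of_ne
          (ne_of_mem_of_not_mem hv hw).symm _, if_neg hw, one_mul]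
  have h2 : χ.1 (integralIdele F u') = 1 := by
    refine hT u' rfl fun w hw => ?_
    rw [unitAt_integralUnit, if_pos hw, Units.val_one, sub_self, map_zero]
    exact zero_le
  rw [h1, map_mul, h2, mul_one, map_prod]
  rfl

end OpenKernel

/-! ### The ring of integers is `ℤ[i]` -/

section Gauss

variable {K : Type*} [Field K] [NumberField K] {i : K}

theorem ne_rat_of_sq_eq_neg_one (hi : i ^ 2 = -1) (a : ℚ) : i ≠ a := by
  rintro rfl
  have h : a ^ 2 = -1 := by exact_mod_cast hi
  nlinarith [sq_nonneg a]

theorem exists_rat_add_rat_mul (hK : Module.finrank ℚ K = 2) (hi : i ^ 2 = -1) (x : K) :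
    ∃ a b : ℚ, x = a + b * i := by
  have hli : LinearIndependent ℚ ![(1 : K), i] := by
    rw [LinearIndependent.pair_iff]
    intro s t h
    have h' : (s : K) + t * i = 0 := by simpa [Algebra.smul_def] using h
    by_cases ht : t = 0
    · subst ht
      simpa using h'
    · exfalso
      refine ne_rat_of_sq_eq_neg_one hi (-s / t) ?_
      have ht' : (t : K) ≠ 0 := by exact_mod_cast ht
      push_cast
      field_simp
      linear_combination h'
  have hspan := hli.span_eq_top_of_card_eq_finrank (by simp [hK])
  have hx : x ∈ Submodule.span ℚ (Set.range ![(1 : K), i]) := by rw [hspan]; trivial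
  simp only [Matrix.range_cons, Matrix.range_empty, Set.union_empty, Set.singleton_union] at hx
  obtain ⟨a, b, h⟩ := Submodule.mem_span_pair.1 hx
  exact ⟨a, b, by rw [← h]; simp [Algebra.smul_def]⟩

variable {c : K ≃ₐ[ℚ] K}

theorem conj_i (hK : Module.finrank ℚ K = 2) (hi : i ^ 2 = -1) (hc : c ≠ 1) : c i = -i := by
  have h : (c i) ^ 2 = i ^ 2 := by rw [← map_pow, hi, map_neg, map_one]
  refine (sq_eq_sq_iff_eq_or_eq_neg.1 h).resolve_left fun h => hc ?_
  ext x
  obtain ⟨a, b, rfl⟩ := exists_rat_add_rat_mul hK hi x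
  simp [h]

theorem conj_add_mul (hci : c i = -i) (a b : ℚ) : c (a + b * i) = a - b * i := by
  simp [hci, sub_eq_add_neg]

theorem conj_conj (hK : Module.finrank ℚ K = 2) (hi : i ^ 2 = -1) (hci : c i = -i) (x : K) :
    c (c x) = x := by
  obtain ⟨a, b, rfl⟩ := exists_rat_add_rat_mul hK hi x
  simp [hci]

/-- A square root of `-1` as an algebraic integer. -/
def intI (hi : i ^ 2 = -1) : 𝓞 K :=
  ⟨i, by
    refine IsIntegral.of_pow (n := 2) (by norm_num) ?_
    rw [hi]
    exact isIntegral_one.neg⟩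

theorem coe_intI (hi : i ^ 2 = -1) : ((intI hi : 𝓞 K) : K) = i := rfl

theorem intI_sq (hi : i ^ 2 = -1) : intI hi ^ 2 = -1 := by
  apply RingOfIntegers.ext
  simpa [coe_intI] using hi

theorem exists_int_of_isIntegral_rat (a : ℚ) (h : IsIntegral ℤ (a : K)) : ∃ m : ℤ, a = m := by
  have h1 : IsIntegral ℤ a := by
    have : IsIntegral ℤ (algebraMap ℚ K a) := by simpa using h
    exact (isIntegral_algebraMap_iff (algebraMap ℚ K).injective).1 this
  obtain ⟨m, hm⟩ := IsIntegrallyClosed.isIntegral_iff.1 h1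
  exact ⟨m, by simpa using hm.symm⟩

/-- The elements `2a`, `2b` and `a ^ 2 + b ^ 2` are rational integers, obtained from `x + c x`, `-i
(x - c x)` and `x * c x`. Then `(2a) ^ 2 + (2b) ^ 2` is divisible by `4`, which forces `2a` and `2b`
to be even. -/
theorem exists_int_add_int_mul (hK : Module.finrank ℚ K = 2) (hi : i ^ 2 = -1) (hci : c i = -i)
    (x : 𝓞 K) : ∃ m n : ℤ, x = m + n * intI hi := by
  obtain ⟨a, b, hab⟩ := exists_rat_add_rat_mul hK hi (x : K)
  have hx : IsIntegral ℤ (x : K) := x.isIntegral_coe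
  have hcx : IsIntegral ℤ (c (x : K)) := hx.map c.toRingHom.toIntAlgHom
  obtain ⟨s, hs⟩ := exists_int_of_isIntegral_rat (K := K) (2 * a) (by
    have := hx.add hcx
    rw [hab, conj_add_mul hci, show (a + b * i + (a - b * i) : K) = ((2 * a : ℚ) : K) by
        push_cast; ring] at this
    exact this)
  obtain ⟨t, ht⟩ := exists_int_of_isIntegral_rat (K := K) (2 * b) (by
    have := (hx.sub hcx).mul (intI hi).isIntegral_coe.neg
    rw [hab, conj_add_mul hci, show (a + b * i - (a - b * i) : K) * -((intI hi : 𝓞 K) : K) =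
      ((2 * b : ℚ) : K) by
        rw [coe_intI]; push_cast; linear_combination (-2 * (b : K)) * hi] at this
    exact this)
  obtain ⟨n, hn⟩ := exists_int_of_isIntegral_rat (K := K) (a ^ 2 + b ^ 2) (by
    have := hx.mul hcx
    rw [hab, conj_add_mul hci, show (a + b * i : K) * (a - b * i) = ((a ^ 2 + b ^ 2 : ℚ) : K) by
        push_cast; linear_combination (-(b : K) ^ 2) * hi] at this
    exact this)
  have h4 : s ^ 2 + t ^ 2 = 4 * n := by
    have : ((s ^ 2 + t ^ 2 : ℤ) : ℚ) = ((4 * n : ℤ) : ℚ) := by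
      push_cast
      rw [← hs, ← ht, ← hn]; ring
    exact_mod_cast this
  have hpar : 2 ∣ s ∧ 2 ∣ t := by
    have h5 : (s ^ 2 + t ^ 2) % 4 = 0 := by rw [h4]; simp
    rcases Int.even_or_odd' s with ⟨s', rfl | rfl⟩ <;> rcases Int.even_or_odd' t with ⟨t', rfl | rfl⟩
    · exact ⟨⟨s', rfl⟩, ⟨t', rfl⟩⟩
    all_goals
      exfalso
      first
      | have : (2 * s') ^ 2 + (2 * t' + 1) ^ 2 = 4 * (s' ^ 2 + t' ^ 2 + t') + 1 := by ring
        omega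
      | have : (2 * s' + 1) ^ 2 + (2 * t') ^ 2 = 4 * (s' ^ 2 + t' ^ 2 + s') + 1 := by ring
        omega
      | have : (2 * s' + 1) ^ 2 + (2 * t' + 1) ^ 2 =
            4 * (s' ^ 2 + t' ^ 2 + s' + t') + 2 := by ring
        omega
  obtain ⟨⟨s', rfl⟩, ⟨t', rfl⟩⟩ := hpar
  refine ⟨s', t', RingOfIntegers.ext ?_⟩
  have ha : a = s' := by push_cast at hs; linarith
  have hb : b = t' := by push_cast at ht; linarith
  rw [hab, ha, hb]
  simp [coe_intI]

theorem isPrincipalIdealRing_of_sq_eq_neg_one (hK : Module.finrank ℚ K = 2) (hi : i ^ 2 = -1)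
    (hci : c i = -i) : IsPrincipalIdealRing (𝓞 K) := by
  let φ : GaussianInt →+* 𝓞 K := Zsqrtd.lift ⟨intI hi, by
    rw [← sq, intI_sq]; norm_num⟩
  refine IsPrincipalIdealRing.of_surjective φ fun x => ?_
  obtain ⟨m, n, rfl⟩ := exists_int_add_int_mul hK hi hci x
  exact ⟨⟨m, n⟩, by simp [φ]⟩

end Gauss

/-! ### Valuations and the place below -/

section Below

variable (L K : Type*) [Field L] [NumberField L] [Field K] [NumberField K] [Algebra L K]

theorem mem_below {v : HeightOneSpectrum (𝓞 K)} {x : 𝓞 L} {y : 𝓞 K}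
    (h : (y : K) = algebraMap L K x) : x ∈ (below L K v).asIdeal ↔ y ∈ v.asIdeal := by
  have : algebraMap (𝓞 L) (𝓞 K) x = y := RingOfIntegers.ext h.symm
  rw [← this]
  rfl

theorem exists_valuation_below (v : HeightOneSpectrum (𝓞 K)) :
    ∃ e : ℕ, e ≠ 0 ∧ ∀ x : L, v.valuation K (algebraMap L K x) =
      (below L K v).valuation L x ^ e :=
  ⟨_, Ideal.IsDedekindDomain.ramificationIdx'_ne_zero_of_liesOver v.asIdeal (below L K v).ne_bot,
    fun x => (HeightOneSpectrum.valuation_liesOver K (below L K v) v x).symm⟩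

/-- A uniformizer of `K` comes from `L`, so its exponent `-1` is a multiple of the ramification
index, which must be `1`. This serves automorphisms, regarded as extensions of `K` by itself. -/
theorem valuation_below_of_surjective (h : Function.Surjective (algebraMap L K))
    (v : HeightOneSpectrum (𝓞 K)) (x : L) :
    (below L K v).valuation L x = v.valuation K (algebraMap L K x) := by
  obtain ⟨e, he0, he⟩ := exists_valuation_below L K v
  obtain ⟨z, hz⟩ := v.valuation_exists_uniformizer K
  obtain ⟨z, rfl⟩ := h z
  rw [he] at hz
  have he1 : e = 1 := by
    have h1 := congrArg WithZero.log hz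
    rw [WithZero.log_pow, WithZero.log_exp, nsmul_eq_mul] at h1
    have h2 := Int.isUnit_iff.1 (IsUnit.of_mul_eq_one (a := (e : ℤ))
      (-WithZero.log ((below L K v).valuation L z)) (by linarith))
    omega
  rw [he, he1, pow_one]

end Below

/-! ### Conjugation of places -/

section Conj

variable {K : Type*} [Field K] [NumberField K]

/-- The place `σ⁻¹ v`. -/
def conjPlace (σ : K ≃ₐ[ℚ] K) (v : HeightOneSpectrum (𝓞 K)) : HeightOneSpectrum (𝓞 K) :=
  @below K K _ _ (σ : K →+* K).toAlgebra v

theorem mem_conjPlace {σ : K ≃ₐ[ℚ] K} {v : HeightOneSpectrum (𝓞 K)} {x y : 𝓞 K}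
    (h : (y : K) = σ x) : x ∈ (conjPlace σ v).asIdeal ↔ y ∈ v.asIdeal :=
  @mem_below K K _ _ _ _ (σ : K →+* K).toAlgebra v x y h

theorem valuation_conjPlace (σ : K ≃ₐ[ℚ] K) (v : HeightOneSpectrum (𝓞 K)) (x : K) :
    (conjPlace σ v).valuation K x = v.valuation K (σ x) :=
  @valuation_below_of_surjective K K _ _ _ _ (σ : K →+* K).toAlgebra σ.surjective v x

end Conj

/-! ### Decomposition of primes in `ℚ(i)` through the action of conjugation on places -/

section Places

variable {K : Type*} [Field K] [NumberField K]

/-- The residue characteristic of a finite place. -/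
def resChar (v : HeightOneSpectrum (𝓞 K)) : ℕ := Ideal.absNorm (Ideal.under ℤ v.asIdeal)

theorem prime_resChar (v : HeightOneSpectrum (𝓞 K)) : (resChar v).Prime := by
  have : NeZero v.asIdeal := ⟨v.ne_bot⟩
  have := v.isPrime
  exact Nat.absNorm_under_prime v.asIdeal

theorem intCast_mem_iff (v : HeightOneSpectrum (𝓞 K)) (m : ℤ) :
    (m : 𝓞 K) ∈ v.asIdeal ↔ (resChar v : ℤ) ∣ m := Int.cast_mem_ideal_iff

theorem above_iff_dvd (v : HeightOneSpectrum (𝓞 K)) (p : ℕ) : Above v p ↔ resChar v ∣ p := by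
  have := intCast_mem_iff v p
  rw [Int.natCast_dvd_natCast, Int.cast_natCast] at this
  exact this

theorem above_iff (v : HeightOneSpectrum (𝓞 K)) {p : ℕ} (hp : p.Prime) :
    Above v p ↔ resChar v = p := by
  rw [above_iff_dvd, Nat.prime_dvd_prime_iff_eq (prime_resChar v) hp]

theorem above_resChar (v : HeightOneSpectrum (𝓞 K)) : Above v (resChar v) :=
  (above_iff v (prime_resChar v)).2 rfl

/-- `K = ℚ(i)`, with nontrivial automorphism `c`. -/
structure IsGaussian (i : K) (c : K ≃ₐ[ℚ] K) : Prop where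
  finrank : Module.finrank ℚ K = 2
  sq : i ^ 2 = -1
  conj : c i = -i

variable {i : K} {c : K ≃ₐ[ℚ] K} (h : IsGaussian i c)

theorem resChar_conjPlace (c : K ≃ₐ[ℚ] K) (v : HeightOneSpectrum (𝓞 K)) :
    resChar (conjPlace c v) = resChar v := by
  have h : Above v (resChar (conjPlace c v)) :=
    (mem_conjPlace (by simp)).1 (above_resChar (conjPlace c v))
  exact ((above_iff v (prime_resChar _)).1 h).symm

namespace IsGaussian

include h in
theorem exists_conj (x : 𝓞 K) : ∃ m n : ℤ, x = m + n * intI h.sq ∧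
    (m - n * intI h.sq : 𝓞 K) = c x := by
  obtain ⟨m, n, rfl⟩ := exists_int_add_int_mul h.finrank h.sq h.conj x
  refine ⟨m, n, rfl, ?_⟩
  simp [coe_intI, h.conj, sub_eq_add_neg]

include h in
theorem mem_conj_iff (v : HeightOneSpectrum (𝓞 K)) (m n : ℤ) :
    (m + n * intI h.sq : 𝓞 K) ∈ (conjPlace c v).asIdeal ↔ (m - n * intI h.sq : 𝓞 K) ∈ v.asIdeal := by
  refine mem_conjPlace ?_
  simp [coe_intI, h.conj, sub_eq_add_neg]

include h in
theorem conjPlace_conjPlace (v : HeightOneSpectrum (𝓞 K)) : conjPlace c (conjPlace c v) = v := by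
  refine HeightOneSpectrum.ext (Ideal.ext fun x => ?_)
  obtain ⟨m, n, rfl⟩ := exists_int_add_int_mul h.finrank h.sq h.conj x
  rw [h.mem_conj_iff]
  have := h.mem_conj_iff v m (-n)
  push_cast at this
  rw [neg_mul, ← sub_eq_add_neg, sub_neg_eq_add] at this
  exact this

include h in
theorem intI_mul_mem_iff (v : HeightOneSpectrum (𝓞 K)) (x : 𝓞 K) :
    x * intI h.sq ∈ v.asIdeal ↔ x ∈ v.asIdeal := by
  refine ⟨fun hx => ?_, fun hx => v.asIdeal.mul_mem_right _ hx⟩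
  have := v.asIdeal.mul_mem_right (-intI h.sq) hx
  have h1 : x * intI h.sq * -intI h.sq = x := by linear_combination (-x) * intI_sq h.sq
  rwa [h1] at this

include h in
-- Both `m + n i` and `m - n i` lie in `v`, hence so do `2m` and `2n`, and `2` is invertible there.
theorem dvd_of_mem {v : HeightOneSpectrum (𝓞 K)} (hv : resChar v ≠ 2) {m n : ℤ}
    (h1 : (m + n * intI h.sq : 𝓞 K) ∈ v.asIdeal)
    (h2 : (m + n * intI h.sq : 𝓞 K) ∈ (conjPlace c v).asIdeal) :
    (resChar v : ℤ) ∣ m ∧ (resChar v : ℤ) ∣ n := by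
  rw [h.mem_conj_iff] at h2
  have hp := Nat.prime_iff_prime_int.1 (prime_resChar v)
  have hp2 : ¬ (resChar v : ℤ) ∣ 2 := by
    intro hd
    exact hv ((Nat.prime_dvd_prime_iff_eq (prime_resChar v) Nat.prime_two).1 (by exact_mod_cast hd))
  constructor
  · have h3 := v.asIdeal.add_mem h1 h2
    rw [show (m + n * intI h.sq + (m - n * intI h.sq) : 𝓞 K) = ((2 * m : ℤ) : 𝓞 K) by
      push_cast; ring, intCast_mem_iff] at h3
    exact (hp.dvd_or_dvd h3).resolve_left hp2
  · have h3 := v.asIdeal.sub_mem h1 h2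
    rw [show (m + n * intI h.sq - (m - n * intI h.sq) : 𝓞 K) = ((2 * n : ℤ) : 𝓞 K) * intI h.sq by
      push_cast; ring, h.intI_mul_mem_iff, intCast_mem_iff] at h3
    exact (hp.dvd_or_dvd h3).resolve_left hp2

theorem eq_of_le {v w : HeightOneSpectrum (𝓞 K)} (hvw : v.asIdeal ≤ w.asIdeal) : v = w :=
  HeightOneSpectrum.ext (v.isMaximal.eq_of_le w.isPrime.ne_top hvw)

include h in
-- `(i - 1) ^ 2 = -2i` puts `i - 1` in the ideal. Conversely `m + n i ≡ m + n` modulo `i - 1`, and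
-- an even integer is a multiple of `i - 1` because `2 = -(i - 1)(i + 1)`.
theorem asIdeal_of_two {v : HeightOneSpectrum (𝓞 K)} (hv : resChar v = 2) :
    v.asIdeal = Ideal.span {intI h.sq - 1} := by
  have hπ : intI h.sq - 1 ∈ v.asIdeal := by
    have h2 : ((2 : ℤ) : 𝓞 K) ∈ v.asIdeal := (intCast_mem_iff v 2).2 (by rw [hv]; rfl)
    refine v.isPrime.mem_of_pow_mem 2 ?_
    have : (intI h.sq - 1) ^ 2 = ((2 : ℤ) : 𝓞 K) * -intI h.sq := by
      push_cast
      linear_combination intI_sq h.sq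
    rw [this]
    exact v.asIdeal.mul_mem_right _ h2
  refine le_antisymm (fun x hx => ?_) ((Ideal.span_singleton_le_iff_mem _).2 hπ)
  obtain ⟨m, n, rfl⟩ := exists_int_add_int_mul h.finrank h.sq h.conj x
  have h1 : ((m + n : ℤ) : 𝓞 K) ∈ v.asIdeal := by
    have := v.asIdeal.sub_mem hx (v.asIdeal.mul_mem_left (n : 𝓞 K) hπ)
    convert this using 1
    push_cast
    ring
  rw [intCast_mem_iff, hv] at h1
  obtain ⟨t, ht⟩ := h1
  obtain rfl : m = 2 * t - n := by push_cast at ht; omega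
  rw [Ideal.mem_span_singleton]
  refine ⟨n - t * (intI h.sq + 1), ?_⟩
  push_cast
  linear_combination (t : 𝓞 K) * intI_sq h.sq

include h in
theorem eq_of_two {v w : HeightOneSpectrum (𝓞 K)} (hv : resChar v = 2) (hw : resChar w = 2) :
    v = w :=
  HeightOneSpectrum.ext ((h.asIdeal_of_two hv).trans (h.asIdeal_of_two hw).symm)

include h in
theorem conjPlace_of_two {v : HeightOneSpectrum (𝓞 K)} (hv : resChar v = 2) : conjPlace c v = v :=
  h.eq_of_two ((resChar_conjPlace c v).trans hv) hv

include h in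
-- For odd `p` an element of both `v` and its conjugate is divisible by `p`, so a prime above `p`
-- contains the product of the two ideals and thus one of them.
theorem eq_or_eq_conjPlace {v w : HeightOneSpectrum (𝓞 K)} (hvw : resChar w = resChar v) :
    w = v ∨ w = conjPlace c v := by
  by_cases hv : resChar v = 2
  · exact .inl (h.eq_of_two (hvw.trans hv) hv)
  have h1 : v.asIdeal * (conjPlace c v).asIdeal ≤ w.asIdeal := by
    refine Ideal.mul_le_inf.trans fun x hx => ?_
    obtain ⟨m, n, rfl⟩ := exists_int_add_int_mul h.finrank h.sq h.conj x
    obtain ⟨h2, h3⟩ := h.dvd_of_mem hv hx.1 hx.2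
    rw [← hvw] at h2 h3
    exact w.asIdeal.add_mem ((intCast_mem_iff w m).2 h2)
      (w.asIdeal.mul_mem_right _ ((intCast_mem_iff w n).2 h3))
  rcases (w.isPrime.mul_le).1 h1 with h2 | h2
  · exact .inl (eq_of_le h2).symm
  · exact .inr (eq_of_le h2).symm

include h in
theorem asIdeal_of_conjPlace_eq {v : HeightOneSpectrum (𝓞 K)} (hv : resChar v ≠ 2)
    (hcv : conjPlace c v = v) : v.asIdeal = Ideal.span {(resChar v : 𝓞 K)} := by
  refine le_antisymm (fun x hx => ?_) ((Ideal.span_singleton_le_iff_mem _).2 (above_resChar v))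
  obtain ⟨m, n, rfl⟩ := exists_int_add_int_mul h.finrank h.sq h.conj x
  obtain ⟨⟨s, hs⟩, ⟨t, ht⟩⟩ := h.dvd_of_mem hv hx (hcv.symm ▸ hx)
  rw [Ideal.mem_span_singleton]
  refine ⟨s + t * intI h.sq, ?_⟩
  rw [hs, ht]
  push_cast
  ring

include h in
/-- At a place that is not fixed by conjugation every residue class contains an integer. -/
theorem exists_int_sub_mem {v : HeightOneSpectrum (𝓞 K)} (hcv : conjPlace c v ≠ v) (x : 𝓞 K) :
    ∃ m : ℤ, x - m ∈ v.asIdeal := by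
  have h1 : ¬ (conjPlace c v).asIdeal ≤ v.asIdeal := fun hle => hcv (eq_of_le hle)
  have h2 : v.asIdeal ⊔ (conjPlace c v).asIdeal = ⊤ := by
    by_contra hne
    have := v.isMaximal.eq_of_le hne le_sup_left
    exact h1 (this ▸ le_sup_right)
  -- Write `1 = a + b` with `a` in `v` and `b` in its conjugate. If `x b = m + n i`, then `m - n i`
  -- is in `v`, so `x ≡ x b ≡ 2m` modulo `v`.
  obtain ⟨a, ha, b, hb, hab⟩ := Submodule.mem_sup.1 ((Ideal.eq_top_iff_one _).1 h2)
  obtain ⟨m, n, hmn⟩ := exists_int_add_int_mul h.finrank h.sq h.conj (x * b)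
  have h3 : x * b ∈ (conjPlace c v).asIdeal := Ideal.mul_mem_left _ _ hb
  rw [hmn, h.mem_conj_iff] at h3
  refine ⟨2 * m, ?_⟩
  have h4 := v.asIdeal.sub_mem (v.asIdeal.mul_mem_left x ha) h3
  convert h4 using 1
  push_cast
  linear_combination (-x) * hab + hmn

include h in
-- The residue field is the prime field, where an integer congruent to `i` is a square root of `-1`.
theorem mod_four_of_conjPlace_ne {v : HeightOneSpectrum (𝓞 K)} (hcv : conjPlace c v ≠ v) :
    resChar v % 4 = 1 := by
  obtain ⟨m, hm⟩ := h.exists_int_sub_mem hcv (intI h.sq)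
  have h1 : ((m ^ 2 + 1 : ℤ) : 𝓞 K) ∈ v.asIdeal := by
    have := v.asIdeal.mul_mem_right (-(intI h.sq + m)) hm
    convert this using 1
    push_cast
    linear_combination intI_sq h.sq
  rw [intCast_mem_iff] at h1
  have hp := prime_resChar v
  have : Fact (resChar v).Prime := ⟨hp⟩
  have h2 : (m : ZMod (resChar v)) ^ 2 = -1 := by
    have := (ZMod.intCast_zmod_eq_zero_iff_dvd _ _).2 h1
    push_cast at this
    linear_combination this
  have h3 := ZMod.mod_four_ne_three_of_sq_eq_neg_one h2
  rcases hp.eq_two_or_odd with h4 | h4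
  · exact absurd (h.conjPlace_of_two h4) hcv
  · omega

include h in
theorem isSplit_iff {v : HeightOneSpectrum (𝓞 K)} : IsSplit K (resChar v) ↔ conjPlace c v ≠ v := by
  constructor
  · rintro ⟨hp, w, w', hww, hw, hw'⟩ hcv
    rw [above_iff _ hp] at hw hw'
    have h1 := h.eq_or_eq_conjPlace hw
    have h2 := h.eq_or_eq_conjPlace hw'
    rw [hcv, or_self] at h1 h2
    exact hww (h1.trans h2.symm)
  · intro hcv
    exact ⟨prime_resChar v, _, _, hcv, (above_iff _ (prime_resChar v)).2 (resChar_conjPlace c v),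
      above_resChar v⟩

include h in
theorem isInert_iff {v : HeightOneSpectrum (𝓞 K)} (hv : resChar v ≠ 2) :
    IsInert K (resChar v) ↔ conjPlace c v = v := by
  constructor
  · rintro ⟨hp, hprime⟩
    let w : HeightOneSpectrum (𝓞 K) := ⟨Ideal.span {(resChar v : 𝓞 K)}, hprime, by
      simpa using hp.ne_zero⟩
    have h1 : w = v := eq_of_le ((Ideal.span_singleton_le_iff_mem _).2 (above_resChar v))
    have h2 : w = conjPlace c v := eq_of_le ((Ideal.span_singleton_le_iff_mem _).2
      ((above_iff _ hp).2 (resChar_conjPlace c v)))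
    exact h2.symm.trans h1
  · intro hcv
    refine ⟨prime_resChar v, ?_⟩
    rw [← h.asIdeal_of_conjPlace_eq hv hcv]
    exact v.isPrime

include h in
theorem not_isRamified {v : HeightOneSpectrum (𝓞 K)} (hv : resChar v % 4 = 3) :
    ¬ IsRamified K (resChar v) := by
  rintro ⟨hp, w, hw⟩
  have hw0 : Above w (resChar v) := by
    have := (dvd_pow_self w.asIdeal two_ne_zero).trans hw
    rwa [Ideal.dvd_span_singleton] at this
  rw [above_iff _ hp] at hw0
  have hcw : conjPlace c w = w := by
    by_contra hcw
    have := h.mod_four_of_conjPlace_ne hcw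
    omega
  rw [← hw0, ← h.asIdeal_of_conjPlace_eq (by omega) hcw] at hw
  have h1 : w.asIdeal * w.asIdeal ∣ w.asIdeal * 1 := by rwa [mul_one, ← _root_.sq]
  have h2 := (mul_dvd_mul_iff_left w.ne_bot).1 h1
  exact w.isPrime.ne_top (Ideal.isUnit_iff.1 (isUnit_of_dvd_one h2))

include h in
-- The ramified-prime condition is vacuous, as no prime `3 mod 4` ramifies. Odd inert places are the
-- odd places fixed by conjugation, and split places are those that are moved, so all conditions
-- become local.
theorem idealConditions_iff (S : Set (HeightOneSpectrum (𝓞 K))) (f : Ideal (𝓞 K)) :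
    IdealConditions S f ↔ ∀ v : HeightOneSpectrum (𝓞 K), v.asIdeal ∣ f →
      (resChar v = 2 → ordAt v f = 2 ∨ ordAt v f = 5) ∧
      (resChar v ≠ 2 → v ∈ S ∧ conjPlace c v ≠ v ∧ ordAt v f = 1) := by
  constructor
  · rintro ⟨hA, -, hC, hD⟩ v hv
    refine ⟨fun h2 => hD v ((above_iff v Nat.prime_two).2 h2) hv, fun h2 => ?_⟩
    have hcv : conjPlace c v ≠ v := fun hcv =>
      hA (resChar v) v ((h.isInert_iff h2).2 hcv) h2 (above_resChar v) hv
    have h3 := hC (resChar v) v (h.isSplit_iff.2 hcv) (above_resChar v) hv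
    exact ⟨h3.1, hcv, h3.2.1 h2⟩
  · intro H
    have key : ∀ (p : ℕ) (v : HeightOneSpectrum (𝓞 K)), IsRamified K p → p % 4 = 3 →
        ¬ Above v p := by
      intro p v hr hp hv
      rw [above_iff v hr.1] at hv
      subst hv
      exact h.not_isRamified hp hr
    refine ⟨?_, ⟨?_, ?_⟩, ?_, ?_⟩
    · rintro p v hp hp2 hv hvf
      rw [above_iff v hp.1] at hv
      subst hv
      exact ((H v hvf).2 hp2).2.1 ((h.isInert_iff hp2).1 hp)
    · rintro v ⟨-, p, hr, hp, hv⟩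
      exact absurd hv (key p v hr hp)
    · exact fun p v hr hp hv => absurd hv (key p v hr hp)
    · rintro p v hp hv hvf
      rw [above_iff v hp.1] at hv
      subst hv
      have h2 : resChar v ≠ 2 := fun h2 => h.isSplit_iff.1 hp (h.conjPlace_of_two h2)
      have h3 := (H v hvf).2 h2
      exact ⟨h3.1, fun _ => h3.2.2, fun h4 => absurd h4 h2⟩
    · intro v hv hvf
      exact (H v hvf).1 ((above_iff v Nat.prime_two).1 hv)

include h in
theorem mem_iff_conjPlace_notMem {S : Set (HeightOneSpectrum (𝓞 K))}
    (hS : IsChoiceOfSplitPlaces S) {v : HeightOneSpectrum (𝓞 K)} (hcv : conjPlace c v ≠ v) :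
    v ∈ S ↔ conjPlace c v ∉ S := by
  obtain ⟨w, ⟨hwS, hw⟩, huniq⟩ := hS.1 (resChar v) (h.isSplit_iff.2 hcv)
  rw [above_iff _ (prime_resChar v)] at hw
  have hcv' : Above (conjPlace c v) (resChar v) :=
    (above_iff _ (prime_resChar v)).2 (resChar_conjPlace c v)
  constructor
  · intro hvS hcS
    exact hcv ((huniq _ ⟨hcS, hcv'⟩).trans (huniq _ ⟨hvS, above_resChar v⟩).symm)
  · intro hcS
    rcases h.eq_or_eq_conjPlace hw with rfl | rfl
    · exact hwS
    · exact absurd hwS hcS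

end IsGaussian
end Places

/-! ### Higher units, approximation, and descent of quadratic characters by squares -/

section Local

variable {K : Type*} [Field K] [NumberField K]

/-- The image of `a ∈ Kˣ` in the completion at `v`. -/
abbrev toLocal (v : HeightOneSpectrum (𝓞 K)) : Kˣ →* (v.adicCompletion K)ˣ :=
  Units.map (algebraMap K (v.adicCompletion K) : K →* v.adicCompletion K)

theorem val_toLocal (v : HeightOneSpectrum (𝓞 K)) (a : Kˣ) :
    (toLocal v a : v.adicCompletion K) = algebraMap K (v.adicCompletion K) a := rfl

theorem valued_algebraMap (v : HeightOneSpectrum (𝓞 K)) (a : K) :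
    Valued.v (algebraMap K (v.adicCompletion K) a) = v.valuation K a :=
  HeightOneSpectrum.valuedAdicCompletion_eq_valuation' v a

/-- The unit `u` of the valuation ring at `v` is congruent to `1` modulo the `n`-th power of the
maximal ideal. -/
def IsHigherUnit (v : HeightOneSpectrum (𝓞 K)) (n : ℕ) (u : (v.adicCompletion K)ˣ) : Prop :=
  Valued.v (u : v.adicCompletion K) = 1 ∧
    Valued.v ((u : v.adicCompletion K) - 1) ≤ WithZero.exp (-(n : ℤ))

theorem IsHigherUnit.mono {v : HeightOneSpectrum (𝓞 K)} {m n : ℕ} (hmn : m ≤ n)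
    {u : (v.adicCompletion K)ˣ} (hu : IsHigherUnit v n u) : IsHigherUnit v m u :=
  ⟨hu.1, hu.2.trans (by rw [WithZero.exp_le_exp]; omega)⟩

theorem isHigherUnit_zero_iff {v : HeightOneSpectrum (𝓞 K)} {u : (v.adicCompletion K)ˣ} :
    IsHigherUnit v 0 u ↔ Valued.v (u : v.adicCompletion K) = 1 := by
  refine ⟨fun hu => hu.1, fun hu => ⟨hu, ?_⟩⟩
  refine (Valuation.map_sub _ _ _).trans ?_
  simp [hu]

/-- The character `f` is trivial on the units that are `1` modulo the `n`-th power of the maximal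
ideal. -/
def TrivialOn (v : HeightOneSpectrum (𝓞 K)) (n : ℕ) (f : (v.adicCompletion K)ˣ →* Circle) : Prop :=
  ∀ u, IsHigherUnit v n u → f u = 1

theorem TrivialOn.mono {v : HeightOneSpectrum (𝓞 K)} {m n : ℕ} (hmn : m ≤ n)
    {f : (v.adicCompletion K)ˣ →* Circle} (hf : TrivialOn v m f) : TrivialOn v n f :=
  fun u hu => hf u (hu.mono hmn)

/-- The infimum of an empty set of naturals is `0`; the hypothesis that some level works ensures
that the infimum is attained. -/
theorem conductorExponent_le_iff {χ : IdeleClassCharacter K} {v : HeightOneSpectrum (𝓞 K)}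
    {N : ℕ} (hN : TrivialOn v N (localChar χ v)) {n : ℕ} :
    conductorExponent χ v ≤ n ↔ TrivialOn v n (localChar χ v) := by
  have h1 : conductorExponent χ v = sInf {n : ℕ | TrivialOn v n (localChar χ v)} := by
    simp only [conductorExponent, TrivialOn, IsHigherUnit, and_imp]
  rw [h1]
  refine ⟨fun h => ?_, fun h => Nat.sInf_le h⟩
  have h2 : TrivialOn v _ (localChar χ v) :=
    Nat.sInf_mem (s := {n : ℕ | TrivialOn v n (localChar χ v)}) ⟨N, hN⟩
  exact h2.mono h

/-- Density of `K` followed by approximation of a `v`-integral element by an algebraic integer. It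
allows characters of local units to be tested on integers prime to `v`. -/
theorem exists_toLocal_near (v : HeightOneSpectrum (𝓞 K)) (n : ℕ) (u : (v.adicCompletion K)ˣ)
    (hu : Valued.v (u : v.adicCompletion K) = 1) :
    ∃ (a : 𝓞 K) (b : Kˣ), (b : K) = a ∧ a ∉ v.asIdeal ∧
      IsHigherUnit v n (u * (toLocal v b)⁻¹) ∧
      Valued.v ((u : v.adicCompletion K) - algebraMap K _ (a : K)) ≤ WithZero.exp (-(n : ℤ)) := by
  have hd := v.denseRange_algebraMap K
  -- With `n + 1` instead of `n` the error is strictly less than `1` even for `n = 0`, so the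
  -- approximation is still a unit at `v`.
  obtain ⟨_, ⟨k, rfl⟩, hk⟩ := hd.inter_nhds_nonempty (ball_mem_nhds v (u : v.adicCompletion K)
    (-((n + 1 : ℕ) : ℤ)))
  rw [Set.mem_ofPred_eq] at hk
  have hlt : WithZero.exp (-((n + 1 : ℕ) : ℤ)) < 1 := by
    rw [← WithZero.exp_zero, WithZero.exp_lt_exp]; omega
  have hk1 : v.valuation K k ≤ 1 := by
    rw [← valued_algebraMap, ← sub_add_cancel (algebraMap K (v.adicCompletion K) k) u]
    refine (Valuation.map_add _ _ _).trans (max_le (hk.trans hlt.le) hu.le)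
  obtain ⟨a, ha⟩ := v.exists_valuation_sub_lt_of_integer hk1
    (Units.mk0 (WithZero.exp (-((n + 1 : ℕ) : ℤ))) WithZero.exp_ne_zero)
  rw [Units.val_mk0] at ha
  have hau : Valued.v ((u : v.adicCompletion K) - algebraMap K _ (a : K)) ≤
      WithZero.exp (-((n + 1 : ℕ) : ℤ)) := by
    have h1 : (u : v.adicCompletion K) - algebraMap K _ (a : K) =
        -((algebraMap K _ k - u) + algebraMap K _ ((a : K) - k)) := by
      rw [map_sub]; ring
    rw [h1, Valuation.map_neg]
    refine (Valuation.map_add _ _ _).trans (max_le hk ?_)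
    rw [valued_algebraMap]
    exact ha.le
  have hva : v.valuation K (a : K) = 1 := by
    rw [← valued_algebraMap, ← hu]
    refine Valuation.map_eq_of_sub_lt _ ?_
    rw [Valuation.map_sub_swap, hu]
    exact hau.trans_lt hlt
  have ha0 : (a : K) ≠ 0 := by
    intro h0
    rw [h0, map_zero] at hva
    exact zero_ne_one hva
  refine ⟨a, Units.mk0 (a : K) ha0, rfl, HeightOneSpectrum.valuation_eq_one_iff_notMem v |>.1 hva, ?_, ?_⟩
  · have hb : Valued.v (algebraMap K (v.adicCompletion K) (a : K)) = 1 := by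
      rw [valued_algebraMap, hva]
    have hb0 : algebraMap K (v.adicCompletion K) (a : K) ≠ 0 := by
      intro h0
      rw [h0, map_zero] at hb
      exact zero_ne_one hb
    constructor
    · rw [Units.val_mul, Units.val_inv_eq_inv_val, map_mul, map_inv₀, hu, val_toLocal,
        Units.val_mk0, hb]
      simp
    · rw [Units.val_mul, Units.val_inv_eq_inv_val, val_toLocal, Units.val_mk0,
        show (u : v.adicCompletion K) * (algebraMap K (v.adicCompletion K) (a : K))⁻¹ - 1 =
          (u - algebraMap K (v.adicCompletion K) (a : K)) *
            (algebraMap K (v.adicCompletion K) (a : K))⁻¹ by field_simp, map_mul, map_inv₀, hb,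
        inv_one, mul_one]
      exact hau.trans (by rw [WithZero.exp_le_exp]; omega)
  · exact hau.trans (by rw [WithZero.exp_le_exp]; omega)

/-- A quadratic character trivial on some higher units is trivial on the units congruent to `1`
modulo `4` times the maximal ideal. -/
theorem TrivialOn.descend {v : HeightOneSpectrum (𝓞 K)} {f : (v.adicCompletion K)ˣ →* Circle}
    (hf : ∀ x, f x ^ 2 = 1) {e : ℕ} (he : v.valuation K 2 = WithZero.exp (-(e : ℤ))) {n : ℕ}
    (hn : 2 * e + 1 ≤ n) (h : TrivialOn v (n + 1) f) : TrivialOn v n f := by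
  intro u hu
  set x : v.adicCompletion K := u - 1 with hx
  have h2 : Valued.v (2 : v.adicCompletion K) = WithZero.exp (-(e : ℤ)) := by
    rw [← map_ofNat (algebraMap K (v.adicCompletion K)) 2, valued_algebraMap, he]
  have h20 : (2 : v.adicCompletion K) ≠ 0 := by
    intro h0
    rw [h0, map_zero] at h2
    exact WithZero.exp_ne_zero h2.symm
  have hx2 : Valued.v (x / 2) ≤ WithZero.exp (-(n : ℤ) + e) := by
    rw [map_div₀, h2, WithZero.exp_add, div_eq_mul_inv, ← WithZero.exp_neg, neg_neg]
    exact mul_le_mul_left hu.2 _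
  have hw : Valued.v (1 + x / 2) = 1 := by
    rw [Valuation.map_one_add_of_lt]
    refine hx2.trans_lt ?_
    rw [← WithZero.exp_zero, WithZero.exp_lt_exp]
    omega
  have hw0 : 1 + x / 2 ≠ 0 := by
    intro h0
    rw [h0, map_zero] at hw
    exact zero_ne_one hw
  -- Since `(1 + x / 2) ^ 2 = u + (x / 2) ^ 2`, the unit `u` is a square times a unit of level `2 (n
  -- - e)`, which is at least `n + 1` because `n ≥ 2e + 1`.
  have hkey : f (u * (Units.mk0 _ hw0 ^ 2)⁻¹) = 1 := by
    refine h _ ⟨?_, ?_⟩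
    · simp [hu.1, hw]
    · have : ((u * (Units.mk0 _ hw0 ^ 2)⁻¹ : (v.adicCompletion K)ˣ) : v.adicCompletion K) - 1 =
          -(x / 2) ^ 2 * ((1 + x / 2) ^ 2)⁻¹ := by
        have hu1 : (u : v.adicCompletion K) = 1 + x := by rw [hx]; ring
        rw [Units.val_mul, Units.val_inv_eq_inv_val, Units.val_pow_eq_pow_val, Units.val_mk0, hu1]
        have : (1 + x / 2) ^ 2 ≠ 0 := pow_ne_zero _ hw0
        rw [eq_mul_inv_iff_mul_eq₀ this, sub_mul, inv_mul_cancel_right₀ this]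
        field_simp
        ring
      rw [this, map_mul, Valuation.map_neg, map_inv₀, map_pow, map_pow, hw, one_pow, inv_one,
        mul_one]
      refine (pow_le_pow_left₀ zero_le hx2 2).trans ?_
      rw [← WithZero.exp_nsmul, WithZero.exp_le_exp]
      simp
      omega
  rw [map_mul, map_inv, map_pow, hf, inv_one, mul_one] at hkey
  exact hkey

theorem TrivialOn.descend_of_le {v : HeightOneSpectrum (𝓞 K)}
    {f : (v.adicCompletion K)ˣ →* Circle} (hf : ∀ x, f x ^ 2 = 1) {e : ℕ}
    (he : v.valuation K 2 = WithZero.exp (-(e : ℤ))) {n : ℕ} (h : TrivialOn v n f) :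
    TrivialOn v (2 * e + 1) f := by
  induction n with
  | zero => exact h.mono (Nat.zero_le _)
  | succ n ih =>
    by_cases hn : 2 * e + 1 ≤ n
    · exact ih (h.descend hf he hn)
    · exact h.mono (by omega)

/-- Approximation reduces triviality on higher units to elements of the number field. -/
theorem TrivialOn.of_integers {v : HeightOneSpectrum (𝓞 K)}
    {f : (v.adicCompletion K)ˣ →* Circle} {N n : ℕ} (hN : TrivialOn v N f)
    (h : ∀ (a : 𝓞 K) (b : Kˣ), (b : K) = a → a ∉ v.asIdeal → a - 1 ∈ v.asIdeal ^ n →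
      f (toLocal v b) = 1) : TrivialOn v n f := by
  intro u hu
  obtain ⟨a, b, hb, ha, hab, hau⟩ := exists_toLocal_near v (max N n) u hu.1
  have h1 := hN _ (hab.mono (le_max_left _ _))
  rw [map_mul, map_inv, mul_inv_eq_one] at h1
  rw [h1]
  refine h a b hb ha ?_
  rw [← HeightOneSpectrum.intValuation_le_pow_iff_mem,
    ← HeightOneSpectrum.valuation_of_algebraMap (K := K), ← valued_algebraMap]
  have h2 : algebraMap K (v.adicCompletion K) (algebraMap (𝓞 K) K (a - 1)) =
      (u - 1) - (u - algebraMap K _ (a : K)) := by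
    rw [map_sub, map_sub, map_one, map_one]; ring
  rw [h2]
  refine (Valuation.map_sub _ _ _).trans (max_le hu.2 (hau.trans ?_))
  rw [WithZero.exp_le_exp]
  have := le_max_right N n
  omega

end Local

/-! ### Continuous maps between completions are determined by the number field -/

section Maps

variable {L K : Type*} [Field L] [NumberField L] [Field K] [NumberField K]

/-- Density of `L` in its completion. Evaluating a whole family `x` allows the places `w` and `w'`
to be equal only propositionally, without transporting elements. -/
theorem finite_ringHom_congr {v : HeightOneSpectrum (𝓞 K)} {w w' : HeightOneSpectrum (𝓞 L)}
    (hw : w = w') (φ : w.adicCompletion L →+* v.adicCompletion K) (hφ : Continuous φ)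
    (ψ : w'.adicCompletion L →+* v.adicCompletion K) (hψ : Continuous ψ)
    (h : ∀ x : L, φ (algebraMap L _ x) = ψ (algebraMap L _ x))
    (x : ∀ w : HeightOneSpectrum (𝓞 L), w.adicCompletion L) : φ (x w) = ψ (x w') := by
  subst hw
  exact congrFun ((w.denseRange_algebraMap L).equalizer hφ hψ (funext h)) (x w)

theorem denseRange_infinite (w : InfinitePlace L) :
    DenseRange (algebraMap L w.Completion) :=
  (InfinitePlace.Completion.denseRange_coe w).mono (by
    rintro _ ⟨x, rfl⟩
    exact ⟨WithAbs.equiv _ x, rfl⟩)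

theorem infinite_ringHom_congr {v : InfinitePlace K} {w w' : InfinitePlace L}
    (hw : w = w') (φ : w.Completion →+* v.Completion) (hφ : Continuous φ)
    (ψ : w'.Completion →+* v.Completion) (hψ : Continuous ψ)
    (h : ∀ x : L, φ (algebraMap L _ x) = ψ (algebraMap L _ x))
    (x : ∀ w : InfinitePlace L, w.Completion) : φ (x w) = ψ (x w') := by
  subst hw
  exact congrFun ((denseRange_infinite w).equalizer hφ hψ (funext h)) (x w)

variable (L K) in
/-- The component of `infiniteAdeleMap` at an infinite place. -/
def infiniteMap [Algebra L K] (w : InfinitePlace K) :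
    (w.comap (algebraMap L K)).Completion →+* w.Completion :=
  LiesOver.completionMap (v := w.comap (algebraMap L K)) (w := w)

theorem continuous_infiniteMap [Algebra L K] (w : InfinitePlace K) :
    Continuous (infiniteMap L K w) := LiesOver.continuous_completionMap

theorem infiniteMap_algebraMap [Algebra L K] (w : InfinitePlace K) (x : L) :
    infiniteMap L K w (algebraMap L _ x) = algebraMap K _ (algebraMap L K x) :=
  LiesOver.completionMap_coe (v := w.comap (algebraMap L K)) (w := w) (WithAbs.toAbs _ x)

theorem finiteMap_algebraMap [Algebra L K] (v : HeightOneSpectrum (𝓞 K)) (x : L) :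
    finiteMap L K v (algebraMap L _ x) = algebraMap K _ (algebraMap L K x) :=
  finiteMap_coe L K v x

theorem adeleAt_adeleMap [Algebra L K] (v : HeightOneSpectrum (𝓞 K)) (x : AdeleRing (𝓞 L) L) :
    adeleAt v (adeleMap L K x) = finiteMap L K v (adeleAt (below L K v) x) := rfl

/-- The component of an adele at an infinite place. -/
def adeleAtInf (w : InfinitePlace L) : AdeleRing (𝓞 L) L →+* w.Completion :=
  (Pi.evalRingHom (fun w : InfinitePlace L => w.Completion) w).comp
    (RingHom.fst (InfiniteAdeleRing L) (FiniteAdeleRing (𝓞 L) L))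

theorem adeleAtInf_adeleMap [Algebra L K] (w : InfinitePlace K) (x : AdeleRing (𝓞 L) L) :
    adeleAtInf w (adeleMap L K x) =
      infiniteMap L K w (adeleAtInf (w.comap (algebraMap L K)) x) := rfl

theorem adele_ext' {x y : AdeleRing (𝓞 L) L} (h1 : ∀ w, adeleAtInf w x = adeleAtInf w y)
    (h2 : ∀ v, adeleAt v x = adeleAt v y) : x = y :=
  adele_ext (funext h1) h2

end Maps

/-! ### Conjugation on adeles and the invariance of base change characters -/

section Gal

variable {K : Type*} [Field K] [NumberField K]

/-- The component of `galAdele σ` at `v`. -/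
def galMap (σ : K ≃ₐ[ℚ] K) (v : HeightOneSpectrum (𝓞 K)) :
    (conjPlace σ v).adicCompletion K →+* v.adicCompletion K :=
  @finiteMap K K _ _ _ _ (σ : K →+* K).toAlgebra v

theorem continuous_galMap (σ : K ≃ₐ[ℚ] K) (v : HeightOneSpectrum (𝓞 K)) :
    Continuous (galMap σ v) :=
  @continuous_finiteMap K K _ _ _ _ (σ : K →+* K).toAlgebra v

theorem galMap_algebraMap (σ : K ≃ₐ[ℚ] K) (v : HeightOneSpectrum (𝓞 K)) (x : K) :
    galMap σ v (algebraMap K _ x) = algebraMap K _ (σ x) :=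
  @finiteMap_algebraMap K K _ _ _ _ (σ : K →+* K).toAlgebra v x

theorem adeleAt_galAdele (σ : K ≃ₐ[ℚ] K) (v : HeightOneSpectrum (𝓞 K))
    (x : AdeleRing (𝓞 K) K) :
    adeleAt v (galAdele σ x) = galMap σ v (adeleAt (conjPlace σ v) x) := rfl

/-- The component of `galAdele σ` at an infinite place. -/
def galMapInf (σ : K ≃ₐ[ℚ] K) (w : InfinitePlace K) :
    (w.comap (σ : K →+* K)).Completion →+* w.Completion :=
  @infiniteMap K K _ _ (σ : K →+* K).toAlgebra w

theorem continuous_galMapInf (σ : K ≃ₐ[ℚ] K) (w : InfinitePlace K) :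
    Continuous (galMapInf σ w) :=
  @continuous_infiniteMap K K _ _ _ _ (σ : K →+* K).toAlgebra w

theorem galMapInf_algebraMap (σ : K ≃ₐ[ℚ] K) (w : InfinitePlace K) (x : K) :
    galMapInf σ w (algebraMap K _ x) = algebraMap K _ (σ x) :=
  @infiniteMap_algebraMap K K _ _ _ _ (σ : K →+* K).toAlgebra w x

theorem adeleAtInf_galAdele (σ : K ≃ₐ[ℚ] K) (w : InfinitePlace K)
    (x : AdeleRing (𝓞 K) K) :
    adeleAtInf w (galAdele σ x) = galMapInf σ w (adeleAtInf (w.comap (σ : K →+* K)) x) := rfl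

theorem below_conjPlace (σ : K ≃ₐ[ℚ] K) (v : HeightOneSpectrum (𝓞 K)) :
    below ℚ K (conjPlace σ v) = below ℚ K v := by
  refine HeightOneSpectrum.ext (Ideal.ext fun x => ?_)
  rw [mem_below ℚ K (y := algebraMap (𝓞 ℚ) (𝓞 K) x) rfl,
    mem_below ℚ K (y := algebraMap (𝓞 ℚ) (𝓞 K) x) rfl]
  exact mem_conjPlace (σ.commutes _).symm

theorem galAdele_adeleMap (σ : K ≃ₐ[ℚ] K) (x : AdeleRing (𝓞 ℚ) ℚ) :
    galAdele σ (adeleMap ℚ K x) = adeleMap ℚ K x := by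
  refine adele_ext' (fun w => ?_) fun v => ?_
  · rw [adeleAtInf_galAdele, adeleAtInf_adeleMap, adeleAtInf_adeleMap]
    refine infinite_ringHom_congr (Subsingleton.elim _ _)
      ((galMapInf σ w).comp (infiniteMap ℚ K _))
      ((continuous_galMapInf σ w).comp (continuous_infiniteMap _)) _ (continuous_infiniteMap _)
      (fun y => ?_) fun w => adeleAtInf w x
    rw [RingHom.comp_apply, infiniteMap_algebraMap, galMapInf_algebraMap, infiniteMap_algebraMap,
      σ.commutes]
  · rw [adeleAt_galAdele, adeleAt_adeleMap, adeleAt_adeleMap]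
    refine finite_ringHom_congr (below_conjPlace σ v) ((galMap σ v).comp (finiteMap ℚ K _))
      ((continuous_galMap σ v).comp (continuous_finiteMap ℚ K _)) _ (continuous_finiteMap ℚ K _)
      (fun y => ?_) fun w => adeleAt w x
    rw [RingHom.comp_apply, finiteMap_algebraMap, galMap_algebraMap, finiteMap_algebraMap,
      σ.commutes]

variable {i : K} {c : K ≃ₐ[ℚ] K} (h : IsGaussian i c)

include h in
theorem IsGaussian.galAdele_galAdele (x : AdeleRing (𝓞 K) K) :
    galAdele c (galAdele c x) = x := by
  have hcc := conj_conj h.finrank h.sq h.conj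
  refine adele_ext' (fun w => ?_) fun v => ?_
  · rw [adeleAtInf_galAdele, adeleAtInf_galAdele]
    refine infinite_ringHom_congr ?_
      ((galMapInf c w).comp (galMapInf c _))
      ((continuous_galMapInf c w).comp (continuous_galMapInf c _)) (RingHom.id _) continuous_id
      (fun y => ?_) fun w => adeleAtInf w x
    · ext y
      simp [hcc]
    · rw [RingHom.comp_apply, galMapInf_algebraMap, galMapInf_algebraMap, hcc, RingHom.id_apply]
  · rw [adeleAt_galAdele, adeleAt_galAdele]
    refine finite_ringHom_congr (h.conjPlace_conjPlace v) ((galMap c v).comp (galMap c _))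
      ((continuous_galMap c v).comp (continuous_galMap c _)) (RingHom.id _) continuous_id
      (fun y => ?_) fun w => adeleAt w x
    rw [RingHom.comp_apply, galMap_algebraMap, galMap_algebraMap, hcc, RingHom.id_apply]

include h in
-- Conjugation is an automorphism of the adeles of `K` as an algebra over the adeles of `ℚ`, and
-- algebra automorphisms preserve norms.
theorem IsGaussian.ideleNorm_galIdele (x : IdeleGroup K) :
    ideleNorm K (galIdele c x) = ideleNorm K x := by
  let : Algebra (AdeleRing (𝓞 ℚ) ℚ) (AdeleRing (𝓞 K) K) := (adeleMap ℚ K).toAlgebra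
  let e : AdeleRing (𝓞 K) K ≃ₐ[AdeleRing (𝓞 ℚ) ℚ] AdeleRing (𝓞 K) K :=
    AlgEquiv.ofRingEquiv (f := RingEquiv.ofRingHom (galAdele c) (galAdele c)
      (RingHom.ext h.galAdele_galAdele) (RingHom.ext h.galAdele_galAdele))
      (fun y => galAdele_adeleMap c y)
  exact Units.ext (Algebra.norm_eq_of_algEquiv e x.val)

include h in
-- The only property of base change characters needed for non-base-change and for uniqueness.
theorem IsGaussian.conjChar_eq_of_isBaseChange {χ : IdeleClassCharacter K}
    (hχ : IsBaseChange χ) : conjChar c χ = χ := by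
  obtain ⟨ν, hν⟩ := hχ
  refine Subtype.ext (DFunLike.ext _ _ fun x => ?_)
  change χ.1 (galIdele c x) = χ.1 x
  rw [hν, hν, h.ideleNorm_galIdele]

theorem galIdele_localIdele (σ : K ≃ₐ[ℚ] K) (v : HeightOneSpectrum (𝓞 K)) (a : Kˣ)
    (hinj : Function.Injective (conjPlace σ)) :
    galIdele σ (localIdele (conjPlace σ v) (toLocal _ a)) =
      localIdele v (toLocal v (Units.map (σ : K →* K) a)) := by
  refine Units.ext (adele_ext ?_ fun w => ?_)
  · exact map_one (@infiniteAdeleMap K K _ _ (σ : K →+* K).toAlgebra)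
  · change adeleAt w (galAdele σ _) = _
    rw [adeleAt_galAdele]
    by_cases hw : w = v
    · subst hw
      rw [adeleAt_localIdele_same, adeleAt_localIdele_same, val_toLocal, galMap_algebraMap]
      rfl
    · rw [adeleAt_localIdele_of_ne (fun h => hw (hinj h)), adeleAt_localIdele_of_ne hw, map_one]

include h in
theorem IsGaussian.localValue_conjChar (χ : IdeleClassCharacter K) (v : HeightOneSpectrum (𝓞 K))
    (a : Kˣ) : localValue (conjChar c χ) (conjPlace c v) a =
      localValue χ v (Units.map (c : K →* K) a) := by
  change χ.1 (galIdele c (localIdele (conjPlace c v) (toLocal _ a))) = _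
  rw [galIdele_localIdele c v a (Function.LeftInverse.injective h.conjPlace_conjPlace)]
  rfl

end Gal

/-! ### Conductors of quadratic characters -/

section Conductor

variable {K : Type*} [Field K] [NumberField K]

theorem multiplicity_finset_prod (T : Finset (HeightOneSpectrum (𝓞 K)))
    (e : HeightOneSpectrum (𝓞 K) → ℕ) (v : HeightOneSpectrum (𝓞 K)) (hv : v ∉ T → e v = 0) :
    multiplicity v.asIdeal (∏ w ∈ T, w.asIdeal ^ e w) = e v := by
  classical
  refine multiplicity_eq_of_emultiplicity_eq_some ?_
  rw [Finset.emultiplicity_prod v.prime]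
  have h1 : ∀ w ∈ T, w ≠ v → emultiplicity v.asIdeal (w.asIdeal ^ e w) = 0 := by
    intro w _ hwv
    rw [emultiplicity_eq_zero]
    intro hd
    have := v.prime.dvd_of_dvd_pow hd
    exact hwv (HeightOneSpectrum.ext (w.isMaximal.eq_of_le v.isPrime.ne_top
      (Ideal.le_of_dvd this)))
  have h2 : emultiplicity v.asIdeal (v.asIdeal ^ e v) = e v :=
    emultiplicity_pow_self v.ne_bot v.prime.not_isUnit _
  by_cases hvT : v ∈ T
  · rw [Finset.sum_eq_single_of_mem v hvT h1, h2]
  · rw [Finset.sum_eq_zero fun w hw => h1 w hw (ne_of_mem_of_not_mem hw hvT), hv hvT]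
    rfl

variable {χ : IdeleClassCharacter K}

theorem apply_sq_eq_one (hχ : χ ^ 2 = 1) (x : IdeleGroup K) : χ.1 x ^ 2 = 1 :=
  congrArg (fun ψ : IdeleClassCharacter K => ψ.1 x) hχ

theorem localChar_sq_eq_one (hχ : χ ^ 2 = 1) (v : HeightOneSpectrum (𝓞 K))
    (x : (v.adicCompletion K)ˣ) : localChar χ v x ^ 2 = 1 := apply_sq_eq_one hχ _

theorem exists_trivialOn (hχ : χ ^ 2 = 1) : ∃ N, ∀ v, TrivialOn v N (localChar χ v) := by
  obtain ⟨T, n, -, -, h⟩ := exists_finset_eq_prod χ hχ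
  exact ⟨n, fun v u hu => h v u hu.1 hu.2⟩

theorem conductorExponent_le_iff' (hχ : χ ^ 2 = 1) {v : HeightOneSpectrum (𝓞 K)} {n : ℕ} :
    conductorExponent χ v ≤ n ↔ TrivialOn v n (localChar χ v) := by
  obtain ⟨N, hN⟩ := exists_trivialOn hχ
  exact conductorExponent_le_iff (hN v)

theorem conductorExponent_eq_zero_iff (hχ : χ ^ 2 = 1) {v : HeightOneSpectrum (𝓞 K)} :
    conductorExponent χ v = 0 ↔ TrivialOn v 0 (localChar χ v) := by
  rw [← conductorExponent_le_iff' hχ, Nat.le_zero]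

theorem exists_conductorIdeal_eq_prod (hχ : χ ^ 2 = 1) :
    ∃ T : Finset (HeightOneSpectrum (𝓞 K)), (∀ v ∉ T, conductorExponent χ v = 0) ∧
      conductorIdeal χ = ∏ v ∈ T, v.asIdeal ^ conductorExponent χ v := by
  obtain ⟨T, n, -, h, -⟩ := exists_finset_eq_prod χ hχ
  have h1 : ∀ v ∉ T, conductorExponent χ v = 0 := fun v hv =>
    (conductorExponent_eq_zero_iff hχ).2 fun u hu => h v hv u hu.1
  refine ⟨T, h1, finprod_eq_finsetProd_of_mulSupport_subset _ fun v hv => ?_⟩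
  by_contra hvT
  exact hv (by simp [h1 v hvT])

theorem ordAt_conductorIdeal (hχ : χ ^ 2 = 1) (v : HeightOneSpectrum (𝓞 K)) :
    ordAt v (conductorIdeal χ) = conductorExponent χ v := by
  obtain ⟨T, hT, hT'⟩ := exists_conductorIdeal_eq_prod hχ
  rw [hT', ordAt]
  exact multiplicity_finset_prod T _ v (hT v)

theorem dvd_iff_ordAt_ne_zero {f : Ideal (𝓞 K)} (v : HeightOneSpectrum (𝓞 K)) :
    v.asIdeal ∣ f ↔ ordAt v f ≠ 0 := by
  rw [ordAt, Ne, multiplicity_eq_zero, not_not]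

theorem dvd_conductorIdeal_iff (hχ : χ ^ 2 = 1) (v : HeightOneSpectrum (𝓞 K)) :
    v.asIdeal ∣ conductorIdeal χ ↔ conductorExponent χ v ≠ 0 := by
  rw [dvd_iff_ordAt_ne_zero, ordAt_conductorIdeal hχ]

theorem conductorIdeal_eq {f : Ideal (𝓞 K)} (hf : f ≠ ⊥)
    (h : ∀ v, conductorExponent χ v = ordAt v f) : conductorIdeal χ = f := by
  rw [← Ideal.finprod_heightOneSpectrum_pow_multiplicity hf, conductorIdeal]
  exact finprod_congr fun v => by rw [h v, ordAt]

/-- As `2` is a unit at `v`, the descent by squares applies with `e = 0`. -/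
theorem conductorExponent_le_one (hχ : χ ^ 2 = 1) {v : HeightOneSpectrum (𝓞 K)}
    (hv : resChar v ≠ 2) : conductorExponent χ v ≤ 1 := by
  obtain ⟨N, hN⟩ := exists_trivialOn hχ
  rw [conductorExponent_le_iff' hχ]
  refine TrivialOn.descend_of_le (e := 0) (localChar_sq_eq_one hχ v) ?_ (hN v)
  have h2 : (2 : 𝓞 K) ∉ v.asIdeal := by
    intro h2
    have := (above_iff v Nat.prime_two).1 (by exact_mod_cast h2)
    exact hv this
  have := (HeightOneSpectrum.valuation_eq_one_iff_notMem (K := K) v).2 h2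
  rw [map_ofNat] at this
  exact this

end Conductor

/-! ### The filtration of units at the place above `2` -/

section TwoAdic

variable {K : Type*} [Field K] [NumberField K] {i : K} {c : K ≃ₐ[ℚ] K} (h : IsGaussian i c)
  {v : HeightOneSpectrum (𝓞 K)} (hv : resChar v = 2)

namespace IsGaussian

include h in
theorem valuation_i (v : HeightOneSpectrum (𝓞 K)) : v.valuation K i = 1 := by
  have h1 : v.valuation K i ^ 2 = 1 := by
    rw [← map_pow, h.sq, Valuation.map_neg, map_one]
  exact (pow_eq_one_iff_of_nonneg zero_le two_ne_zero).1 h1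

include h hv in
theorem valuation_pi : v.valuation K (i - 1) = WithZero.exp (-1 : ℤ) := by
  have h1 : ((intI h.sq - 1 : 𝓞 K) : K) = i - 1 := by simp [coe_intI]
  rw [← h1, HeightOneSpectrum.valuation_of_algebraMap]
  refine v.intValuation_singleton ?_ (h.asIdeal_of_two hv)
  intro h0
  rw [h0] at h1
  have h2 : (0 : K) = i - 1 := h1
  have : i = ((1 : ℚ) : K) := by push_cast; linear_combination -h2
  exact ne_rat_of_sq_eq_neg_one h.sq 1 this

include h hv in
theorem valuation_two : v.valuation K 2 = WithZero.exp (-2 : ℤ) := by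
  have h1 : (2 : K) = (i - 1) ^ 2 * i := by linear_combination (2 - i) * h.sq
  rw [h1, map_mul, map_pow, h.valuation_pi hv, h.valuation_i, mul_one, ← WithZero.exp_nsmul]
  rfl

include h hv in
-- The residue field has two elements: `m + n i ≡ m + n` modulo `i - 1`, and a unit has `m + n` odd.
theorem isHigherUnit_one (u : (v.adicCompletion K)ˣ)
    (hu : Valued.v (u : v.adicCompletion K) = 1) : IsHigherUnit v 1 u := by
  refine ⟨hu, ?_⟩
  obtain ⟨a, b, hb, ha, -, hau⟩ := exists_toLocal_near v 1 u hu
  have h1 : a - 1 ∈ v.asIdeal := by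
    have hπ : intI h.sq - 1 ∈ v.asIdeal := by
      rw [h.asIdeal_of_two hv]; exact Ideal.mem_span_singleton_self _
    obtain ⟨m, n, rfl⟩ := exists_int_add_int_mul h.finrank h.sq h.conj a
    have h2 : ¬ (2 : ℤ) ∣ m + n := by
      intro hd
      have h3 : ((m + n : ℤ) : 𝓞 K) ∈ v.asIdeal := (intCast_mem_iff v _).2 (by rw [hv]; exact hd)
      refine ha ?_
      have := v.asIdeal.add_mem h3 (v.asIdeal.mul_mem_left (n : 𝓞 K) hπ)
      convert this using 1
      push_cast; ring
    have h3 : ((m + n - 1 : ℤ) : 𝓞 K) ∈ v.asIdeal :=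
      (intCast_mem_iff v _).2 (by rw [hv]; push_cast; omega)
    have := v.asIdeal.add_mem h3 (v.asIdeal.mul_mem_left (n : 𝓞 K) hπ)
    convert this using 1
    push_cast; ring
  have h2 : (u : v.adicCompletion K) - 1 = (u - algebraMap K _ (a : K)) +
      algebraMap K (v.adicCompletion K) (algebraMap (𝓞 K) K (a - 1)) := by
    rw [map_sub, map_sub, map_one, map_one]; ring
  rw [h2]
  refine (Valuation.map_add _ _ _).trans (max_le hau ?_)
  rw [valued_algebraMap, HeightOneSpectrum.valuation_of_algebraMap,
    HeightOneSpectrum.intValuation_le_pow_iff_mem, pow_one]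
  exact h1

theorem le_exp_of_lt_exp {z : WithZero (Multiplicative ℤ)} {n : ℤ} (hz : z < WithZero.exp n) :
    z ≤ WithZero.exp (n - 1) := by
  by_cases h0 : z = 0
  · rw [h0]; exact zero_le
  · rw [← WithZero.exp_log h0, WithZero.exp_lt_exp] at hz
    rw [← WithZero.exp_log h0, WithZero.exp_le_exp]
    omega

include h hv in
/-- The quotient of two units with the same distance to `1` is a unit closer to `1`. -/
theorem isHigherUnit_mul_inv {n : ℕ} {u w : (v.adicCompletion K)ˣ}
    (hu : IsHigherUnit v n u) (hw1 : Valued.v (w : v.adicCompletion K) = 1)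
    (hw : Valued.v ((w : v.adicCompletion K) - 1) = WithZero.exp (-(n : ℤ))) :
    IsHigherUnit v (n + 1) u ∨ IsHigherUnit v (n + 1) (u * w⁻¹) := by
  rcases hu.2.lt_or_eq with hlt | heq
  · refine .inl ⟨hu.1, (le_exp_of_lt_exp hlt).trans ?_⟩
    rw [WithZero.exp_le_exp]; push_cast; omega
  · right
    have hu0 : (u : v.adicCompletion K) - 1 ≠ 0 := by
      intro h0
      rw [h0, map_zero] at heq
      exact WithZero.exp_ne_zero heq.symm
    have hw0 : (w : v.adicCompletion K) - 1 ≠ 0 := by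
      intro h0
      rw [h0, map_zero] at hw
      exact WithZero.exp_ne_zero hw.symm
    -- The quotient of `u - 1` by `w - 1` is a unit, hence `1` modulo `π`; so `u` and `w` agree to
    -- one more level.
    have hr := h.isHigherUnit_one hv (Units.mk0 _ hu0 * (Units.mk0 _ hw0)⁻¹) (by
      rw [Units.val_mul, Units.val_inv_eq_inv_val, Units.val_mk0, Units.val_mk0, map_mul,
        map_inv₀, heq, hw, mul_inv_cancel₀ WithZero.exp_ne_zero])
    refine ⟨by simp [hu.1, hw1], ?_⟩
    have h1 : ((u * w⁻¹ : (v.adicCompletion K)ˣ) : v.adicCompletion K) - 1 =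
        (((Units.mk0 _ hu0 * (Units.mk0 _ hw0)⁻¹ : (v.adicCompletion K)ˣ) : v.adicCompletion K)
          - 1) * (w - 1) * (w : v.adicCompletion K)⁻¹ := by
      have hwne : (w : v.adicCompletion K) ≠ 0 := w.ne_zero
      rw [Units.val_mul, Units.val_mul, Units.val_inv_eq_inv_val, Units.val_inv_eq_inv_val,
        Units.val_mk0, Units.val_mk0]
      field_simp
      ring
    rw [h1, map_mul, map_mul, map_inv₀, hw1, inv_one, mul_one, hw]
    refine (mul_le_mul_left hr.2 _).trans ?_
    rw [← WithZero.exp_add, WithZero.exp_le_exp]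
    push_cast
    omega

include h hv in
-- Each graded piece of the filtration has order two, so a single element of exact level `n`
-- generates it.
theorem trivialOn_step {f : (v.adicCompletion K)ˣ →* Circle} {n : ℕ} {w : (v.adicCompletion K)ˣ}
    (hw1 : Valued.v (w : v.adicCompletion K) = 1)
    (hw : Valued.v ((w : v.adicCompletion K) - 1) = WithZero.exp (-(n : ℤ)))
    (hfw : f w = 1) (hf : TrivialOn v (n + 1) f) : TrivialOn v n f := by
  intro u hu
  rcases h.isHigherUnit_mul_inv hv hu hw1 hw with h1 | h1
  · exact hf u h1
  · have := hf _ h1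
    rwa [map_mul, map_inv, hfw, inv_one, mul_one] at this

end IsGaussian
end TwoAdic

/-! ### The complex place is invisible to quadratic characters; the product formula -/

section Infinite

variable {K : Type*} [Field K] [NumberField K] {i : K} {c : K ≃ₐ[ℚ] K} (h : IsGaussian i c)

namespace IsGaussian

include h in
theorem isComplex (w : InfinitePlace K) : w.IsComplex := by
  rw [← InfinitePlace.not_isReal_iff_isComplex]
  intro hw
  have h1 := congrArg (InfinitePlace.embedding_of_isReal hw) h.sq
  rw [map_pow, map_neg, map_one] at h1
  nlinarith [sq_nonneg (InfinitePlace.embedding_of_isReal hw i)]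

include h in
-- This removes the infinite place from all questions about quadratic characters of `K`.
theorem exists_sq_eq (y : (InfiniteAdeleRing K)ˣ) : ∃ z : (InfiniteAdeleRing K)ˣ, z ^ 2 = y := by
  have h1 : ∀ w : InfinitePlace K, ∃ z : w.Completion, z ^ 2 = y.val w := by
    intro w
    let e := InfinitePlace.Completion.ringEquivComplexOfIsComplex (h.isComplex w)
    obtain ⟨z, hz⟩ := IsAlgClosed.exists_pow_nat_eq (e (y.val w)) two_pos
    refine ⟨e.symm z, ?_⟩
    rw [← map_pow, hz, RingEquiv.symm_apply_apply]
  choose z hz using h1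
  let z' : InfiniteAdeleRing K := z
  have hz' : z' ^ 2 = y.val := funext hz
  have hu : IsUnit z' := by
    rw [← isUnit_pow_iff two_ne_zero, hz']
    exact y.isUnit
  obtain ⟨u, hu⟩ := hu
  exact ⟨u, Units.ext (by rw [Units.val_pow_eq_pow_val, hu, hz'])⟩

include h in
/-- A character of order two of the ideles of `ℚ(i)` is determined on the integral ideles by
its local components. -/
theorem exists_finset_eq_prod {χ : IdeleClassCharacter K} (hχ : χ ^ 2 = 1) :
    ∃ T : Finset (HeightOneSpectrum (𝓞 K)),
      (∀ u : (IntegralAdeles K)ˣ,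
        χ.1 (integralIdele K u) = ∏ v ∈ T, localChar χ v (unitAt v u)) ∧
      ∀ v ∉ T, conductorExponent χ v = 0 := by
  obtain ⟨T, n, hT, hT', -⟩ := IdeleClass.exists_finset_eq_prod χ hχ
  refine ⟨T, fun u => ?_, fun v hv => (conductorExponent_eq_zero_iff hχ).2 fun x hx =>
    hT' v hv x hx.1⟩
  obtain ⟨z, hz⟩ := h.exists_sq_eq (Units.map (RingHom.fst _ _).toMonoidHom u)
  let w : (IntegralAdeles K)ˣ := integralUnit z (fun _ => 1) (by simp)
  have hw : ∀ v, unitAt v w = 1 := fun v => unitAt_integralUnit _ _ _ _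
  have h1 : (u * (w ^ 2)⁻¹).val.1 = 1 := by
    have : Units.map (RingHom.fst (InfiniteAdeleRing K) (∀ v : HeightOneSpectrum (𝓞 K),
        v.adicCompletionIntegers K)).toMonoidHom (u * (w ^ 2)⁻¹) = 1 := by
      rw [map_mul, map_inv, map_pow, mul_inv_eq_one, ← hz]
      rfl
    exact congrArg Units.val this
  have h2 := hT _ h1
  simp only [map_mul, map_inv, map_pow, hw, one_pow, inv_one, mul_one] at h2
  rw [apply_sq_eq_one hχ, inv_one, mul_one] at h2
  exact h2

include h in
-- A global unit is at once a principal idele, where `χ` is trivial, and an integral idele, where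
-- `χ` is the product of its local components. It is applied to `i`.
theorem prod_toLocal_eq_one {χ : IdeleClassCharacter K} (hχ : χ ^ 2 = 1) :
    ∃ T : Finset (HeightOneSpectrum (𝓞 K)), (∀ v ∉ T, conductorExponent χ v = 0) ∧
      ∀ a : Kˣ, (∀ v : HeightOneSpectrum (𝓞 K), v.valuation K (a : K) = 1) →
        ∏ v ∈ T, localValue χ v a = 1 := by
  obtain ⟨T, hT, hT'⟩ := h.exists_finset_eq_prod hχ
  refine ⟨T, hT', fun a ha => ?_⟩
  obtain ⟨u, hu⟩ := exists_integralIdele_eq (principalIdele K a) (by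
    intro v
    exact (valued_algebraMap v (a : K)).trans (ha v))
  rw [← χ.2 a, ← hu]
  refine Eq.trans ?_ (hT u).symm
  refine Finset.prod_congr rfl fun v _ => ?_
  have : unitAt v u = toLocal v a := by
    refine Units.ext ?_
    rw [← adeleAt_integralIdele, hu]
    rfl
  rw [this]
  rfl

include h in
theorem eq_one_of_conductorExponent_eq_zero {χ : IdeleClassCharacter K} (hχ : χ ^ 2 = 1)
    (h0 : ∀ v, conductorExponent χ v = 0) : χ = 1 := by
  have := isPrincipalIdealRing_of_sq_eq_neg_one h.finrank h.sq h.conj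
  obtain ⟨T, hT, -⟩ := h.exists_finset_eq_prod hχ
  refine Subtype.ext (DFunLike.ext _ _ fun x => ?_)
  obtain ⟨a, u, rfl⟩ := exists_principal_mul_integral x
  rw [map_mul, χ.2 a, hT, one_mul]
  exact Finset.prod_eq_one fun v _ => (conductorExponent_eq_zero_iff hχ).1 (h0 v) _
    (isHigherUnit_zero_iff.2 (valued_unitAt v u))

end IsGaussian
end Infinite

/-! ### Quadratic characters above `2` and a local form of normalization -/

section TwoAdicCharacters

variable {K : Type*} [Field K] [NumberField K] {i : K} {c : K ≃ₐ[ℚ] K} (h : IsGaussian i c)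
  {v : HeightOneSpectrum (𝓞 K)} (hv : resChar v = 2)

theorem localValue_eq (χ : IdeleClassCharacter K) (v : HeightOneSpectrum (𝓞 K)) (a : Kˣ) :
    localValue χ v a = localChar χ v (toLocal v a) := rfl

theorem localValue_mul (χ : IdeleClassCharacter K) (v : HeightOneSpectrum (𝓞 K)) (a b : Kˣ) :
    localValue χ v (a * b) = localValue χ v a * localValue χ v b := by
  rw [localValue_eq, map_mul, map_mul]; rfl

theorem localValue_char_mul (χ ψ : IdeleClassCharacter K) (v : HeightOneSpectrum (𝓞 K)) (a : Kˣ) :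
    localValue (χ * ψ) v a = localValue χ v a * localValue ψ v a := rfl

theorem localChar_char_mul (χ ψ : IdeleClassCharacter K) (v : HeightOneSpectrum (𝓞 K))
    (a : (v.adicCompletion K)ˣ) :
    localChar (χ * ψ) v a = localChar χ v a * localChar ψ v a := rfl

theorem valued_toLocal_sub_one (v : HeightOneSpectrum (𝓞 K)) (a : Kˣ) :
    Valued.v ((toLocal v a : v.adicCompletion K) - 1) = v.valuation K ((a : K) - 1) := by
  rw [val_toLocal, ← valued_algebraMap, map_sub (algebraMap _ _), map_one]

theorem valued_toLocal (v : HeightOneSpectrum (𝓞 K)) (a : Kˣ) :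
    Valued.v (toLocal v a : v.adicCompletion K) = v.valuation K (a : K) := by
  rw [val_toLocal, ← valued_algebraMap]

/-- The number `5` as a unit of the field. -/
def unitFive (K : Type*) [Field K] [NumberField K] : Kˣ := Units.mk0 5 (by norm_num)

namespace IsGaussian

theorem valuation_eq_one_of_sub_one {a : K} (ha : v.valuation K (a - 1) < 1) :
    v.valuation K a = 1 := by
  have := Valuation.map_one_add_of_lt _ ha
  rwa [add_sub_cancel] at this

include h hv in
theorem valuation_pi_pow (n : ℕ) : v.valuation K ((i - 1) ^ n) = WithZero.exp (-(n : ℤ)) := by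
  rw [map_pow, h.valuation_pi hv, ← WithZero.exp_nsmul]
  simp

theorem exp_neg_lt_one {n : ℕ} (hn : n ≠ 0) : WithZero.exp (-(n : ℤ)) < 1 := by
  rw [← WithZero.exp_zero, WithZero.exp_lt_exp]
  omega

include h hv in
theorem trivialOn_step_of_valuation {f : (v.adicCompletion K)ˣ →* Circle} {n : ℕ} {a : Kˣ}
    (hn : n ≠ 0) (ha : v.valuation K ((a : K) - 1) = WithZero.exp (-(n : ℤ)))
    (hfa : f (toLocal v a) = 1) (hf : TrivialOn v (n + 1) f) : TrivialOn v n f := by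
  refine h.trivialOn_step hv (w := toLocal v a) ?_ ?_ hfa hf
  · rw [valued_toLocal]
    exact valuation_eq_one_of_sub_one (ha ▸ exp_neg_lt_one hn)
  · rw [valued_toLocal_sub_one, ha]

include h hv in
theorem trivialOn_zero_of_one {f : (v.adicCompletion K)ˣ →* Circle} (hf : TrivialOn v 1 f) :
    TrivialOn v 0 f := fun u hu => hf u (h.isHigherUnit_one hv u hu.1)

include h hv in
-- `i = 1 + π` has exact level one.
theorem trivialOn_one_of_two {f : (v.adicCompletion K)ˣ →* Circle} (hf : TrivialOn v 2 f)
    (hi : f (toLocal v (muFour i h.sq)) = 1) : TrivialOn v 1 f :=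
  h.trivialOn_step_of_valuation hv one_ne_zero (h.valuation_pi hv) hi hf

include h in
theorem sq_muFour : muFour i h.sq ^ 2 = -1 := Units.ext h.sq

include h hv in
-- `1 + π ^ 3` generates the step of level three. The step of level two is generated by `-1 = i ^
-- 2`, a square, so it costs no condition.
theorem trivialOn_two_of_four {f : (v.adicCompletion K)ˣ →* Circle} (hf2 : ∀ x, f x ^ 2 = 1)
    (hf : TrivialOn v 4 f) (hi : f (toLocal v (onePlusPiCubed i h.sq)) = 1) : TrivialOn v 2 f := by
  refine h.trivialOn_step_of_valuation hv two_ne_zero (a := -1) ?_ ?_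
    (h.trivialOn_step_of_valuation hv three_ne_zero (a := onePlusPiCubed i h.sq) ?_ hi hf)
  · refine Eq.trans ?_ (h.valuation_two hv)
    rw [← Valuation.map_neg]
    congr 1
    push_cast
    norm_num
  · rw [← h.sq_muFour, map_pow, map_pow, hf2]
  · refine Eq.trans ?_ (h.valuation_pi_pow hv 3)
    congr 1
    change 1 + (i - 1) ^ 3 - 1 = _
    ring

include h hv in
theorem trivialOn_four_of_five {f : (v.adicCompletion K)ˣ →* Circle}
    (hf : TrivialOn v 5 f) (h5 : f (toLocal v (unitFive K)) = 1) : TrivialOn v 4 f := by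
  refine h.trivialOn_step_of_valuation hv four_ne_zero (a := unitFive K) ?_ h5 hf
  have : ((unitFive K : Kˣ) : K) - 1 = 2 ^ 2 := by
    change (5 : K) - 1 = _
    norm_num
  rw [this, map_pow, h.valuation_two hv, ← WithZero.exp_nsmul]
  rfl

include h hv in
-- The prime `2` has valuation `e = 2` here, and the descent by squares stops at `2e + 1 = 5`.
theorem trivialOn_five {f : (v.adicCompletion K)ˣ →* Circle} (hf2 : ∀ x, f x ^ 2 = 1) {n : ℕ}
    (hf : TrivialOn v n f) : TrivialOn v 5 f :=
  hf.descend_of_le hf2 (e := 2) (h.valuation_two hv)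

include h hv in
theorem conductorExponent_le_five {χ : IdeleClassCharacter K} (hχ : χ ^ 2 = 1) :
    conductorExponent χ v ≤ 5 := by
  obtain ⟨N, hN⟩ := exists_trivialOn hχ
  exact (conductorExponent_le_iff' hχ).2 (h.trivialOn_five hv (localChar_sq_eq_one hχ v) (hN v))

include h hv in
-- Exponent `1` cannot occur, as all units have level one; a trivial sign at `1 + π ^ 3` excludes
-- `3` and `4`; exponent `2` forces a nontrivial sign at `i`.
theorem conductorExponent_eq_of_localValue {χ : IdeleClassCharacter K} (hχ : χ ^ 2 = 1)
    (h3 : localValue χ v (onePlusPiCubed i h.sq) = 1) :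
    conductorExponent χ v = 0 ∨
      conductorExponent χ v = 2 ∧ localValue χ v (muFour i h.sq) = -1 ∨
      conductorExponent χ v = 5 := by
  have h5 := h.conductorExponent_le_five hv hχ
  have h42 : conductorExponent χ v ≤ 4 → conductorExponent χ v ≤ 2 := by
    rw [conductorExponent_le_iff' hχ, conductorExponent_le_iff' hχ]
    exact fun h4 => h.trivialOn_two_of_four hv (localChar_sq_eq_one hχ v) h4 h3
  have h10 : conductorExponent χ v ≤ 1 → conductorExponent χ v ≤ 0 := by
    rw [conductorExponent_le_iff' hχ, conductorExponent_le_iff' hχ]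
    exact fun h1 => h.trivialOn_zero_of_one hv h1
  have h21 : conductorExponent χ v ≤ 2 → localValue χ v (muFour i h.sq) = 1 →
      conductorExponent χ v ≤ 1 := by
    rw [conductorExponent_le_iff' hχ, conductorExponent_le_iff' hχ]
    exact fun h2 hi => h.trivialOn_one_of_two hv h2 hi
  rcases circle_eq_one_or_neg_one (localChar_sq_eq_one hχ v (toLocal v (muFour i h.sq)))
    with hi | hi
  · have := fun h2 => h21 h2 hi
    omega
  · by_cases h2 : conductorExponent χ v = 2
    · exact .inr (.inl ⟨h2, hi⟩)
    · omega

include h hv in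
theorem localValue_onePlusPiCubed_of_le_two {χ : IdeleClassCharacter K} (hχ : χ ^ 2 = 1)
    (h2 : conductorExponent χ v ≤ 2) : localValue χ v (onePlusPiCubed i h.sq) = 1 := by
  rw [conductorExponent_le_iff' hχ] at h2
  have h1 : v.valuation K ((onePlusPiCubed i h.sq : K) - 1) = WithZero.exp (-3 : ℤ) := by
    refine Eq.trans ?_ (h.valuation_pi_pow hv 3)
    congr 1
    change 1 + (i - 1) ^ 3 - 1 = _
    ring
  refine h2 _ ⟨?_, ?_⟩
  · rw [valued_toLocal]
    exact valuation_eq_one_of_sub_one (h1 ▸ exp_neg_lt_one three_ne_zero)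
  · rw [valued_toLocal_sub_one, h1, WithZero.exp_le_exp]
    norm_num

include h in
-- For quadratic characters the exponent conditions are automatic, and the sign at `1 + π ^ 3` may
-- be required for every exponent above `2`. This is the form of normalization used in all
-- arguments.
theorem isNormalized_iff {S : Set (HeightOneSpectrum (𝓞 K))} {χ : IdeleClassCharacter K}
    (hχ : χ ^ 2 = 1) : IsNormalized i h.sq S χ ↔
      (∀ v, resChar v ≠ 2 → conductorExponent χ v ≠ 0 → v ∈ S ∧ conjPlace c v ≠ v) ∧
      ∀ v, resChar v = 2 → localValue χ v (onePlusPiCubed i h.sq) = 1 := by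
  simp only [IsNormalized, h.idealConditions_iff, CondDValue, dvd_conductorIdeal_iff hχ,
    ordAt_conductorIdeal hχ, above_iff _ Nat.prime_two]
  constructor
  · rintro ⟨h1, h2⟩
    refine ⟨fun v hv hv0 => ⟨((h1 v hv0).2 hv).1, ((h1 v hv0).2 hv).2.1⟩, fun v hv => ?_⟩
    by_cases h5 : conductorExponent χ v = 5
    · exact (h2 v hv).2 h5
    · refine h.localValue_onePlusPiCubed_of_le_two hv hχ ?_
      by_cases h0 : conductorExponent χ v = 0
      · omega
      · have := (h1 v h0).1 hv
        omega
  · rintro ⟨h1, h2⟩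
    refine ⟨fun v hv0 => ⟨fun hv => ?_, fun hv => ⟨(h1 v hv hv0).1, (h1 v hv hv0).2, ?_⟩⟩,
      fun v hv => ⟨fun he => ?_, fun _ => h2 v hv⟩⟩
    · rcases h.conductorExponent_eq_of_localValue hv hχ (h2 v hv) with h3 | h3 | h3
      · exact absurd h3 hv0
      · exact .inl h3.1
      · exact .inr h3
    · have := conductorExponent_le_one hχ hv
      omega
    · rcases h.conductorExponent_eq_of_localValue hv hχ (h2 v hv) with h3 | h3 | h3
      · omega
      · exact h3.2
      · omega

end IsGaussian
end TwoAdicCharacters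

/-! ### A conjugation-invariant product of normalized characters is trivial -/

section Uniqueness

variable {K : Type*} [Field K] [NumberField K] {i : K} {c : K ≃ₐ[ℚ] K} (h : IsGaussian i c)

theorem conductorExponent_mul_eq_zero {χ ψ : IdeleClassCharacter K} (hχ : χ ^ 2 = 1)
    (hψ : ψ ^ 2 = 1) {v : HeightOneSpectrum (𝓞 K)} (h1 : conductorExponent χ v = 0)
    (h2 : conductorExponent ψ v = 0) : conductorExponent (χ * ψ) v = 0 := by
  rw [conductorExponent_eq_zero_iff hχ] at h1
  rw [conductorExponent_eq_zero_iff hψ] at h2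
  rw [conductorExponent_eq_zero_iff (by rw [mul_pow, hχ, hψ, one_mul])]
  intro u hu
  rw [localChar_char_mul, h1 u hu, h2 u hu, one_mul]

namespace IsGaussian

include h in
theorem conductorExponent_eq_zero_of_conj {ψ : IdeleClassCharacter K} (hψ : ψ ^ 2 = 1)
    (hc : conjChar c ψ = ψ) {v : HeightOneSpectrum (𝓞 K)}
    (hv : conductorExponent ψ (conjPlace c v) = 0) : conductorExponent ψ v = 0 := by
  rw [conductorExponent_eq_zero_iff hψ] at hv ⊢
  obtain ⟨N, hN⟩ := exists_trivialOn hψ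
  refine (hN v).of_integers fun a b hb ha _ => ?_
  have h1 := h.localValue_conjChar ψ v (Units.map (c : K →* K) b)
  have h2 : Units.map (c : K →* K) (Units.map (c : K →* K) b) = b :=
    Units.ext (conj_conj h.finrank h.sq h.conj (b : K))
  rw [hc, h2] at h1
  rw [← localValue_eq, ← h1]
  refine hv _ (isHigherUnit_zero_iff.2 ?_)
  rw [valued_toLocal, valuation_conjPlace]
  change v.valuation K (c (c (b : K))) = 1
  rw [conj_conj h.finrank h.sq h.conj, hb]
  exact (HeightOneSpectrum.valuation_eq_one_iff_notMem v).2 ha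

include h in
-- By invariance the sign is also trivial at the conjugate of `1 + π ^ 3`, hence at the norm `13`.
-- As `5 * 13 = 1 + 2 ^ 6` has level `12`, the sign at `5` is trivial as well, and the steps of the
-- filtration can be descended one after another.
theorem conductorExponent_eq_zero_of_two {ψ : IdeleClassCharacter K} (hψ : ψ ^ 2 = 1)
    (hc : conjChar c ψ = ψ) {v : HeightOneSpectrum (𝓞 K)} (hv : resChar v = 2)
    (h3 : localValue ψ v (onePlusPiCubed i h.sq) = 1)
    (hi : localValue ψ v (muFour i h.sq) = 1) : conductorExponent ψ v = 0 := by
  obtain ⟨N, hN⟩ := exists_trivialOn hψ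
  have hsq := localChar_sq_eq_one hψ v
  have hf5 := h.trivialOn_five hv hsq (hN v)
  have h3' : localValue ψ v (Units.map (c : K →* K) (onePlusPiCubed i h.sq)) = 1 := by
    rw [← h.localValue_conjChar, hc, h.conjPlace_of_two hv, h3]
  have h5 : localValue ψ v (unitFive K) = 1 := by
    have h13 : ((onePlusPiCubed i h.sq : Kˣ) : K) * c (onePlusPiCubed i h.sq : Kˣ) = 13 := by
      change (1 + (i - 1) ^ 3) * c (1 + (i - 1) ^ 3) = 13
      rw [map_add, map_pow, map_sub, map_one, h.conj]
      linear_combination (- i ^ 4 + 4 * i ^ 2 - 13) * h.sq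
    have h1 : localValue ψ v (unitFive K *
        (onePlusPiCubed i h.sq * Units.map (c : K →* K) (onePlusPiCubed i h.sq))) = 1 := by
      have e1 : v.valuation K (((unitFive K * (onePlusPiCubed i h.sq *
          Units.map (c : K →* K) (onePlusPiCubed i h.sq)) : Kˣ) : K) - 1) =
          WithZero.exp (-(12 : ℕ) : ℤ) := by
        have : ((unitFive K * (onePlusPiCubed i h.sq *
          Units.map (c : K →* K) (onePlusPiCubed i h.sq)) : Kˣ) : K) = 5 * 13 := by
          rw [← h13]; rfl
        rw [this, show (5 * 13 - 1 : K) = 2 ^ 6 by norm_num, map_pow, h.valuation_two hv,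
          ← WithZero.exp_nsmul]
        rfl
      refine hf5 _ ⟨?_, ?_⟩
      · rw [valued_toLocal]
        exact valuation_eq_one_of_sub_one (e1 ▸ exp_neg_lt_one (by norm_num))
      · rw [valued_toLocal_sub_one, e1, WithZero.exp_le_exp]
        norm_num
    rwa [localValue_mul, localValue_mul, h3, h3', mul_one, mul_one] at h1
  rw [conductorExponent_eq_zero_iff hψ]
  exact h.trivialOn_zero_of_one hv (h.trivialOn_one_of_two hv (h.trivialOn_two_of_four hv hsq
    (h.trivialOn_four_of_five hv hf5 h5) h3) hi)

include h in
-- If an odd split place is in `S`, its conjugate is not, so both characters are unramified at the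
-- conjugate and invariance carries this back to the place itself. What remains is the place above
-- `2`.
theorem eq_one_of_conj {S : Set (HeightOneSpectrum (𝓞 K))} (hS : IsChoiceOfSplitPlaces S)
    {χ η : IdeleClassCharacter K} (hχ : χ ^ 2 = 1) (hη : η ^ 2 = 1)
    (hχn : IsNormalized i h.sq S χ) (hηn : IsNormalized i h.sq S η)
    (hc : conjChar c (χ * η) = χ * η) : χ * η = 1 := by
  have hψ : (χ * η) ^ 2 = 1 := by rw [mul_pow, hχ, hη, one_mul]
  rw [h.isNormalized_iff hχ] at hχn
  rw [h.isNormalized_iff hη] at hηn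
  have hun : ∀ v, resChar v ≠ 2 → ¬ (v ∈ S ∧ conjPlace c v ≠ v) →
      conductorExponent (χ * η) v = 0 := fun v hv hv' =>
    conductorExponent_mul_eq_zero hχ hη
      (by by_contra h0; exact hv' (hχn.1 v hv h0)) (by by_contra h0; exact hv' (hηn.1 v hv h0))
  have hodd : ∀ v, resChar v ≠ 2 → conductorExponent (χ * η) v = 0 := by
    intro v hv
    by_cases hvS : v ∈ S ∧ conjPlace c v ≠ v
    · refine h.conductorExponent_eq_zero_of_conj hψ hc (hun _ ?_ fun h1 => ?_)
      · rwa [resChar_conjPlace]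
      · exact (h.mem_iff_conjPlace_notMem hS hvS.2).1 hvS.1 h1.1
    · exact hun v hv hvS
  refine h.eq_one_of_conductorExponent_eq_zero hψ fun v => ?_
  by_cases hv : resChar v = 2
  · obtain ⟨T, hT, hT'⟩ := h.prod_toLocal_eq_one hψ
    -- All odd places are unramified, so the product formula at `i` reduces to the factor above `2`.
    have h1 := hT' (muFour i h.sq) h.valuation_i
    by_cases hvT : v ∈ T
    · rw [Finset.prod_eq_single_of_mem v hvT] at h1
      · refine h.conductorExponent_eq_zero_of_two hψ hc hv ?_ h1
        rw [localValue_char_mul, hχn.2 v hv, hηn.2 v hv, one_mul]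
      · intro w _ hwv
        refine (conductorExponent_eq_zero_iff hψ).1
          (hodd w fun hw => hwv (h.eq_of_two hw hv)) _ (isHigherUnit_zero_iff.2 ?_)
        rw [valued_toLocal]
        exact h.valuation_i w
    · exact hT v hvT
  · exact hodd v hv

end IsGaussian
end Uniqueness

/-! ### The image of the adeles of the base field -/

section AdeleMapRange

variable {L K : Type*} [Field L] [NumberField L] [Field K] [NumberField K] [Algebra L K]

open scoped Valued in
-- The image is a one-dimensional subspace of `K_v` over a complete field, and finite-dimensional
-- subspaces are closed.
theorem isClosed_range_finiteMap (v : HeightOneSpectrum (𝓞 K)) :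
    IsClosed (Set.range (finiteMap L K v)) := by
  let : Algebra ((below L K v).adicCompletion L) (v.adicCompletion K) :=
    (finiteMap L K v).toAlgebra
  have : ContinuousSMul ((below L K v).adicCompletion L) (v.adicCompletion K) :=
    ⟨((continuous_finiteMap L K v).comp continuous_fst).mul continuous_snd⟩
  have : IsScalarTower L ((below L K v).adicCompletion L) (v.adicCompletion K) :=
    .of_algebraMap_eq fun x => (finiteMap_algebraMap v x).symm
  exact (LinearMap.range (Algebra.linearMap ((below L K v).adicCompletion L)
    (v.adicCompletion K))).closed_of_finiteDimensional

variable (L) in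
theorem mem_range_finiteMap {v : HeightOneSpectrum (𝓞 K)} {y : v.adicCompletion K}
    (hy : y ∈ closure (Set.range fun x : L => algebraMap K (v.adicCompletion K)
      (algebraMap L K x))) : y ∈ (finiteMap L K v).range := by
  refine closure_minimal ?_ (isClosed_range_finiteMap (L := L) v) hy
  rintro _ ⟨x, rfl⟩
  exact ⟨algebraMap L _ x, finiteMap_algebraMap v x⟩

theorem norm_infiniteMap (w : InfinitePlace K)
    (x : (w.comap (algebraMap L K)).Completion) : ‖infiniteMap L K w x‖ = ‖x‖ := by
  have h : (fun x => ‖infiniteMap L K w x‖) = fun x => ‖x‖ := by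
    refine (denseRange_infinite (w.comap (algebraMap L K))).equalizer
      (continuous_norm.comp (continuous_infiniteMap w)) continuous_norm (funext fun x => ?_)
    change ‖infiniteMap L K w (algebraMap L _ x)‖ = ‖algebraMap L _ x‖
    rw [infiniteMap_algebraMap]
    refine (InfinitePlace.Completion.norm_coe w (WithAbs.toAbs _ (algebraMap L K x))).trans ?_
    exact (InfinitePlace.Completion.norm_coe (w.comap (algebraMap L K))
      (WithAbs.toAbs _ x)).symm
  exact congrFun h x

variable (L) in
theorem mem_range_infiniteMap {w : InfinitePlace K} {y : w.Completion}
    (hy : y ∈ closure (Set.range fun x : L => algebraMap K w.Completion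
      (algebraMap L K x))) : y ∈ (infiniteMap L K w).range := by
  have h1 : Isometry (infiniteMap L K w) :=
    AddMonoidHomClass.isometry_of_norm _ (norm_infiniteMap w)
  refine closure_minimal ?_ h1.isClosedEmbedding.isClosed_range hy
  rintro _ ⟨x, rfl⟩
  exact ⟨algebraMap L _ x, infiniteMap_algebraMap w x⟩

theorem exists_valuation_eq_exp (v : HeightOneSpectrum (𝓞 L)) (n : ℤ) :
    ∃ k : L, v.valuation L k = WithZero.exp n := by
  obtain ⟨π, hπ⟩ := v.valuation_exists_uniformizer L
  refine ⟨π ^ (-n), ?_⟩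
  rw [map_zpow₀, hπ, ← WithZero.exp_zsmul]
  simp

variable (L) in
-- Scaling by an element of `L` leaves an element of valuation `1`. It and its inverse map to
-- integers, so its image again has valuation `1`, and the exponent can be read off on `L`.
theorem exists_valued_finiteMap (v : HeightOneSpectrum (𝓞 K)) :
    ∃ e : ℕ, e ≠ 0 ∧ ∀ x, Valued.v (finiteMap L K v x) = Valued.v x ^ e := by
  obtain ⟨e, he0, he⟩ := exists_valuation_below L K v
  refine ⟨e, he0, fun x => ?_⟩
  by_cases hx : x = 0
  · simp [hx, he0]
  have hx' : Valued.v x ≠ 0 := (Valuation.ne_zero_iff _).2 hx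
  obtain ⟨k, hk⟩ := exists_valuation_eq_exp (below L K v) (WithZero.log (Valued.v x))
  rw [WithZero.exp_log hx', ← valued_algebraMap] at hk
  have hk0 : algebraMap L ((below L K v).adicCompletion L) k ≠ 0 := by
    intro h0
    rw [h0, map_zero] at hk
    exact hx' hk.symm
  set t := x * (algebraMap L ((below L K v).adicCompletion L) k)⁻¹ with ht
  have ht1 : Valued.v t = 1 := by rw [ht, map_mul, map_inv₀, hk, mul_inv_cancel₀ hx']
  have h1 : Valued.v (finiteMap L K v t) ≤ 1 := by
    rw [← HeightOneSpectrum.mem_adicCompletionIntegers]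
    refine finiteMap_mapsTo L K v ?_
    rw [SetLike.mem_coe, HeightOneSpectrum.mem_adicCompletionIntegers, ht1]
  have h2 : Valued.v (finiteMap L K v t⁻¹) ≤ 1 := by
    rw [← HeightOneSpectrum.mem_adicCompletionIntegers]
    refine finiteMap_mapsTo L K v ?_
    rw [SetLike.mem_coe, HeightOneSpectrum.mem_adicCompletionIntegers, map_inv₀, ht1, inv_one]
  have h3 : Valued.v (finiteMap L K v t) = 1 := by
    refine le_antisymm h1 ?_
    rw [map_inv₀, map_inv₀] at h2
    have h4 : Valued.v (finiteMap L K v t) ≠ 0 := by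
      rw [Valuation.ne_zero_iff, map_ne_zero]
      intro h0
      rw [h0, map_zero] at ht1
      exact zero_ne_one ht1
    exact (inv_le_one₀ (zero_lt_iff.2 h4)).1 h2
  have hxt : x = t * algebraMap L ((below L K v).adicCompletion L) k := by
    rw [ht, inv_mul_cancel_right₀ hk0]
  rw [← hk, hxt, map_mul, map_mul, h3, one_mul, finiteMap_algebraMap, valued_algebraMap, he,
    ← valued_algebraMap]

variable (L K) in
theorem below_surjective : Function.Surjective (below L K) := by
  intro w
  have := w.isMaximal
  obtain ⟨P, hP, hPw⟩ := Ideal.exists_maximal_ideal_liesOver_of_isIntegral (S := 𝓞 K) w.asIdeal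
  refine ⟨⟨P, hP.isPrime, ?_⟩, HeightOneSpectrum.ext hPw.over.symm⟩
  rintro rfl
  refine w.ne_bot ?_
  rw [hPw.over, Ideal.under_bot]

theorem adeleMap_injective : Function.Injective (adeleMap L K) := by
  intro x y hxy
  refine adele_ext' (fun w => ?_) fun w => ?_
  · obtain ⟨u, rfl⟩ := InfinitePlace.comap_surjective (K := K) w
    exact (infiniteMap L K u).injective (congrArg (adeleAtInf u) hxy)
  · obtain ⟨v, rfl⟩ := below_surjective L K w
    exact (finiteMap L K v).injective (congrArg (adeleAt v) hxy)

end AdeleMapRange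

/-! ### Fixed points of conjugation on adeles, and the norm as `x * c x` -/

section Invariants

variable {K : Type*} [Field K] [NumberField K] {i : K} {c : K ≃ₐ[ℚ] K} (h : IsGaussian i c)

theorem resChar_eq_of_below_eq {v w : HeightOneSpectrum (𝓞 K)} (hvw : below ℚ K w = below ℚ K v) :
    resChar w = resChar v := by
  have h1 : Above w (resChar v) := by
    refine (mem_below ℚ K (x := (resChar v : 𝓞 ℚ)) (by simp)).1 ?_
    rw [hvw]
    exact (mem_below ℚ K (by simp)).2 (above_resChar v)
  exact (above_iff w (prime_resChar v)).1 h1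

namespace IsGaussian

include h in
theorem exists_rat_eq_add_conj (k : K) : ∃ q : ℚ, algebraMap ℚ K q = k + c k := by
  obtain ⟨a, b, rfl⟩ := exists_rat_add_rat_mul h.finrank h.sq k
  refine ⟨2 * a, ?_⟩
  rw [conj_add_mul h.conj]
  simp
  ring

include h in
/-- A point fixed by a continuous extension of `c` to a completion is a limit of rational
numbers. -/
theorem mem_closure_of_fixed {E : Type*} [Field E] [TopologicalSpace E] [IsTopologicalRing E]
    [Algebra K E] (hd : DenseRange (algebraMap K E)) (τ : E →+* E) (hτ : Continuous τ)
    (hτc : ∀ k, τ (algebraMap K E k) = algebraMap K E (c k)) {y : E} (hy : τ y = y) :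
    y ∈ closure (Set.range fun x : ℚ => algebraMap K E (algebraMap ℚ K x)) := by
  -- A fixed point equals half its trace. The half-trace is continuous and maps the dense subfield
  -- `K` into `ℚ`.
  have hg : Continuous fun z : E => algebraMap K E (2⁻¹) * (z + τ z) := by fun_prop
  have h2 : algebraMap K E (2⁻¹) * (y + τ y) = y := by
    rw [hy, ← two_mul, ← mul_assoc, ← map_ofNat (algebraMap K E) 2, ← map_mul]
    norm_num
  rw [← h2]
  refine map_mem_closure (f := fun z : E => algebraMap K E (2⁻¹) * (z + τ z)) hg (hd y) ?_
  rintro _ ⟨k, rfl⟩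
  obtain ⟨q, hq⟩ := h.exists_rat_eq_add_conj k
  refine ⟨2⁻¹ * q, ?_⟩
  change algebraMap K E (algebraMap ℚ K (2⁻¹ * q)) =
    algebraMap K E 2⁻¹ * (algebraMap K E k + τ (algebraMap K E k))
  rw [hτc, ← map_add, ← map_mul, map_mul, hq]
  simp

include h in
-- Choose `e + f = 1` with `e` in the `n`-th power of `v` and `f` in that of its conjugate. The
-- trace of `-i e` is rational and differs from `i` by `-i e - i c(f)`, which is small at `v`.
theorem i_mem_closure {v : HeightOneSpectrum (𝓞 K)} (hcv : conjPlace c v ≠ v) :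
    algebraMap K (v.adicCompletion K) i ∈ closure (Set.range fun x : ℚ =>
      algebraMap K (v.adicCompletion K) (algebraMap ℚ K x)) := by
  rw [mem_closure_iff_nhds]
  intro s hs
  obtain ⟨n, hn⟩ := exists_ball_subset v hs
  have h1 : IsCoprime (v.asIdeal ^ n) ((conjPlace c v).asIdeal ^ n) := by
    refine IsCoprime.pow (Ideal.isCoprime_iff_sup_eq.2 ?_)
    exact Ideal.IsMaximal.coprime_of_ne v.isMaximal (conjPlace c v).isMaximal
      fun h0 => hcv (HeightOneSpectrum.ext h0.symm)
  obtain ⟨e, he, f, hf, hef⟩ := Submodule.mem_sup.1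
    ((Ideal.eq_top_iff_one _).1 (Ideal.isCoprime_iff_sup_eq.1 h1))
  have he1 : v.valuation K (e : K) ≤ WithZero.exp (-(n : ℤ)) := by
    rw [HeightOneSpectrum.valuation_of_algebraMap]
    exact (HeightOneSpectrum.intValuation_le_pow_iff_mem _ _ _).2 he
  have hf1 : v.valuation K (c (f : K)) ≤ WithZero.exp (-(n : ℤ)) := by
    rw [← valuation_conjPlace, HeightOneSpectrum.valuation_of_algebraMap]
    exact (HeightOneSpectrum.intValuation_le_pow_iff_mem _ _ _).2 hf
  have hef' : (e : K) + f = 1 := by exact_mod_cast congrArg (fun x : 𝓞 K => (x : K)) hef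
  obtain ⟨q, hq⟩ := h.exists_rat_eq_add_conj (-(i * e))
  refine ⟨_, hn _ ?_, ⟨q, rfl⟩⟩
  rw [← map_sub, valued_algebraMap, hq]
  have h2 : -(i * (e : K)) + c (-(i * e)) - i = -(i * e) + -(i * c f) := by
    have : (e : K) = 1 - f := by linear_combination hef'
    rw [this]
    simp [h.conj]
    ring
  rw [h2]
  refine (Valuation.map_add _ _ _).trans (max_le ?_ ?_) <;>
    rwa [Valuation.map_neg, map_mul, h.valuation_i, one_mul]

include h in
-- The range is closed and contains `ℚ` and `i`, hence the dense subfield `K`.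
theorem finiteMap_surjective {v : HeightOneSpectrum (𝓞 K)} (hcv : conjPlace c v ≠ v) :
    Function.Surjective (finiteMap ℚ K v) := by
  have h1 : Set.range (finiteMap ℚ K v) = Set.univ := by
    rw [← (isClosed_range_finiteMap v).closure_eq]
    refine Dense.closure_eq ((v.denseRange_algebraMap K).mono ?_)
    rintro _ ⟨k, rfl⟩
    change _ ∈ (finiteMap ℚ K v).range
    obtain ⟨a, b, rfl⟩ := exists_rat_add_rat_mul h.finrank h.sq k
    have hr : ∀ q : ℚ, algebraMap K (v.adicCompletion K) q ∈ (finiteMap ℚ K v).range := fun q =>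
      ⟨algebraMap ℚ _ q, finiteMap_algebraMap v q⟩
    rw [map_add, map_mul]
    exact add_mem (hr a) (mul_mem (hr b) (mem_range_finiteMap ℚ (h.i_mem_closure hcv)))
  exact Set.range_eq_univ.1 h1

theorem exists_ringHom_of_eq {v w : HeightOneSpectrum (𝓞 K)} (hw : w = v)
    (φ : w.adicCompletion K →+* v.adicCompletion K) (hφ : Continuous φ)
    (hφc : ∀ k, φ (algebraMap K _ k) = algebraMap K _ (c k)) :
    ∃ τ : v.adicCompletion K →+* v.adicCompletion K, Continuous τ ∧
      (∀ k, τ (algebraMap K _ k) = algebraMap K _ (c k)) ∧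
      ∀ x : AdeleRing (𝓞 K) K, φ (adeleAt w x) = τ (adeleAt v x) := by
  subst hw
  exact ⟨φ, hφ, hφc, fun _ => rfl⟩

theorem exists_ringHom_of_eq_inf {v w : InfinitePlace K} (hw : w = v)
    (φ : w.Completion →+* v.Completion) (hφ : Continuous φ)
    (hφc : ∀ k, φ (algebraMap K _ k) = algebraMap K _ (c k)) :
    ∃ τ : v.Completion →+* v.Completion, Continuous τ ∧
      (∀ k, τ (algebraMap K _ k) = algebraMap K _ (c k)) ∧
      ∀ x : AdeleRing (𝓞 K) K, φ (adeleAtInf w x) = τ (adeleAtInf v x) := by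
  subst hw
  exact ⟨φ, hφ, hφc, fun _ => rfl⟩

include h in
theorem subsingleton_infinitePlace : Subsingleton (InfinitePlace K) := by
  have : IsTotallyComplex K := ⟨h.isComplex⟩
  have h1 := InfinitePlace.card_eq_nrRealPlaces_add_nrComplexPlaces K
  have h2 := InfinitePlace.card_add_two_mul_card_eq_rank K
  have h3 := nrRealPlaces_eq_zero_iff.2 this
  rw [h.finrank] at h2
  rw [← Fintype.card_le_one_iff_subsingleton]
  omega

include h in
theorem adeleAt_mem_range {y : AdeleRing (𝓞 K) K} (hy : galAdele c y = y)
    (v : HeightOneSpectrum (𝓞 K)) : adeleAt v y ∈ (finiteMap ℚ K v).range := by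
  by_cases hcv : conjPlace c v = v
  · obtain ⟨τ, h1, h2, h3⟩ := exists_ringHom_of_eq hcv (galMap c v) (continuous_galMap c v)
      (galMap_algebraMap c v)
    refine mem_range_finiteMap ℚ (h.mem_closure_of_fixed (v.denseRange_algebraMap K) τ h1 h2 ?_)
    rw [← h3, ← adeleAt_galAdele, hy]
  · exact h.finiteMap_surjective hcv _

include h in
theorem adeleAtInf_mem_range {y : AdeleRing (𝓞 K) K} (hy : galAdele c y = y)
    (w : InfinitePlace K) : adeleAtInf w y ∈ (infiniteMap ℚ K w).range := by
  have := h.subsingleton_infinitePlace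
  obtain ⟨τ, h1, h2, h3⟩ := exists_ringHom_of_eq_inf
    (Subsingleton.elim (w.comap (c : K →+* K)) w) (galMapInf c w) (continuous_galMapInf c w)
      (galMapInf_algebraMap c w)
  refine mem_range_infiniteMap ℚ (h.mem_closure_of_fixed (denseRange_infinite w) τ h1 h2 ?_)
  rw [← h3, ← adeleAtInf_galAdele, hy]

include h in
/-- An adele of `ℚ(i)` invariant under conjugation is an adele of `ℚ`. -/
theorem exists_adeleMap_eq {y : AdeleRing (𝓞 K) K} (hy : galAdele c y = y) :
    ∃ a, adeleMap ℚ K a = y := by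
  have hsub := h.subsingleton_infinitePlace
  have hfin : ∀ w : HeightOneSpectrum (𝓞 ℚ), ∃ a : w.adicCompletion ℚ,
      ∀ x : (∀ w : HeightOneSpectrum (𝓞 ℚ), w.adicCompletion ℚ), x w = a →
        ∀ v, below ℚ K v = w → finiteMap ℚ K v (x (below ℚ K v)) = adeleAt v y := by
    intro w
    obtain ⟨v₀, rfl⟩ := below_surjective ℚ K w
    obtain ⟨a, ha⟩ := h.adeleAt_mem_range hy v₀
    refine ⟨a, fun x hx v hv => ?_⟩
    rcases h.eq_or_eq_conjPlace (resChar_eq_of_below_eq hv) with rfl | rfl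
    · rw [hx, ha]
    · apply (galMap c v₀).injective
      rw [← adeleAt_galAdele, hy, ← ha, ← hx]
      refine finite_ringHom_congr hv ((galMap c v₀).comp (finiteMap ℚ K _))
        ((continuous_galMap c v₀).comp (continuous_finiteMap ℚ K _)) _
        (continuous_finiteMap ℚ K _) (fun q => ?_) x
      rw [RingHom.comp_apply, finiteMap_algebraMap, galMap_algebraMap, finiteMap_algebraMap,
        c.commutes]
  have hinf : ∀ u : InfinitePlace ℚ, ∃ a : u.Completion,
      ∀ x : (∀ u : InfinitePlace ℚ, u.Completion), x u = a →
        ∀ w : InfinitePlace K, w.comap (algebraMap ℚ K) = u →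
          infiniteMap ℚ K w (x (w.comap (algebraMap ℚ K))) = adeleAtInf w y := by
    intro u
    obtain ⟨w₀, rfl⟩ := InfinitePlace.comap_surjective (K := K) u
    obtain ⟨a, ha⟩ := h.adeleAtInf_mem_range hy w₀
    refine ⟨a, fun x hx w _ => ?_⟩
    obtain rfl := hsub.elim w₀ w
    exact (congrArg _ hx).trans ha
  choose a ha using hfin
  choose b hb using hinf
  -- The valuation at a place of `K` restricts to a positive power of the one below, so integrality
  -- of `y` at almost all places descends.
  have hint : ∀ᶠ w in Filter.cofinite, a w ∈ w.adicCompletionIntegers ℚ := by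
    choose s hs using below_surjective ℚ K
    have hs' : Function.Injective s := Function.LeftInverse.injective hs
    filter_upwards [hs'.tendsto_cofinite.eventually y.2.property] with w hw
    have h1 : a (below ℚ K (s w)) ∈ (below ℚ K (s w)).adicCompletionIntegers ℚ := by
      obtain ⟨e, he0, he⟩ := exists_valued_finiteMap ℚ (s w)
      have h2 : adeleAt (s w) y ∈ (s w).adicCompletionIntegers K := hw
      rw [← ha w a rfl (s w) (hs w), HeightOneSpectrum.mem_adicCompletionIntegers, he,
        pow_le_one_iff he0] at h2
      rwa [HeightOneSpectrum.mem_adicCompletionIntegers]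
    rwa [hs w] at h1
  refine ⟨((b : InfiniteAdeleRing ℚ), (⟨a, hint⟩ : FiniteAdeleRing (𝓞 ℚ) ℚ)), ?_⟩
  refine adele_ext' (fun w => ?_) fun v => ?_
  · exact hb _ b rfl w rfl
  · exact ha _ a rfl v rfl

include h in
/-- The norm of adeles of `ℚ(i)` is the product of the conjugates. -/
theorem adeleMap_ideleNorm (x : IdeleGroup K) :
    adeleMap ℚ K (ideleNorm K x).val = x.val * galAdele c x.val := by
  let : Algebra (AdeleRing (𝓞 ℚ) ℚ) (AdeleRing (𝓞 K) K) := (adeleMap ℚ K).toAlgebra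
  have hsmul : ∀ (a : AdeleRing (𝓞 ℚ) ℚ) (y : AdeleRing (𝓞 K) K), a • y = adeleMap ℚ K a * y :=
    fun _ _ => rfl
  set I : AdeleRing (𝓞 K) K := algebraMap K _ i with hI
  have hI2 : I * I = (-1 : AdeleRing (𝓞 ℚ) ℚ) • 1 + (0 : AdeleRing (𝓞 ℚ) ℚ) • I := by
    rw [hI, ← map_mul, ← pow_two, h.sq, zero_smul, add_zero, hsmul, map_neg, map_neg, map_one, map_one,
      mul_one]
  have hI2' : I * I = -1 := by rw [hI, ← map_mul, ← pow_two, h.sq, map_neg, map_one]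
  have hcI : galAdele c I = -I := by rw [hI, galAdele_algebraMap, h.conj, map_neg]
  have hhalf : ∀ y : AdeleRing (𝓞 K) K, algebraMap K (AdeleRing (𝓞 K) K) 2⁻¹ * (y + y) = y := by
    intro y
    rw [← two_mul, ← mul_assoc, ← map_ofNat (algebraMap K (AdeleRing (𝓞 K) K)) 2, ← map_mul]
    norm_num
  -- The adeles of `K` are free over those of `ℚ` on `1` and `i`. This identifies them with a
  -- quadratic algebra whose norm form is `re ^ 2 + im ^ 2`.
  let φ := QuadraticAlgebra.lift (R := AdeleRing (𝓞 ℚ) ℚ) (A := AdeleRing (𝓞 K) K) (a := -1)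
    (b := 0) ⟨I, hI2⟩
  have hφ : ∀ z, φ z = adeleMap ℚ K z.re + adeleMap ℚ K z.im * I := by
    intro z
    change z.re • (1 : AdeleRing (𝓞 K) K) + z.im • I = _
    rw [hsmul, hsmul, mul_one]
  have hcφ : ∀ z, galAdele c (φ z) = adeleMap ℚ K z.re - adeleMap ℚ K z.im * I := by
    intro z
    rw [hφ, map_add, map_mul, galAdele_adeleMap, galAdele_adeleMap, hcI]
    ring
  have hinj : Function.Injective φ := by
    rw [injective_iff_map_eq_zero]
    intro z hz
    have h1 := hφ z
    have h2 := hcφ z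
    rw [hz] at h1 h2
    rw [map_zero] at h2
    have h3 : adeleMap ℚ K z.re = 0 := by
      rw [← hhalf (adeleMap ℚ K z.re)]
      have : adeleMap ℚ K z.re + adeleMap ℚ K z.re = 0 := by linear_combination -h1 - h2
      rw [this, mul_zero]
    have h4 : adeleMap ℚ K z.im = 0 := by
      rw [h3] at h1
      linear_combination I * h1 + adeleMap ℚ K z.im * hI2'
    have h5 := adeleMap_injective (h3.trans (map_zero _).symm)
    have h6 := adeleMap_injective (h4.trans (map_zero _).symm)
    exact QuadraticAlgebra.ext h5 h6
  have hsurj : Function.Surjective φ := by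
    intro y
    have hcc := h.galAdele_galAdele y
    -- The real and imaginary parts `(y + c y) / 2` and `-i (y - c y) / 2` are fixed by conjugation,
    -- hence are adeles of `ℚ`.
    obtain ⟨a, ha⟩ := h.exists_adeleMap_eq (y := algebraMap K _ 2⁻¹ * (y + galAdele c y)) (by
      rw [map_mul, map_add, hcc, galAdele_algebraMap, map_inv₀, map_ofNat, add_comm])
    obtain ⟨b, hb⟩ := h.exists_adeleMap_eq
      (y := algebraMap K _ 2⁻¹ * (-I * (y - galAdele c y))) (by
      rw [map_mul, map_mul, map_sub, hcc, galAdele_algebraMap, map_inv₀, map_ofNat, map_neg, hcI]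
      ring)
    refine ⟨⟨a, b⟩, ?_⟩
    rw [hφ]
    change adeleMap ℚ K a + adeleMap ℚ K b * I = y
    rw [ha, hb]
    linear_combination hhalf y -
      algebraMap K (AdeleRing (𝓞 K) K) 2⁻¹ * (y - galAdele c y) * hI2'
  let e : QuadraticAlgebra (AdeleRing (𝓞 ℚ) ℚ) (-1) 0 ≃ₐ[AdeleRing (𝓞 ℚ) ℚ] AdeleRing (𝓞 K) K :=
    AlgEquiv.ofBijective φ ⟨hinj, hsurj⟩
  obtain ⟨z, hz⟩ := hsurj x.val
  have h8 : (ideleNorm K x).val = z.norm := by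
    change Algebra.norm (AdeleRing (𝓞 ℚ) ℚ) x.val = _
    rw [← hz, ← QuadraticAlgebra.det_toLinearMap_eq_norm]
    exact Algebra.norm_eq_of_algEquiv e z
  rw [h8, ← hz, hcφ, hφ, QuadraticAlgebra.norm_def]
  simp only [map_sub, map_add, map_mul, map_zero, map_neg, map_one]
  linear_combination adeleMap ℚ K z.im * adeleMap ℚ K z.im * hI2'

end IsGaussian
end Invariants

/-! ### Separation by signs, and subgroups of integral ideles -/

section Abstract

/-- Homomorphisms to `±1` separate a subgroup containing all squares from its complement. -/
theorem exists_monoidHom_eq_neg_one {G : Type*} [CommGroup G] (H : Subgroup G)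
    (hsq : ∀ x : G, x ^ 2 ∈ H) {g : G} (hg : g ∉ H) :
    ∃ f : G →* Circle, (∀ x ∈ H, f x = 1) ∧ f g = -1 ∧ ∀ x, f x ^ 2 = 1 := by
  -- The quotient is killed by squaring, so it is a vector space over `ZMod 2`; the character comes
  -- from a linear form equal to `1` at the class of `g`.
  let : Module (ZMod 2) (Additive (G ⧸ H)) := AddCommGroup.zmodModule (fun x => by
    induction x using Additive.rec with | _ x => ?_
    induction x using QuotientGroup.induction_on with | _ x => ?_
    exact congrArg Additive.ofMul ((QuotientGroup.eq_one_iff (x ^ 2)).2 (hsq x)))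
  have h0 : Additive.ofMul (QuotientGroup.mk g : G ⧸ H) ≠ 0 := fun h0 =>
    hg ((QuotientGroup.eq_one_iff g).1 h0)
  obtain ⟨φ, hφ⟩ := Module.Projective.exists_dual_eq_one (ZMod 2) h0
  let f : G →* Circle :=
    { toFun := fun x => ZMod.toCircle (φ (Additive.ofMul (QuotientGroup.mk x : G ⧸ H)))
      map_one' := by
        change ZMod.toCircle (φ 0) = 1
        rw [map_zero, AddChar.map_zero_eq_one]
      map_mul' := fun x y => by
        change ZMod.toCircle (φ (Additive.ofMul (QuotientGroup.mk x : G ⧸ H) +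
          Additive.ofMul (QuotientGroup.mk y : G ⧸ H))) = _
        rw [map_add, AddChar.map_add_eq_mul] }
  have hf : ∀ x, f x ^ 2 = 1 := fun x => by
    change ZMod.toCircle _ ^ 2 = 1
    rw [← AddChar.map_nsmul_eq_pow, CharTwo.two_nsmul, AddChar.map_zero_eq_one]
  refine ⟨f, fun x hx => ?_, ?_, hf⟩
  · change ZMod.toCircle (φ (Additive.ofMul (QuotientGroup.mk x : G ⧸ H))) = 1
    rw [(QuotientGroup.eq_one_iff x).2 hx]
    change ZMod.toCircle (φ 0) = 1
    rw [map_zero, AddChar.map_zero_eq_one]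
  · refine (circle_eq_one_or_neg_one (hf g)).resolve_left fun h1 => ?_
    have h2 : ZMod.toCircle (φ (Additive.ofMul (QuotientGroup.mk g : G ⧸ H))) = 1 := h1
    rw [hφ, ← AddChar.map_zero_eq_one (ZMod.toCircle (N := 2))] at h2
    exact one_ne_zero (ZMod.injective_toCircle h2)

variable {F : Type*} [Field F] [NumberField F]

/-- The subgroup of units congruent to `1` modulo the `n`-th power of the maximal ideal. -/
def higherUnits (v : HeightOneSpectrum (𝓞 F)) (n : ℕ) : Subgroup (v.adicCompletion F)ˣ where
  carrier := {u | IsHigherUnit v n u}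
  one_mem' := ⟨by simp, by simp⟩
  mul_mem' := by
    rintro x y ⟨hx, hx1⟩ ⟨hy, hy1⟩
    refine ⟨by simp [hx, hy], ?_⟩
    have : ((x * y : (v.adicCompletion F)ˣ) : v.adicCompletion F) - 1 =
        (x - 1) * y + (y - 1) := by
      rw [Units.val_mul]
      ring
    rw [this]
    refine (Valuation.map_add _ _ _).trans (max_le ?_ hy1)
    rwa [map_mul, hy, mul_one]
  inv_mem' := by
    rintro x ⟨hx, hx1⟩
    refine ⟨by simp [hx], ?_⟩
    have : ((x⁻¹ : (v.adicCompletion F)ˣ) : v.adicCompletion F) - 1 = -((x - 1) * x⁻¹) := by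
      have := x.ne_zero
      rw [Units.val_inv_eq_inv_val]
      field_simp
      ring
    rw [this, Valuation.map_neg, map_mul, Units.val_inv_eq_inv_val, map_inv₀, hx, inv_one, mul_one]
    exact hx1

theorem mem_higherUnits {v : HeightOneSpectrum (𝓞 F)} {n : ℕ} {u : (v.adicCompletion F)ˣ} :
    u ∈ higherUnits v n ↔ IsHigherUnit v n u := Iff.rfl

/-- The infinite component of an integral idele. -/
def infPart : (IntegralAdeles F)ˣ →* (InfiniteAdeleRing F)ˣ :=
  Units.map (RingHom.fst (InfiniteAdeleRing F)
    (∀ v : HeightOneSpectrum (𝓞 F), v.adicCompletionIntegers F)).toMonoidHom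

theorem infPart_integralUnit (y : (InfiniteAdeleRing F)ˣ) (u : ∀ v : HeightOneSpectrum (𝓞 F),
    (v.adicCompletion F)ˣ) (hu : ∀ v, Valued.v (u v : v.adicCompletion F) = 1) :
    infPart (integralUnit y u hu) = y := Units.ext rfl

theorem infPart_eq_one_iff {u : (IntegralAdeles F)ˣ} : infPart u = 1 ↔ u.val.1 = 1 :=
  Units.ext_iff

/-- The integral ideles that are trivial at infinity and higher units at `w`. -/
def integralHigherUnits (w : HeightOneSpectrum (𝓞 F)) (n : ℕ) : Subgroup (IntegralAdeles F)ˣ :=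
  infPart.ker ⊓ (higherUnits w n).comap (unitAt w)

theorem mem_integralHigherUnits {w : HeightOneSpectrum (𝓞 F)} {n : ℕ} {u : (IntegralAdeles F)ˣ} :
    u ∈ integralHigherUnits w n ↔ infPart u = 1 ∧ IsHigherUnit w n (unitAt w u) := Iff.rfl

theorem continuous_unitAt (v : HeightOneSpectrum (𝓞 F)) :
    Continuous fun u : (IntegralAdeles F)ˣ => (unitAt v u : v.adicCompletion F) :=
  continuous_subtype_val.comp <| (continuous_apply v).comp <| continuous_snd.comp
    Units.continuous_val

theorem eventually_isHigherUnit (v : HeightOneSpectrum (𝓞 F)) (n : ℕ) :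
    ∀ᶠ u in nhds (1 : (IntegralAdeles F)ˣ), IsHigherUnit v n (unitAt v u) := by
  have h1 := (continuous_unitAt v).tendsto 1
  rw [map_one, Units.val_one] at h1
  filter_upwards [h1.eventually (ball_mem_nhds v 1 (-(n : ℤ)))] with u hu
  exact ⟨valued_unitAt v u, hu⟩

theorem integralIdele_injective : Function.Injective (integralIdele F) :=
  (isOpenEmbedding_integralIdele F).injective

/-- Dividing by the square of an idele supported at infinity changes the infinite component to `1`
and no value of a quadratic character. -/
theorem apply_eq_one_of_infPart_eq_sq {f : (IntegralAdeles F)ˣ →* Circle} (hf2 : ∀ x, f x ^ 2 = 1)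
    {u : (IntegralAdeles F)ˣ} {z : (InfiniteAdeleRing F)ˣ} (hz : z ^ 2 = infPart u)
    (h : ∀ t, infPart t = 1 → (fun v => unitAt v t) = (fun v => unitAt v u) → f t = 1) :
    f u = 1 := by
  let s : (IntegralAdeles F)ˣ := integralUnit z (fun _ => 1) (by simp)
  have h1 := h (u * (s ^ 2)⁻¹)
    (by rw [map_mul, map_inv, map_pow, infPart_integralUnit, hz, mul_inv_cancel])
    (funext fun v => by rw [map_mul, map_inv, map_pow, unitAt_integralUnit]; simp)
  rwa [map_mul, map_inv, map_pow, hf2, inv_one, mul_one] at h1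

/-- The integral idele with component `x` at `v` and `1` elsewhere. -/
theorem exists_integralIdele_eq_localIdele (v : HeightOneSpectrum (𝓞 F))
    {x : (v.adicCompletion F)ˣ} (hx : Valued.v (x : v.adicCompletion F) = 1) :
    ∃ u, integralIdele F u = localIdele v x ∧ infPart u = 1 ∧ unitAt v u = x ∧
      ∀ w ≠ v, unitAt w u = 1 := by
  obtain ⟨u, hu⟩ := exists_integralIdele_eq (localIdele v x) (fun w => by
    by_cases hw : w = v
    · subst hw
      rw [adeleAt_localIdele_same, hx]
    · rw [adeleAt_localIdele_of_ne hw, map_one])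
  refine ⟨u, hu, ?_, Units.ext ?_, fun w hw => Units.ext ?_⟩
  · rw [infPart_eq_one_iff, ← adeleFst_integralIdele, hu, adeleFst_localIdele]
  · rw [← adeleAt_integralIdele, hu, adeleAt_localIdele_same]
  · rw [← adeleAt_integralIdele, hu, adeleAt_localIdele_of_ne hw]
    rfl

end Abstract

/-! ### Quadratic characters of `ℚ` ramified at one prime and possibly infinity -/

section Rational

theorem isReal_rat (w : InfinitePlace ℚ) : w.IsReal := by
  obtain rfl := Subsingleton.elim w Rat.infinitePlace
  exact ⟨Rat.castHom _, by ext; simp, rfl⟩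

theorem exists_sq_eq_of_pos {y : (InfiniteAdeleRing ℚ)ˣ}
    (hy : ∀ w : InfinitePlace ℚ,
      0 < InfinitePlace.Completion.extensionEmbeddingOfIsReal (isReal_rat w) (y.val w)) :
    ∃ z : (InfiniteAdeleRing ℚ)ˣ, z ^ 2 = y := by
  have h1 : ∀ w : InfinitePlace ℚ, ∃ z : w.Completion, z ^ 2 = y.val w := by
    intro w
    let e := InfinitePlace.Completion.ringEquivRealOfIsReal (isReal_rat w)
    have he : 0 < e (y.val w) := hy w
    refine ⟨e.symm (√(e (y.val w))), ?_⟩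
    rw [← map_pow, Real.sq_sqrt he.le]
    exact e.symm_apply_apply _
  choose z hz using h1
  let z' : InfiniteAdeleRing ℚ := z
  have hz' : z' ^ 2 = y.val := funext hz
  have hu : IsUnit z' := by
    rw [← isUnit_pow_iff two_ne_zero, hz']
    exact y.isUnit
  obtain ⟨u, hu⟩ := hu
  exact ⟨u, Units.ext (by rw [Units.val_pow_eq_pow_val, hu, hz'])⟩

/-- The real place separates `-1` from the squares. Thus a sign at infinity can absorb the global
unit `-1`, whatever the sign at the chosen prime. -/
theorem infinite_sq_ne_neg_one (y : (InfiniteAdeleRing ℚ)ˣ) : y ^ 2 ≠ -1 := by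
  intro h
  have h1 : (y.val Rat.infinitePlace) ^ 2 = -1 :=
    congrFun (congrArg Units.val h) Rat.infinitePlace
  have h2 := congrArg
    (InfinitePlace.Completion.extensionEmbeddingOfIsReal (isReal_rat Rat.infinitePlace)) h1
  rw [map_pow, map_neg, map_one] at h2
  nlinarith [sq_nonneg ((InfinitePlace.Completion.extensionEmbeddingOfIsReal
    (isReal_rat Rat.infinitePlace)) (y.val Rat.infinitePlace))]

theorem eventually_exists_sq :
    ∀ᶠ u in nhds (1 : (IntegralAdeles ℚ)ˣ), ∃ z : (InfiniteAdeleRing ℚ)ˣ, z ^ 2 = infPart u := by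
  have h1 : ∀ w : InfinitePlace ℚ, Continuous fun u : (IntegralAdeles ℚ)ˣ =>
      InfinitePlace.Completion.extensionEmbeddingOfIsReal (isReal_rat w) (u.val.1 w) := fun w =>
    (InfinitePlace.Completion.isometry_extensionEmbeddingOfIsReal (isReal_rat w)).continuous.comp
      ((continuous_apply w).comp (continuous_fst.comp Units.continuous_val))
  have h2 : ∀ w : InfinitePlace ℚ, ∀ᶠ u in nhds (1 : (IntegralAdeles ℚ)ˣ),
      0 < InfinitePlace.Completion.extensionEmbeddingOfIsReal (isReal_rat w) (u.val.1 w) := by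
    intro w
    refine ((h1 w).tendsto 1).eventually (lt_mem_nhds ?_)
    change 0 < InfinitePlace.Completion.extensionEmbeddingOfIsReal (isReal_rat w) 1
    rw [map_one]
    exact one_pos
  filter_upwards [Filter.eventually_all.2 h2] with u hu
  exact exists_sq_eq_of_pos (y := infPart u) hu

theorem exists_int_eq (x : 𝓞 ℚ) : ∃ m : ℤ, x = m := by
  obtain ⟨m, hm⟩ := exists_int_of_isIntegral_rat (K := ℚ) (x : ℚ) x.isIntegral_coe
  exact ⟨m, RingOfIntegers.ext (by simpa using hm)⟩

theorem eq_one_or_neg_one_of_valuation (a : ℚˣ)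
    (ha : ∀ v : HeightOneSpectrum (𝓞 ℚ), v.valuation ℚ (a : ℚ) = 1) : a = 1 ∨ a = -1 := by
  obtain ⟨x, hx⟩ := HeightOneSpectrum.mem_integers_of_valuation_le_one ℚ (a : ℚ)
    fun v => (ha v).le
  obtain ⟨y, hy⟩ := HeightOneSpectrum.mem_integers_of_valuation_le_one ℚ ((a⁻¹ : ℚˣ) : ℚ)
    fun v => by rw [Units.val_inv_eq_inv_val, map_inv₀, ha, inv_one]
  obtain ⟨m, rfl⟩ := exists_int_eq x
  obtain ⟨n, rfl⟩ := exists_int_eq y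
  rw [map_intCast] at hx hy
  have h1 : m * n = 1 := by
    have : ((m * n : ℤ) : ℚ) = 1 := by
      rw [Int.cast_mul, hx, hy, Units.mul_inv]
    exact_mod_cast this
  rcases Int.eq_one_or_neg_one_of_mul_eq_one h1 with rfl | rfl
  · exact .inl (Units.ext (by rw [← hx]; simp))
  · exact .inr (Units.ext (by rw [← hx]; simp))

instance : IsPrincipalIdealRing (𝓞 ℚ) :=
  IsPrincipalIdealRing.of_surjective (Int.castRingHom (𝓞 ℚ)) fun x => by
    obtain ⟨m, rfl⟩ := exists_int_eq x
    exact ⟨m, rfl⟩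

/-- A quadratic idele class character of `ℚ` ramified at most at `w` and infinity that takes the
value `-1` at a local non-square. -/
theorem exists_rat_character (w : HeightOneSpectrum (𝓞 ℚ)) (n : ℕ) (q : ℚˣ)
    (hq : w.valuation ℚ (q : ℚ) = 1)
    (hqn : ∀ a : ℤ, ¬ w.valuation ℚ ((q : ℚ) - a ^ 2) ≤ WithZero.exp (-(n : ℤ))) :
    ∃ ν : IdeleClassCharacter ℚ, (∀ x, ν.1 x ^ 2 = 1) ∧
      (∀ u ∈ integralHigherUnits w n, ν.1 (integralIdele ℚ u) = 1) ∧
      ν.1 (localIdele w (toLocal w q)) = -1 := by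
  obtain ⟨g, hg, hginf, hgw, -⟩ := exists_integralIdele_eq_localIdele w (x := toLocal w q)
    (by rw [valued_toLocal, hq])
  -- `H` gathers everything on which the character must be trivial. If `g` were in `H`, the real
  -- place would force an even power of `-1`, and then `q` would be a square modulo the `n`-th power
  -- of `w`, against `hqn`.
  let H : Subgroup (IntegralAdeles ℚ)ˣ :=
    (powMonoidHom 2).range ⊔ Subgroup.zpowers (-1) ⊔ integralHigherUnits w n
  have hgH : g ∉ H := by
    intro hgH
    obtain ⟨_, hx, t, ht, rfl⟩ := Subgroup.mem_sup.1 hgH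
    obtain ⟨_, ⟨s, rfl⟩, e, he, rfl⟩ := Subgroup.mem_sup.1 hx
    obtain ⟨k, rfl⟩ := Subgroup.mem_zpowers_iff.1 he
    change infPart (s ^ 2 * (-1) ^ k * t) = 1 at hginf
    change unitAt w (s ^ 2 * (-1) ^ k * t) = _ at hgw
    rw [mem_integralHigherUnits] at ht
    have hneg : infPart (-1 : (IntegralAdeles ℚ)ˣ) = -1 := Units.ext rfl
    rw [map_mul, map_mul, map_pow, map_zpow, ht.1, mul_one, hneg] at hginf
    rcases Int.even_or_odd k with hk | hk
    · rw [hk.neg_one_zpow, mul_one, map_mul, map_pow] at hgw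
      obtain ⟨a, b, hb, -, hab, -⟩ := exists_toLocal_near w n (unitAt w s) (valued_unitAt w s)
      obtain ⟨m, rfl⟩ := exists_int_eq a
      refine hqn m ?_
      have h1 : toLocal w (q * (b ^ 2)⁻¹) ∈ higherUnits w n := by
        rw [map_mul, map_inv, map_pow, ← hgw]
        have : unitAt w s ^ 2 * unitAt w t * (toLocal w b ^ 2)⁻¹ =
            (unitAt w s * (toLocal w b)⁻¹) ^ 2 * unitAt w t := by
          rw [mul_pow, inv_pow, mul_right_comm]
        rw [this]
        exact mul_mem (pow_mem hab 2) ht.2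
      have hb0 : (b : ℚ) ≠ 0 := b.ne_zero
      have h2 : (q : ℚ) - (m : ℚ) ^ 2 = ((q * (b ^ 2)⁻¹ : ℚˣ) - 1 : ℚ) * b ^ 2 := by
        have : (m : ℚ) = b := by rw [hb]; simp
        rw [this, Units.val_mul, Units.val_inv_eq_inv_val, Units.val_pow_eq_pow_val]
        field_simp
      rw [h2, map_mul, ← valued_toLocal_sub_one]
      refine (mul_le_of_le_one_right' ?_).trans h1.2
      rw [map_pow, hb]
      exact pow_le_one' (w.valuation_le_one _) 2
    · rw [hk.neg_one_zpow, mul_neg, mul_one, neg_eq_iff_eq_neg] at hginf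
      exact infinite_sq_ne_neg_one _ hginf
  obtain ⟨f, hf1, hfg, hf2⟩ := exists_monoidHom_eq_neg_one H
    (fun x => Subgroup.mem_sup_left (Subgroup.mem_sup_left ⟨x, rfl⟩)) hgH
  have hU : ∀ u ∈ integralHigherUnits w n, f u = 1 := fun u hu => hf1 u (Subgroup.mem_sup_right hu)
  have hfc : Continuous f := by
    refine continuous_of_continuousAt_one f ?_
    rw [ContinuousAt, map_one]
    refine tendsto_const_nhds.congr' ?_
    filter_upwards [eventually_exists_sq, eventually_isHigherUnit w n] with u ⟨z, hz⟩ hu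
    exact (apply_eq_one_of_infPart_eq_sq hf2 hz (fun t ht htw =>
      hU t (mem_integralHigherUnits.2
        ⟨ht, (congrFun htw w : unitAt w t = unitAt w u).symm ▸ hu⟩))).symm
  obtain ⟨ν, hν⟩ := exists_extension f hfc (fun a u hau => by
    have ha : ∀ v : HeightOneSpectrum (𝓞 ℚ), v.valuation ℚ (a : ℚ) = 1 := by
      intro v
      rw [← valued_algebraMap]
      have := valued_unitAt v u
      rw [← adeleAt_integralIdele, ← hau] at this
      exact this
    have h1 : (-1 : (IntegralAdeles ℚ)ˣ) ∈ H :=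
      Subgroup.mem_sup_left (Subgroup.mem_sup_right (Subgroup.mem_zpowers _))
    rcases eq_one_or_neg_one_of_valuation a ha with rfl | rfl
    · rw [map_one, ← map_one (integralIdele ℚ)] at hau
      rw [← integralIdele_injective hau, map_one]
    · have h2 : principalIdele ℚ (-1) = integralIdele ℚ (-1) := by
        refine Units.ext (adele_ext ?_ fun v => ?_)
        · change adeleFst (algebraMap ℚ _ (-1)) = -1
          rw [map_neg, map_neg, map_one, map_one]
        · change adeleAt v (algebraMap ℚ _ (-1)) = -1
          rw [map_neg, map_neg, map_one, map_one]
      rw [h2] at hau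
      rw [← integralIdele_injective hau, hf1 _ h1])
  refine ⟨ν, fun x => ?_, fun u hu => by rw [hν, hU u hu], by rw [← hg, hν, hfg]⟩
  obtain ⟨a, u, rfl⟩ := exists_principal_mul_integral x
  rw [map_mul, ν.2 a, one_mul, hν, hf2]

end Rational

/-! ### Base changes of rational quadratic characters -/

section BaseChange

variable {K : Type*} [Field K] [NumberField K] {i : K} {c : K ≃ₐ[ℚ] K} (h : IsGaussian i c)

theorem adeleAt_localIdele_toLocal {v w : HeightOneSpectrum (𝓞 K)} (hvw : w = v) (a : Kˣ) :
    adeleAt w (localIdele v (toLocal v a)).val = algebraMap K _ (a : K) := by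
  subst hvw
  exact adeleAt_localIdele_same _ _

theorem adeleAtInf_localIdele (v : HeightOneSpectrum (𝓞 K)) (x : (v.adicCompletion K)ˣ)
    (w : InfinitePlace K) : adeleAtInf w (localIdele v x).val = 1 := rfl

theorem exists_valued_galMap (σ : K ≃ₐ[ℚ] K) (v : HeightOneSpectrum (𝓞 K)) :
    ∃ e : ℕ, e ≠ 0 ∧ ∀ x : (conjPlace σ v).adicCompletion K,
      Valued.v (galMap σ v x) = Valued.v x ^ e :=
  @exists_valued_finiteMap K K _ _ _ _ (σ : K →+* K).toAlgebra v

theorem valued_galMap_le {σ : K ≃ₐ[ℚ] K} {v : HeightOneSpectrum (𝓞 K)}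
    {x : (conjPlace σ v).adicCompletion K} (hx : Valued.v x ≤ 1) :
    Valued.v (galMap σ v x) ≤ Valued.v x := by
  obtain ⟨e, he0, he⟩ := exists_valued_galMap σ v
  rw [he]
  exact pow_le_of_le_one zero_le hx he0

theorem valued_galMap_of_eq_one {σ : K ≃ₐ[ℚ] K} {v : HeightOneSpectrum (𝓞 K)}
    {x : (conjPlace σ v).adicCompletion K} (hx : Valued.v x = 1) :
    Valued.v (galMap σ v x) = 1 := by
  obtain ⟨e, he0, he⟩ := exists_valued_galMap σ v
  rw [he, hx, one_pow]

namespace IsGaussian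

include h in
theorem finiteMap_ideleNorm (x : IdeleGroup K) (v : HeightOneSpectrum (𝓞 K)) :
    finiteMap ℚ K v (adeleAt (below ℚ K v) (ideleNorm K x).val) =
      adeleAt v x.val * galMap c v (adeleAt (conjPlace c v) x.val) := by
  have := congrArg (adeleAt v) (h.adeleMap_ideleNorm x)
  rwa [adeleAt_adeleMap, map_mul, adeleAt_galAdele] at this

include h in
theorem infiniteMap_ideleNorm (x : IdeleGroup K) (w : InfinitePlace K) :
    infiniteMap ℚ K w (adeleAtInf (w.comap (algebraMap ℚ K)) (ideleNorm K x).val) =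
      adeleAtInf w x.val * galMapInf c w (adeleAtInf (w.comap (c : K →+* K)) x.val) := by
  have := congrArg (adeleAtInf w) (h.adeleMap_ideleNorm x)
  rwa [adeleAtInf_adeleMap, map_mul, adeleAtInf_galAdele] at this

include h in
theorem exists_ideleNorm_principalIdele (a : Kˣ) :
    ∃ q : ℚˣ, ideleNorm K (principalIdele K a) = principalIdele ℚ q := by
  obtain ⟨s, t, hst⟩ := exists_rat_add_rat_mul h.finrank h.sq (a : K)
  have h1 : algebraMap ℚ K (s ^ 2 + t ^ 2) = (a : K) * c a := by
    rw [hst, conj_add_mul h.conj]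
    simp
    linear_combination t ^ 2 * h.sq
  have h2 : s ^ 2 + t ^ 2 ≠ 0 := by
    intro h0
    rw [h0, map_zero] at h1
    exact mul_ne_zero a.ne_zero (by simp) h1.symm
  refine ⟨Units.mk0 _ h2, Units.ext (adeleMap_injective (K := K) ?_)⟩
  rw [h.adeleMap_ideleNorm]
  change algebraMap K _ (a : K) * galAdele c (algebraMap K _ (a : K)) =
    adeleMap ℚ K (algebraMap ℚ _ (s ^ 2 + t ^ 2))
  rw [galAdele_algebraMap, adeleMap_algebraMap, h1, map_mul]

include h in
-- The two cases are local degree one, where the norm leaves a rational `k` unchanged, and local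
-- degree two, where it is `k * c k`. Both sides are compared inside the adeles of `K`.
theorem ideleNorm_localIdele (v : HeightOneSpectrum (𝓞 K)) (q : ℚˣ) (k : Kˣ)
    (hk : conjPlace c v ≠ v ∧ (k : K) = algebraMap ℚ K q ∨
      conjPlace c v = v ∧ (k : K) * c k = algebraMap ℚ K q) :
    ideleNorm K (localIdele v (toLocal v k)) =
      localIdele (below ℚ K v) (toLocal (below ℚ K v) q) := by
  refine Units.ext (adeleMap_injective (K := K) (adele_ext' (fun w => ?_) fun u => ?_))
  · rw [adeleAtInf_adeleMap, adeleAtInf_adeleMap, h.infiniteMap_ideleNorm, adeleAtInf_localIdele,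
      adeleAtInf_localIdele, adeleAtInf_localIdele, map_one, map_one, mul_one]
  · rw [adeleAt_adeleMap, adeleAt_adeleMap, h.finiteMap_ideleNorm]
    by_cases huv : u = v
    · subst huv
      rw [adeleAt_localIdele_toLocal rfl, adeleAt_localIdele_toLocal rfl, finiteMap_algebraMap]
      rcases hk with ⟨hc, hk⟩ | ⟨hc, hk⟩
      · rw [adeleAt_localIdele_of_ne hc, map_one, mul_one, hk]
      · rw [adeleAt_localIdele_toLocal hc, galMap_algebraMap, ← map_mul, hk]
    · rw [adeleAt_localIdele_of_ne huv, one_mul]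
      by_cases hcu : conjPlace c u = v
      · rw [adeleAt_localIdele_toLocal hcu, galMap_algebraMap, adeleAt_localIdele_toLocal
          (by rw [← hcu, below_conjPlace]), finiteMap_algebraMap]
        have huc : u = conjPlace c v := by rw [← hcu, h.conjPlace_conjPlace]
        rcases hk with ⟨-, hk⟩ | ⟨hc, -⟩
        · rw [hk, c.commutes]
        · exact absurd (huc.trans hc) huv
      · rw [adeleAt_localIdele_of_ne hcu, map_one, adeleAt_localIdele_of_ne, map_one]
        intro hb
        rcases h.eq_or_eq_conjPlace (resChar_eq_of_below_eq hb) with h1 | h1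
        · exact huv h1
        · exact hcu (by rw [h1, h.conjPlace_conjPlace])

include h in
/-- Integral ideles close to `1` above `w` have norms close to `1` at `w`. -/
theorem exists_ideleNorm_integralIdele (v : HeightOneSpectrum (𝓞 K)) (n : ℕ) :
    ∃ M : ℕ, ∀ u : (IntegralAdeles K)ˣ, infPart u = 1 → IsHigherUnit v M (unitAt v u) →
      IsHigherUnit (conjPlace c v) M (unitAt (conjPlace c v) u) →
        ∃ t ∈ integralHigherUnits (below ℚ K v) n,
          integralIdele ℚ t = ideleNorm K (integralIdele K u) := by
  obtain ⟨e, he0, he⟩ := exists_valued_finiteMap ℚ v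
  -- Valuations are raised to the power `e` from `ℚ` to `K`, so level `n * e` above gives level `n`
  -- below.
  refine ⟨n * e, fun u hu h1 h2 => ?_⟩
  obtain ⟨t, ht⟩ := exists_integralIdele_eq (ideleNorm K (integralIdele K u)) (fun w => by
    obtain ⟨v', rfl⟩ := below_surjective ℚ K w
    obtain ⟨e', he0', he'⟩ := exists_valued_finiteMap ℚ v'
    have h3 := congrArg Valued.v (h.finiteMap_ideleNorm (integralIdele K u) v')
    rw [he', map_mul, adeleAt_integralIdele, adeleAt_integralIdele, valued_unitAt,
      valued_galMap_of_eq_one (valued_unitAt _ _), mul_one] at h3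
    exact (pow_eq_one_iff_of_nonneg zero_le he0').1 h3)
  refine ⟨t, mem_integralHigherUnits.2 ⟨?_, valued_unitAt _ _, ?_⟩, ht⟩
  · rw [infPart_eq_one_iff]
    funext w
    change adeleAtInf w (integralIdele ℚ t).val = 1
    rw [ht]
    obtain ⟨w', rfl⟩ := InfinitePlace.comap_surjective (K := K) w
    apply (infiniteMap ℚ K w').injective
    rw [h.infiniteMap_ideleNorm, map_one]
    rw [infPart_eq_one_iff] at hu
    have h3 : ∀ w'' : InfinitePlace K, adeleAtInf w'' (integralIdele K u).val = 1 :=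
      fun w'' => congrFun hu w''
    rw [h3, h3, map_one, mul_one]
  · rw [← adeleAt_integralIdele, ht]
    have h3 := h.finiteMap_ideleNorm (integralIdele K u) v
    have h4 : Valued.v (finiteMap ℚ K v (adeleAt (below ℚ K v)
        (ideleNorm K (integralIdele K u)).val - 1)) ≤ WithZero.exp (-((n * e : ℕ) : ℤ)) := by
      rw [map_sub (finiteMap ℚ K v), h3, map_one, adeleAt_integralIdele, adeleAt_integralIdele]
      have h5 : (unitAt v u : v.adicCompletion K) * galMap c v (unitAt (conjPlace c v) u) - 1 =
          (unitAt v u - 1) * galMap c v (unitAt (conjPlace c v) u) +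
            galMap c v (unitAt (conjPlace c v) u - 1) := by
        rw [map_sub, map_one]
        ring
      rw [h5]
      refine (Valuation.map_add _ _ _).trans (max_le ?_ ?_)
      · rw [map_mul, valued_galMap_of_eq_one h2.1, mul_one]
        exact h1.2
      · refine (valued_galMap_le (h2.2.trans ?_)).trans h2.2
        rw [← WithZero.exp_zero, WithZero.exp_le_exp]
        omega
    rw [he] at h4
    have h6 : WithZero.exp (-((n * e : ℕ) : ℤ)) = WithZero.exp (-(n : ℤ)) ^ e := by
      rw [← WithZero.exp_nsmul]
      congr 1
      push_cast
      simp [mul_comm]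
    rw [h6] at h4
    exact (pow_le_pow_iff_left₀ zero_le zero_le he0).1 h4

include h in
-- The twisting device: at one chosen pair of conjugate places it makes a prescribed local value
-- nontrivial, and it is unramified at all other places.
theorem exists_baseChange (v : HeightOneSpectrum (𝓞 K)) (n : ℕ) (q : ℚˣ) (k : Kˣ)
    (hq : (below ℚ K v).valuation ℚ (q : ℚ) = 1)
    (hqn : ∀ a : ℤ, ¬ (below ℚ K v).valuation ℚ ((q : ℚ) - a ^ 2) ≤ WithZero.exp (-(n : ℤ)))
    (hk : conjPlace c v ≠ v ∧ (k : K) = algebraMap ℚ K q ∨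
      conjPlace c v = v ∧ (k : K) * c k = algebraMap ℚ K q) :
    ∃ μ : IdeleClassCharacter K, IsBaseChange μ ∧ μ ^ 2 = 1 ∧
      (∀ u, u ≠ v → u ≠ conjPlace c v → conductorExponent μ u = 0) ∧ localValue μ v k = -1 := by
  obtain ⟨ν, hν2, hνU, hνq⟩ := exists_rat_character (below ℚ K v) n q hq hqn
  obtain ⟨M, hM⟩ := h.exists_ideleNorm_integralIdele v n
  let f : IdeleGroup K →* Circle := (ν.1 : IdeleGroup ℚ →* Circle).comp (ideleNorm K)
  have hf : ∀ x, f x = ν.1 (ideleNorm K x) := fun _ => rfl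
  have hfU : ∀ u : (IntegralAdeles K)ˣ, infPart u = 1 → IsHigherUnit v M (unitAt v u) →
      IsHigherUnit (conjPlace c v) M (unitAt (conjPlace c v) u) → f (integralIdele K u) = 1 := by
    intro u hu h1 h2
    obtain ⟨t, ht, htN⟩ := hM u hu h1 h2
    rw [hf, ← htN, hνU t ht]
  -- Continuity of the idele norm is not needed: `f` is trivial on integral ideles close to `1` at
  -- the two places, since the infinite component is a square.
  have hfc : Continuous f := by
    refine continuous_of_continuousAt_one f ?_
    rw [ContinuousAt, map_one]
    refine tendsto_const_nhds.congr' ?_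
    have h1 := (isOpenEmbedding_integralIdele K).map_nhds_eq 1
    rw [map_one] at h1
    rw [← h1]
    change ∀ᶠ x in _, _ = _
    rw [Filter.eventually_map]
    filter_upwards [eventually_isHigherUnit v M, eventually_isHigherUnit (conjPlace c v) M]
      with u hu hu'
    obtain ⟨z, hz⟩ := h.exists_sq_eq (infPart u)
    refine (apply_eq_one_of_infPart_eq_sq (f := f.comp (integralIdele K))
      (fun x => hν2 _) hz fun t ht htu => hfU t ht ?_ ?_).symm
    · exact (congrFun htu v : unitAt v t = unitAt v u).symm ▸ hu
    · exact (congrFun htu (conjPlace c v) :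
        unitAt (conjPlace c v) t = unitAt (conjPlace c v) u).symm ▸ hu'
  let μ : IdeleClassCharacter K := ⟨⟨f, hfc⟩, fun a => by
    obtain ⟨b, hb⟩ := h.exists_ideleNorm_principalIdele a
    change ν.1 (ideleNorm K (principalIdele K a)) = 1
    rw [hb, ν.2 b]⟩
  have hμ2 : μ ^ 2 = 1 := Subtype.ext (DFunLike.ext _ _ fun x => hν2 _)
  refine ⟨μ, ⟨ν, fun _ => rfl⟩, hμ2, fun u hu1 hu2 => ?_, ?_⟩
  · rw [conductorExponent_eq_zero_iff hμ2]
    intro x hx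
    obtain ⟨t, ht, ht1, -, ht2⟩ := exists_integralIdele_eq_localIdele u hx.1
    change f (localIdele u x) = 1
    rw [← ht]
    refine hfU t ht1 ?_ ?_
    · rw [ht2 v hu1.symm]; exact (higherUnits v M).one_mem
    · rw [ht2 _ hu2.symm]; exact (higherUnits _ M).one_mem
  · change ν.1 (ideleNorm K (localIdele v (toLocal v k))) = -1
    rw [h.ideleNorm_localIdele v q k hk, hνq]

end IsGaussian
end BaseChange

/-! ### Tame quadratic characters are residue symbols -/

section Tame

variable {K : Type*} [Field K] [NumberField K]

theorem isSquare_mul_of_not_isSquare {F : Type*} [Field F] [Finite F] {a b : F}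
    (ha : ¬ IsSquare a) (hb : ¬ IsSquare b) : IsSquare (a * b) := by
  classical
  have := Fintype.ofFinite F
  have ha0 : a ≠ 0 := by rintro rfl; exact ha (IsSquare.zero)
  have hb0 : b ≠ 0 := by rintro rfl; exact hb (IsSquare.zero)
  rw [← quadraticChar_one_iff_isSquare (mul_ne_zero ha0 hb0), map_mul,
    quadraticChar_neg_one_iff_not_isSquare.2 ha, quadraticChar_neg_one_iff_not_isSquare.2 hb]
  norm_num

theorem isHigherUnit_toLocal_mul_inv {v : HeightOneSpectrum (𝓞 K)} {n : ℕ} {a t : 𝓞 K} {x y : Kˣ}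
    (hx : (x : K) = a) (hy : (y : K) = t) (ha : a ∉ v.asIdeal) (ht : t ∉ v.asIdeal)
    (hat : a - t ∈ v.asIdeal ^ n) : IsHigherUnit v n (toLocal v x * (toLocal v y)⁻¹) := by
  have hvx : v.valuation K (x : K) = 1 := by
    rw [hx]; exact (HeightOneSpectrum.valuation_eq_one_iff_notMem v).2 ha
  have hvy : v.valuation K (y : K) = 1 := by
    rw [hy]; exact (HeightOneSpectrum.valuation_eq_one_iff_notMem v).2 ht
  rw [← map_inv, ← map_mul]
  refine ⟨?_, ?_⟩
  · rw [valued_toLocal, Units.val_mul, Units.val_inv_eq_inv_val, map_mul, map_inv₀, hvx, hvy,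
      inv_one, mul_one]
  · rw [valued_toLocal_sub_one]
    have hy0 : (y : K) ≠ 0 := y.ne_zero
    have h1 : ((x * y⁻¹ : Kˣ) : K) - 1 = (algebraMap (𝓞 K) K (a - t)) * (y : K)⁻¹ := by
      rw [map_sub]
      change _ = ((a : K) - t) * _
      rw [← hx, ← hy, Units.val_mul, Units.val_inv_eq_inv_val]
      field_simp
    rw [h1, map_mul, map_inv₀, hvy, inv_one, mul_one, HeightOneSpectrum.valuation_of_algebraMap]
    exact (HeightOneSpectrum.intValuation_le_pow_iff_mem _ _ _).2 hat

variable {v : HeightOneSpectrum (𝓞 K)} {f : (v.adicCompletion K)ˣ →* Circle}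

theorem apply_toLocal_eq_one_of_isSquare (hf : TrivialOn v 1 f) (hf2 : ∀ x, f x ^ 2 = 1)
    {a : 𝓞 K} {b : Kˣ} (hb : (b : K) = a) (ha : a ∉ v.asIdeal)
    (hsq : IsSquare (Ideal.Quotient.mk v.asIdeal a)) : f (toLocal v b) = 1 := by
  obtain ⟨s, hs⟩ := hsq
  obtain ⟨t, rfl⟩ := Ideal.Quotient.mk_surjective s
  rw [← map_mul, Ideal.Quotient.mk_eq_mk_iff_sub_mem] at hs
  have ht : t * t ∉ v.asIdeal := fun ht => ha (by simpa using add_mem hs ht)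
  have ht0 : (t : K) ≠ 0 := by
    intro h0
    have : t = 0 := RingOfIntegers.ext h0
    exact ht (by simp [this])
  have h1 := hf _ (isHigherUnit_toLocal_mul_inv (n := 1) (y := Units.mk0 (t : K) ht0 ^ 2) hb
    (by simp [pow_two]) ha ht (by rwa [pow_one]))
  rwa [map_mul, map_inv, map_pow, map_pow, hf2, inv_one, mul_one] at h1

/-- The squares have index two in the residue field units. A tame quadratic character trivial at one
non-square would therefore be trivial on all units. -/
theorem apply_toLocal_eq_one_iff_isSquare (hf : TrivialOn v 1 f) (hf2 : ∀ x, f x ^ 2 = 1)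
    (hf0 : ¬ TrivialOn v 0 f) {a : 𝓞 K} {b : Kˣ} (hb : (b : K) = a) (ha : a ∉ v.asIdeal) :
    f (toLocal v b) = 1 ↔ IsSquare (Ideal.Quotient.mk v.asIdeal a) := by
  refine ⟨fun h1 => ?_, apply_toLocal_eq_one_of_isSquare hf hf2 hb ha⟩
  by_contra hsq
  have := v.isMaximal
  let : Field (𝓞 K ⧸ v.asIdeal) := Ideal.Quotient.field v.asIdeal
  have : Finite (𝓞 K ⧸ v.asIdeal) := Ideal.finiteQuotientOfFreeOfNeBot _ v.ne_bot
  refine hf0 (hf.of_integers fun a' b' hb' ha' _ => ?_)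
  by_cases hsq' : IsSquare (Ideal.Quotient.mk v.asIdeal a')
  · exact apply_toLocal_eq_one_of_isSquare hf hf2 hb' ha' hsq'
  · have h2 := isSquare_mul_of_not_isSquare hsq hsq'
    rw [← map_mul] at h2
    have h3 := apply_toLocal_eq_one_of_isSquare hf hf2 (b := b * b') (by simp [hb, hb'])
      (fun h4 => (v.isPrime.mem_or_mem h4).elim ha ha') h2
    rwa [map_mul, map_mul, h1, one_mul] at h3

/-- Both characters restrict to the same residue symbol on units, so they cancel. -/
theorem conductorExponent_mul_eq_zero_of_ne_zero {χ ψ : IdeleClassCharacter K} (hχ : χ ^ 2 = 1)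
    (hψ : ψ ^ 2 = 1) (hv : resChar v ≠ 2) (h1 : conductorExponent χ v ≠ 0)
    (h2 : conductorExponent ψ v ≠ 0) : conductorExponent (χ * ψ) v = 0 := by
  have e1 := (conductorExponent_le_iff' hχ).1 (conductorExponent_le_one hχ hv)
  have e2 := (conductorExponent_le_iff' hψ).1 (conductorExponent_le_one hψ hv)
  have hχψ : (χ * ψ) ^ 2 = 1 := by rw [mul_pow, hχ, hψ, one_mul]
  have e3 := (conductorExponent_le_iff' hχψ).1 (conductorExponent_le_one hχψ hv)
  rw [Ne, conductorExponent_eq_zero_iff hχ] at h1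
  rw [Ne, conductorExponent_eq_zero_iff hψ] at h2
  rw [conductorExponent_eq_zero_iff hχψ]
  refine e3.of_integers fun a b hb ha _ => ?_
  have f1 := apply_toLocal_eq_one_iff_isSquare e1 (localChar_sq_eq_one hχ v) h1 hb ha
  have f2 := apply_toLocal_eq_one_iff_isSquare e2 (localChar_sq_eq_one hψ v) h2 hb ha
  rw [localChar_char_mul]
  by_cases hsq : IsSquare (Ideal.Quotient.mk v.asIdeal a)
  · rw [f1.2 hsq, f2.2 hsq, one_mul]
  · rw [(circle_eq_one_or_neg_one (localChar_sq_eq_one hχ v _)).resolve_left (mt f1.1 hsq),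
      (circle_eq_one_or_neg_one (localChar_sq_eq_one hψ v _)).resolve_left (mt f2.1 hsq)]
    exact Subtype.ext (by simp)

theorem conductorExponent_one (v : HeightOneSpectrum (𝓞 K)) :
    conductorExponent (1 : IdeleClassCharacter K) v = 0 :=
  (conductorExponent_eq_zero_iff (one_pow 2)).2 fun _ _ => rfl

theorem conductorExponent_mul_ne_zero {χ ψ : IdeleClassCharacter K} (hχ : χ ^ 2 = 1)
    (hψ : ψ ^ 2 = 1) (h1 : conductorExponent χ v = 0) (h2 : conductorExponent ψ v ≠ 0) :
    conductorExponent (χ * ψ) v ≠ 0 := by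
  intro h0
  have h3 := conductorExponent_mul_eq_zero hχ (by rw [mul_pow, hχ, hψ, one_mul]) h1 h0
  rw [← mul_assoc, ← pow_two, hχ, one_mul] at h3
  exact h2 h3

theorem isBaseChange_one : IsBaseChange (1 : IdeleClassCharacter K) := ⟨1, fun _ => rfl⟩

theorem IsBaseChange.mul {χ ψ : IdeleClassCharacter K} (hχ : IsBaseChange χ)
    (hψ : IsBaseChange ψ) : IsBaseChange (χ * ψ) := by
  obtain ⟨ν, hν⟩ := hχ
  obtain ⟨ν', hν'⟩ := hψ
  refine ⟨ν * ν', fun x => ?_⟩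
  change χ.1 x * ψ.1 x = ν.1 _ * ν'.1 _
  rw [hν, hν']

end Tame

/-! ### Rational integers at the place below -/

section BelowRational

variable {K : Type*} [Field K] [NumberField K] {v : HeightOneSpectrum (𝓞 K)}

theorem intCast_mem_below_iff (v : HeightOneSpectrum (𝓞 K)) (m : ℤ) :
    (m : 𝓞 ℚ) ∈ (below ℚ K v).asIdeal ↔ (resChar v : ℤ) ∣ m := by
  rw [mem_below ℚ K (y := (m : 𝓞 K)) (by simp), intCast_mem_iff]

theorem valuation_below_intCast_eq_one {m : ℤ} (hm : ¬ (resChar v : ℤ) ∣ m) :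
    (below ℚ K v).valuation ℚ (m : ℚ) = 1 := by
  have h1 : (m : ℚ) = algebraMap (𝓞 ℚ) ℚ m := by simp
  rw [h1, HeightOneSpectrum.valuation_eq_one_iff_notMem, intCast_mem_below_iff]
  exact hm

theorem valuation_below_intCast_le {m : ℤ}
    (hm : (below ℚ K v).valuation ℚ (m : ℚ) ≤ WithZero.exp (-((1 : ℕ) : ℤ))) :
    (resChar v : ℤ) ∣ m := by
  have h1 : (m : ℚ) = algebraMap (𝓞 ℚ) ℚ m := by simp
  rwa [h1, HeightOneSpectrum.valuation_of_algebraMap,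
    HeightOneSpectrum.intValuation_le_pow_iff_mem, pow_one, intCast_mem_below_iff] at hm

theorem valuation_below_resChar (v : HeightOneSpectrum (𝓞 K)) :
    (below ℚ K v).valuation ℚ (resChar v : ℚ) = WithZero.exp (-1 : ℤ) := by
  have h1 : (resChar v : ℚ) = algebraMap (𝓞 ℚ) ℚ (resChar v : 𝓞 ℚ) := by simp
  rw [h1, HeightOneSpectrum.valuation_of_algebraMap]
  refine HeightOneSpectrum.intValuation_singleton _ ?_ ?_
  · exact_mod_cast (prime_resChar v).ne_zero
  · ext x
    obtain ⟨m, rfl⟩ := exists_int_eq x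
    rw [intCast_mem_below_iff, Ideal.mem_span_singleton]
    constructor
    · rintro ⟨k, rfl⟩
      exact ⟨k, by push_cast; rfl⟩
    · rintro ⟨y, hy⟩
      obtain ⟨k, rfl⟩ := exists_int_eq y
      exact ⟨k, by exact_mod_cast hy⟩

end BelowRational

/-! ### Twisting to a normalized character -/

section Twists

variable {K : Type*} [Field K] [NumberField K] {i : K} {c : K ≃ₐ[ℚ] K} (h : IsGaussian i c)
  {v : HeightOneSpectrum (𝓞 K)}

namespace IsGaussian

include h in
-- A non-residue modulo `p` is a norm from `K_v`: trivially at a split place, and at a fixed place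
-- because every residue is a sum of two squares, hence the norm of some `a + b i`.
theorem exists_baseChange_ramified (hv : resChar v ≠ 2) :
    ∃ μ : IdeleClassCharacter K, IsBaseChange μ ∧ μ ^ 2 = 1 ∧
      (∀ u, u ≠ v → u ≠ conjPlace c v → conductorExponent μ u = 0) ∧
      conductorExponent μ v ≠ 0 := by
  have hp : Fact (resChar v).Prime := ⟨prime_resChar v⟩
  obtain ⟨r, hr⟩ := FiniteField.exists_nonsquare (F := ZMod (resChar v))
    (by rwa [ZMod.ringChar_zmod_n])
  have key : ∃ (q : ℤ) (k : K), (q : ZMod (resChar v)) = r ∧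
      (conjPlace c v ≠ v ∧ k = algebraMap ℚ K q ∨
        conjPlace c v = v ∧ k * c k = algebraMap ℚ K q) := by
    by_cases hcv : conjPlace c v = v
    · obtain ⟨a, b, hab⟩ := ZMod.sq_add_sq (resChar v) r
      obtain ⟨a, rfl⟩ := ZMod.intCast_surjective a
      obtain ⟨b, rfl⟩ := ZMod.intCast_surjective b
      refine ⟨a ^ 2 + b ^ 2, a + b * i, by push_cast; exact hab, .inr ⟨hcv, ?_⟩⟩
      simp [h.conj]
      linear_combination -(b : K) ^ 2 * h.sq
    · obtain ⟨q, rfl⟩ := ZMod.intCast_surjective r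
      exact ⟨q, algebraMap ℚ K q, rfl, .inl ⟨hcv, rfl⟩⟩
  obtain ⟨q, k, rfl, hk⟩ := key
  have hqd : ¬ (resChar v : ℤ) ∣ q := by
    intro hd
    rw [(ZMod.intCast_zmod_eq_zero_iff_dvd _ _).2 hd] at hr
    exact hr IsSquare.zero
  have hqv := valuation_below_intCast_eq_one hqd
  have hq0 : (q : ℚ) ≠ 0 := by
    intro h0
    rw [h0, map_zero] at hqv
    exact zero_ne_one hqv
  have hvq : v.valuation K (algebraMap ℚ K q) = 1 := by
    obtain ⟨e, -, he⟩ := exists_valuation_below ℚ K v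
    rw [he, hqv, one_pow]
  have hkv : v.valuation K k = 1 := by
    rcases hk with ⟨-, hk⟩ | ⟨hcv, hk⟩
    · rw [hk, hvq]
    · rw [← hk, map_mul, ← valuation_conjPlace, hcv, ← pow_two] at hvq
      exact (pow_eq_one_iff_of_nonneg zero_le two_ne_zero).1 hvq
  have hk0 : k ≠ 0 := by
    intro h0
    rw [h0, map_zero] at hkv
    exact zero_ne_one hkv
  have hqn : ∀ a : ℤ, ¬ (below ℚ K v).valuation ℚ ((q : ℚ) - a ^ 2) ≤
      WithZero.exp (-((1 : ℕ) : ℤ)) := by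
    intro a ha
    have h5 : (resChar v : ℤ) ∣ q - a ^ 2 := valuation_below_intCast_le (by push_cast; exact ha)
    rw [← ZMod.intCast_zmod_eq_zero_iff_dvd] at h5
    push_cast at h5
    exact hr ⟨a, by linear_combination h5⟩
  obtain ⟨μ, h1, h2, h3, h4⟩ := h.exists_baseChange v 1 (Units.mk0 _ hq0) (Units.mk0 k hk0) hqv
    hqn hk
  refine ⟨μ, h1, h2, h3, fun h5 => ?_⟩
  rw [conductorExponent_eq_zero_iff h2] at h5
  have h6 := h5 (toLocal v (Units.mk0 k hk0)) (isHigherUnit_zero_iff.2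
    (by rw [valued_toLocal]; exact hkv))
  rw [← localValue_eq, h4] at h6
  exact circle_neg_one_ne_one h6

include h in
-- `13` is the norm of `1 + π ^ 3` and is not a square modulo `8`, hence the level `3`.
theorem exists_baseChange_two (hv : resChar v = 2) :
    ∃ μ : IdeleClassCharacter K, IsBaseChange μ ∧ μ ^ 2 = 1 ∧
      (∀ u, u ≠ v → conductorExponent μ u = 0) ∧
      localValue μ v (onePlusPiCubed i h.sq) = -1 := by
  have hcv := h.conjPlace_of_two hv
  have h13 : ((13 : ℤ) : ℚ) ≠ 0 := by norm_num
  have hv2 := valuation_below_resChar v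
  rw [hv] at hv2
  have hqn : ∀ a : ℤ, ¬ (below ℚ K v).valuation ℚ (((13 : ℤ) : ℚ) - a ^ 2) ≤
      WithZero.exp (-((3 : ℕ) : ℤ)) := by
    intro a ha
    have ha' : (below ℚ K v).valuation ℚ ((13 - a ^ 2 : ℤ) : ℚ) ≤ WithZero.exp (-((3 : ℕ) : ℤ)) := by
      push_cast; exact ha
    have h5 : (resChar v : ℤ) ∣ 13 - a ^ 2 := valuation_below_intCast_le (ha'.trans (by
      rw [WithZero.exp_le_exp]; norm_num))
    rw [hv] at h5
    have h6 : ¬ (2 : ℤ) ∣ a := by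
      rintro ⟨b, rfl⟩
      have : (13 : ℤ) - (2 * b) ^ 2 = 2 * (6 - 2 * b ^ 2) + 1 := by ring
      push_cast at h5
      omega
    obtain ⟨b, rfl⟩ : ∃ b, a = 2 * b + 1 := ⟨a / 2, by omega⟩
    -- The square of an odd integer is `1 + 8d`, so `13 - a ^ 2 = 4 (3 - 2d)` is divisible by `4`
    -- but not by `8`.
    obtain ⟨d, hd⟩ := Int.even_mul_succ_self b
    have h7 : (13 : ℤ) - (2 * b + 1) ^ 2 = 2 * 2 * (3 - 2 * d) := by linear_combination -4 * hd
    have h8 : (below ℚ K v).valuation ℚ ((3 - 2 * d : ℤ) : ℚ) = 1 :=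
      valuation_below_intCast_eq_one (by rw [hv]; push_cast; omega)
    rw [h7, Int.cast_mul, Int.cast_mul, map_mul, map_mul, h8, mul_one] at ha'
    have h9 : ((2 : ℤ) : ℚ) = ((2 : ℕ) : ℚ) := by norm_num
    rw [h9, hv2, ← WithZero.exp_add, WithZero.exp_le_exp] at ha'
    norm_num at ha'
  have hk : (onePlusPiCubed i h.sq : K) * c (onePlusPiCubed i h.sq) =
      algebraMap ℚ K ((13 : ℤ) : ℚ) := by
    change (1 + (i - 1) ^ 3) * c (1 + (i - 1) ^ 3) = algebraMap ℚ K (13 : ℤ)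
    rw [map_add, map_pow, map_sub, map_one, h.conj, map_intCast]
    push_cast
    linear_combination (- i ^ 4 + 4 * i ^ 2 - 13) * h.sq
  obtain ⟨μ, h1, h2, h3, h4⟩ := h.exists_baseChange v 3 (Units.mk0 _ h13)
    (onePlusPiCubed i h.sq) (valuation_below_intCast_eq_one (by rw [hv]; norm_num)) hqn
    (.inr ⟨hcv, hk⟩)
  exact ⟨μ, h1, h2, fun u hu => h3 u hu (by rwa [hcv]), h4⟩

include h in
-- A twist for `v` may also ramify at its conjugate. Two distinct conjugate places in `V` could
-- therefore undo each other, which `hVc` rules out.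
theorem exists_baseChange_ramified_on (V : Finset (HeightOneSpectrum (𝓞 K)))
    (hV : ∀ v ∈ V, resChar v ≠ 2) (hVc : ∀ v ∈ V, conjPlace c v ∈ V → conjPlace c v = v) :
    ∃ μ : IdeleClassCharacter K, IsBaseChange μ ∧ μ ^ 2 = 1 ∧
      (∀ u, u ∉ V → conjPlace c u ∉ V → conductorExponent μ u = 0) ∧
      ∀ u ∈ V, conductorExponent μ u ≠ 0 := by
  classical
  induction V using Finset.induction_on with
  | empty => exact ⟨1, isBaseChange_one, one_pow 2, fun u _ _ => conductorExponent_one u, by simp⟩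
  | insert v V hvV ih =>
    obtain ⟨μ, h1, h2, h3, h4⟩ := ih (fun u hu => hV u (Finset.mem_insert_of_mem hu))
      (fun u hu hcu => hVc u (Finset.mem_insert_of_mem hu) (Finset.mem_insert_of_mem hcu))
    obtain ⟨η, g1, g2, g3, g4⟩ := h.exists_baseChange_ramified
      (hV v (Finset.mem_insert_self v V))
    refine ⟨μ * η, h1.mul g1, by rw [mul_pow, h2, g2, one_mul], fun u hu hcu => ?_, fun u hu => ?_⟩
    · rw [Finset.mem_insert, not_or] at hu hcu
      refine conductorExponent_mul_eq_zero h2 g2 (h3 u hu.2 hcu.2) (g3 u hu.1 fun h5 => hcu.1 ?_)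
      rw [h5, h.conjPlace_conjPlace]
    · rcases Finset.mem_insert.1 hu with rfl | huV
      · refine conductorExponent_mul_ne_zero h2 g2 (h3 u hvV fun hcu => hvV ?_) g4
        have := hVc u (Finset.mem_insert_self u V) (Finset.mem_insert_of_mem hcu)
        rwa [this] at hcu
      · rw [mul_comm]
        refine conductorExponent_mul_ne_zero g2 h2 (g3 u (ne_of_mem_of_not_mem huV hvV)
          fun h5 => hvV ?_) (h4 u huV)
        have h6 := hVc v (Finset.mem_insert_self v V) (by
          rw [← h5]; exact Finset.mem_insert_of_mem huV)
        rwa [← h6, ← h5]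

include h in
theorem exists_twist_isNormalized {S : Set (HeightOneSpectrum (𝓞 K))}
    (hS : IsChoiceOfSplitPlaces S) {χ : IdeleClassCharacter K} (hχ : χ ^ 2 = 1) :
    ∃ μ : IdeleClassCharacter K, IsBaseChange μ ∧ (χ * μ) ^ 2 = 1 ∧
      IsNormalized i h.sq S (χ * μ) := by
  classical
  obtain ⟨T, -, hT⟩ := h.exists_finset_eq_prod hχ
  -- The filter keeps the odd ramified places of `χ` that are not split places in `S`. Of two
  -- distinct conjugate places one is in `S`, so at most the other is kept.
  obtain ⟨μ, h1, h2, h3, h4⟩ := h.exists_baseChange_ramified_on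
    (T.filter fun v => resChar v ≠ 2 ∧ conductorExponent χ v ≠ 0 ∧
      ¬ (v ∈ S ∧ conjPlace c v ≠ v)) (by simp +contextual) (by
    intro v hv hcv
    by_contra hne
    rw [Finset.mem_filter, h.conjPlace_conjPlace] at hcv
    rw [Finset.mem_filter] at hv
    exact hcv.2.2.2 ⟨by_contra fun h5 =>
      hv.2.2.2 ⟨(h.mem_iff_conjPlace_notMem hS hne).2 h5, hne⟩, Ne.symm hne⟩)
  have hχμ : (χ * μ) ^ 2 = 1 := by rw [mul_pow, hχ, h2, one_mul]
  have hodd : ∀ v, resChar v ≠ 2 → conductorExponent (χ * μ) v ≠ 0 →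
      v ∈ S ∧ conjPlace c v ≠ v := by
    intro v hv hv0
    by_contra hvS
    by_cases hχv : conductorExponent χ v = 0
    · refine hv0 (conductorExponent_mul_eq_zero hχ h2 hχv (h3 v (by simp [hχv]) fun hcv => ?_))
      rw [Finset.mem_filter, h.conjPlace_conjPlace] at hcv
      by_cases hne : conjPlace c v = v
      · rw [hne] at hcv
        exact hcv.2.2.1 hχv
      · refine hcv.2.2.2 ⟨by_contra fun h5 =>
          hvS ⟨(h.mem_iff_conjPlace_notMem hS hne).2 h5, hne⟩, Ne.symm hne⟩
    · refine hv0 (conductorExponent_mul_eq_zero_of_ne_zero hχ h2 hv hχv (h4 v ?_))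
      exact Finset.mem_filter.2 ⟨by_contra fun h5 => hχv (hT v h5), hv, hχv, hvS⟩
  by_cases hall : ∀ v, resChar v = 2 → localValue (χ * μ) v (onePlusPiCubed i h.sq) = 1
  · exact ⟨μ, h1, hχμ, (h.isNormalized_iff hχμ).2 ⟨hodd, hall⟩⟩
  · push Not at hall
    obtain ⟨v, hv, hv1⟩ := hall
    -- The wrong sign at `1 + π ^ 3` is corrected by a base change that is unramified at odd places
    -- and so preserves what was achieved there.
    obtain ⟨η, g1, g2, g3, g4⟩ := h.exists_baseChange_two hv
    have hsq : (χ * (μ * η)) ^ 2 = 1 := by rw [← mul_assoc, mul_pow, hχμ, g2, one_mul]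
    refine ⟨μ * η, h1.mul g1, hsq, (h.isNormalized_iff hsq).2 ⟨fun u hu hu0 => ?_, fun u hu => ?_⟩⟩
    · refine hodd u hu fun h5 => hu0 ?_
      rw [← mul_assoc]
      exact conductorExponent_mul_eq_zero hχμ g2 h5 (g3 u fun h6 => hu (h6 ▸ hv))
    · obtain rfl := h.eq_of_two hv hu
      have h5 : localValue (χ * μ) v (onePlusPiCubed i h.sq) = -1 :=
        (circle_eq_one_or_neg_one (localChar_sq_eq_one hχμ v _)).resolve_left hv1
      rw [← mul_assoc, localValue_char_mul, g4, h5]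
      exact Subtype.ext (by simp)

end IsGaussian
end Twists

/-! ### Residue fields, squareness of `i`, and global units -/

section ResidueField

variable {K : Type*} [Field K] [NumberField K] {i : K} {c : K ≃ₐ[ℚ] K} (h : IsGaussian i c)

theorem charP_quotient (v : HeightOneSpectrum (𝓞 K)) : CharP (𝓞 K ⧸ v.asIdeal) (resChar v) :=
  ⟨fun n => by
    rw [← map_natCast (Ideal.Quotient.mk v.asIdeal), Ideal.Quotient.eq_zero_iff_mem]
    exact above_iff_dvd v n⟩

theorem intI_notMem (hi : i ^ 2 = -1) (v : HeightOneSpectrum (𝓞 K)) : intI hi ∉ v.asIdeal := by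
  intro h1
  have h2 := v.asIdeal.mul_mem_left (-intI hi) h1
  have h3 : -intI hi * intI hi = 1 := by linear_combination -intI_sq hi
  rw [h3] at h2
  exact v.isPrime.ne_top ((Ideal.eq_top_iff_one _).2 h2)

namespace IsGaussian

include h in
theorem natCard_quotient {v : HeightOneSpectrum (𝓞 K)} (hcv : conjPlace c v ≠ v) :
    Nat.card (𝓞 K ⧸ v.asIdeal) = resChar v := by
  have := charP_quotient v
  have hp : Fact (resChar v).Prime := ⟨prime_resChar v⟩
  have hb : Function.Bijective (ZMod.castHom (dvd_refl (resChar v)) (𝓞 K ⧸ v.asIdeal)) := by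
    refine ⟨ZMod.castHom_injective _, fun y => ?_⟩
    obtain ⟨x, rfl⟩ := Ideal.Quotient.mk_surjective y
    obtain ⟨m, hm⟩ := h.exists_int_sub_mem hcv x
    refine ⟨m, ?_⟩
    rw [map_intCast, ← map_intCast (Ideal.Quotient.mk v.asIdeal), eq_comm,
      Ideal.Quotient.mk_eq_mk_iff_sub_mem]
    exact hm
  rw [← Nat.card_eq_of_bijective _ hb, Nat.card_zmod]

include h in
-- Euler's criterion in a field of `p` elements with `p ≡ 1 mod 4`: the power `i ^ ((p - 1) / 2)` is
-- `1` for `p ≡ 1 mod 8` and `-1` for `p ≡ 5 mod 8`.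
theorem isSquare_intI_iff {v : HeightOneSpectrum (𝓞 K)} (hcv : conjPlace c v ≠ v) :
    IsSquare (Ideal.Quotient.mk v.asIdeal (intI h.sq)) ↔ resChar v % 8 ≠ 5 := by
  have h4 := h.mod_four_of_conjPlace_ne hcv
  have := v.isMaximal
  let : Field (𝓞 K ⧸ v.asIdeal) := Ideal.Quotient.field v.asIdeal
  have : Finite (𝓞 K ⧸ v.asIdeal) := Ideal.finiteQuotientOfFreeOfNeBot _ v.ne_bot
  have := Fintype.ofFinite (𝓞 K ⧸ v.asIdeal)
  have hch := charP_quotient v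
  have hring : ringChar (𝓞 K ⧸ v.asIdeal) ≠ 2 := by
    rw [ringChar.eq _ (resChar v)]
    intro h2
    omega
  set I := Ideal.Quotient.mk v.asIdeal (intI h.sq) with hI
  have hI2 : I ^ 2 = -1 := by rw [hI, ← map_pow, intI_sq, map_neg, map_one]
  have hI0 : I ≠ 0 := by
    rw [hI, Ne, Ideal.Quotient.eq_zero_iff_mem]
    exact intI_notMem h.sq v
  have hI4 : I ^ 4 = 1 := by linear_combination (I ^ 2 - 1) * hI2
  rw [FiniteField.isSquare_iff hring hI0, Fintype.card_eq_nat_card, h.natCard_quotient hcv]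
  have h8 : resChar v % 8 = 1 ∨ resChar v % 8 = 5 := by omega
  rcases h8 with h8 | h8
  · have : resChar v / 2 = 4 * (resChar v / 8) := by omega
    rw [this, pow_mul, hI4, one_pow]
    simp [h8]
  · have : resChar v / 2 = 4 * (resChar v / 8) + 2 := by omega
    rw [this, pow_add, pow_mul, hI4, one_pow, one_mul, hI2]
    simp only [h8, ne_eq, not_true_eq_false, iff_false]
    exact Ring.neg_one_ne_one_of_char_ne_two hring

include h in
theorem eq_zpow_of_valuation (a : Kˣ)
    (ha : ∀ v : HeightOneSpectrum (𝓞 K), v.valuation K (a : K) = 1) :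
    ∃ k : ℕ, a = muFour i h.sq ^ k := by
  obtain ⟨x, hx⟩ := HeightOneSpectrum.mem_integers_of_valuation_le_one K (a : K)
    fun v => (ha v).le
  obtain ⟨y, hy⟩ := HeightOneSpectrum.mem_integers_of_valuation_le_one K ((a⁻¹ : Kˣ) : K)
    fun v => by rw [Units.val_inv_eq_inv_val, map_inv₀, ha, inv_one]
  obtain ⟨m, n, rfl, -⟩ := h.exists_conj x
  obtain ⟨m', n', rfl, -⟩ := h.exists_conj y
  have hx' : (a : K) = m + n * i := by rw [← hx]; simp [coe_intI]
  have hy' : ((a⁻¹ : Kˣ) : K) = m' + n' * i := by rw [← hy]; simp [coe_intI]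
  have h1 : (m + n * i : K) * (m' + n' * i) = 1 := by rw [← hx', ← hy', Units.mul_inv]
  have h2 : (m - n * i : K) * (m' - n' * i) = 1 := by
    have := congrArg c h1
    simpa [h.conj, sub_eq_add_neg] using this
  have h3 : (m ^ 2 + n ^ 2) * (m' ^ 2 + n' ^ 2) = 1 := by
    have : (((m ^ 2 + n ^ 2) * (m' ^ 2 + n' ^ 2) : ℤ) : K) = 1 := by
      have e1 : (m ^ 2 + n ^ 2 : K) = (m + n * i) * (m - n * i) := by
        linear_combination (n : K) ^ 2 * h.sq
      have e2 : (m' ^ 2 + n' ^ 2 : K) = (m' + n' * i) * (m' - n' * i) := by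
        linear_combination (n' : K) ^ 2 * h.sq
      push_cast
      rw [e1, e2]
      linear_combination (m - n * i : K) * (m' - n' * i) * h1 + h2
    exact_mod_cast this
  have h4 : m ^ 2 + n ^ 2 = 1 :=
    (Int.eq_one_or_neg_one_of_mul_eq_one h3).resolve_right (by nlinarith [sq_nonneg m, sq_nonneg n])
  have hm : -1 ≤ m ∧ m ≤ 1 := ⟨by nlinarith [sq_nonneg n], by nlinarith [sq_nonneg n]⟩
  have hn : -1 ≤ n ∧ n ≤ 1 := ⟨by nlinarith [sq_nonneg m], by nlinarith [sq_nonneg m]⟩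
  have hi3 : i ^ 3 = -i := by linear_combination i * h.sq
  have key : ∃ k : ℕ, (a : K) = i ^ k := by
    obtain ⟨hm1, hm2⟩ := hm
    obtain ⟨hn1, hn2⟩ := hn
    interval_cases m <;> interval_cases n <;> simp at h4
    · exact ⟨2, by rw [hx', h.sq]; simp⟩
    · exact ⟨3, by rw [hx', hi3]; simp⟩
    · exact ⟨1, by rw [hx']; simp⟩
    · exact ⟨0, by rw [hx']; simp⟩
  obtain ⟨k, hk⟩ := key
  exact ⟨k, Units.ext hk⟩

end IsGaussian
end ResidueField

/-! ### Construction of tame local characters -/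

section LocalCharacters

variable {K : Type*} [Field K] [NumberField K] {v : HeightOneSpectrum (𝓞 K)}

/-- The subgroup generated by squares and higher units. -/
def squaresSup (v : HeightOneSpectrum (𝓞 K)) (n : ℕ) : Subgroup (v.adicCompletion K)ˣ :=
  (powMonoidHom 2).range ⊔ higherUnits v n

theorem sq_mem_squaresSup (n : ℕ) (x : (v.adicCompletion K)ˣ) : x ^ 2 ∈ squaresSup v n :=
  Subgroup.mem_sup_left ⟨x, rfl⟩

theorem exists_of_mem_squaresSup {n : ℕ} {x : (v.adicCompletion K)ˣ} (hx : x ∈ squaresSup v n)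
    (hx1 : Valued.v (x : v.adicCompletion K) = 1) :
    ∃ s : (v.adicCompletion K)ˣ, Valued.v (s : v.adicCompletion K) = 1 ∧
      x * (s ^ 2)⁻¹ ∈ higherUnits v n := by
  obtain ⟨y, ⟨s, hs⟩, t, ht, hst⟩ := Subgroup.mem_sup.1 hx
  rw [powMonoidHom_apply] at hs
  subst hs hst
  have ht1 : Valued.v (t : v.adicCompletion K) = 1 := (show IsHigherUnit v n t from ht).1
  refine ⟨s, ?_, ?_⟩
  · rw [Units.val_mul, Units.val_pow_eq_pow_val, map_mul, map_pow, ht1, mul_one] at hx1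
    exact (pow_eq_one_iff_of_nonneg zero_le two_ne_zero).1 hx1
  · have e : s ^ 2 * t * (s ^ 2)⁻¹ = t := by rw [mul_comm (s ^ 2), mul_inv_cancel_right]
    rw [e]
    exact ht

theorem mem_or_mul_mem_of_mem_sup_zpowers {G : Type*} [CommGroup G] {H : Subgroup G}
    (hsq : ∀ x : G, x ^ 2 ∈ H) {a g : G} (hg : g ∈ H ⊔ Subgroup.zpowers a) : g ∈ H ∨ g * a ∈ H := by
  obtain ⟨x, hx, y, hy, rfl⟩ := Subgroup.mem_sup.1 hg
  obtain ⟨k, rfl⟩ := Subgroup.mem_zpowers_iff.1 hy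
  rcases Int.even_or_odd' k with ⟨m, rfl | rfl⟩
  · left
    refine mul_mem hx ?_
    rw [mul_comm, zpow_mul]
    exact_mod_cast hsq (a ^ m)
  · right
    rw [mul_assoc, ← zpow_add_one]
    refine mul_mem hx ?_
    have : 2 * m + 1 + 1 = (m + 1) * 2 := by ring
    rw [this, zpow_mul]
    exact_mod_cast hsq (a ^ (m + 1))

/-- A lift of a non-square of the residue field is not a square times a unit of level one, so a sign
character separates it. -/
theorem exists_tame_character (hv : resChar v ≠ 2) :
    ∃ f : (v.adicCompletion K)ˣ →* Circle, (∀ x, f x ^ 2 = 1) ∧ TrivialOn v 1 f ∧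
      ¬ TrivialOn v 0 f := by
  have := v.isMaximal
  let : Field (𝓞 K ⧸ v.asIdeal) := Ideal.Quotient.field v.asIdeal
  have : Finite (𝓞 K ⧸ v.asIdeal) := Ideal.finiteQuotientOfFreeOfNeBot _ v.ne_bot
  have hch := charP_quotient v
  obtain ⟨r, hr⟩ := FiniteField.exists_nonsquare (F := 𝓞 K ⧸ v.asIdeal)
    (by rwa [ringChar.eq _ (resChar v)])
  obtain ⟨a, rfl⟩ := Ideal.Quotient.mk_surjective r
  have ha : a ∉ v.asIdeal := by
    intro ha
    rw [Ideal.Quotient.eq_zero_iff_mem.2 ha] at hr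
    exact hr IsSquare.zero
  have ha0 : (a : K) ≠ 0 := by
    intro h0
    have : a = 0 := RingOfIntegers.ext h0
    exact ha (by simp [this])
  set g := toLocal v (Units.mk0 (a : K) ha0) with hg
  have hg1 : Valued.v (g : v.adicCompletion K) = 1 := by
    rw [hg, valued_toLocal]
    exact (HeightOneSpectrum.valuation_eq_one_iff_notMem v).2 ha
  have hgH : g ∉ squaresSup v 1 := by
    intro hgH
    obtain ⟨s, hs1, hs⟩ := exists_of_mem_squaresSup hgH hg1
    obtain ⟨t, b, hb, ht, hst, -⟩ := exists_toLocal_near v 1 s hs1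
    have h1 : toLocal v (Units.mk0 (a : K) ha0 * (b ^ 2)⁻¹) ∈ higherUnits v 1 := by
      have : toLocal v (Units.mk0 (a : K) ha0 * (b ^ 2)⁻¹) =
          g * (s ^ 2)⁻¹ * (s * (toLocal v b)⁻¹) ^ 2 := by
        rw [map_mul, map_inv, map_pow, mul_pow, inv_pow, ← mul_assoc, inv_mul_cancel_right]
      rw [this]
      exact mul_mem hs (pow_mem hst 2)
    have h2 := h1.2
    rw [valued_toLocal_sub_one] at h2
    have hb0 : (b : K) ≠ 0 := b.ne_zero
    have hvb : v.valuation K (b : K) = 1 := by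
      rw [hb]; exact (HeightOneSpectrum.valuation_eq_one_iff_notMem v).2 ht
    have h3 : v.valuation K (algebraMap (𝓞 K) K (a - t ^ 2)) ≤ WithZero.exp (-((1 : ℕ) : ℤ)) := by
      have : algebraMap (𝓞 K) K (a - t ^ 2) =
          (((Units.mk0 (a : K) ha0 * (b ^ 2)⁻¹ : Kˣ) : K) - 1) * b ^ 2 := by
        rw [map_sub, map_pow]
        change (a : K) - (t : K) ^ 2 = _
        rw [← hb, Units.val_mul, Units.val_inv_eq_inv_val, Units.val_pow_eq_pow_val, Units.val_mk0]
        field_simp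
      rwa [this, map_mul, map_pow, hvb, one_pow, mul_one]
    rw [HeightOneSpectrum.valuation_of_algebraMap,
      HeightOneSpectrum.intValuation_le_pow_iff_mem, pow_one] at h3
    refine hr ⟨Ideal.Quotient.mk _ t, ?_⟩
    rw [← map_mul, Ideal.Quotient.mk_eq_mk_iff_sub_mem, ← pow_two]
    exact h3
  obtain ⟨f, hf1, hfg, hf2⟩ := exists_monoidHom_eq_neg_one (squaresSup v 1)
    (sq_mem_squaresSup 1) hgH
  refine ⟨f, hf2, fun u hu => hf1 u (Subgroup.mem_sup_right hu), fun h0 => ?_⟩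
  rw [h0 g (isHigherUnit_zero_iff.2 hg1)] at hfg
  exact circle_neg_one_ne_one hfg.symm

end LocalCharacters

/-! ### Construction of local characters of exponents `2` and `5` above `2` -/

section TwoAdicExistence

variable {K : Type*} [Field K] [NumberField K] {i : K} {c : K ≃ₐ[ℚ] K} (h : IsGaussian i c)
  {v : HeightOneSpectrum (𝓞 K)} (hv : resChar v = 2)

namespace IsGaussian

include h hv in
theorem valued_two : Valued.v (2 : v.adicCompletion K) = WithZero.exp (-2 : ℤ) := by
  rw [← map_ofNat (algebraMap K (v.adicCompletion K)) 2, valued_algebraMap, h.valuation_two hv]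

include h hv in
-- Both factors of `s ^ 2 - 1 = (s - 1)((s - 1) + 2)` are divisible by `π`.
theorem sq_mem_higherUnits_two {s : (v.adicCompletion K)ˣ}
    (hs : Valued.v (s : v.adicCompletion K) = 1) : s ^ 2 ∈ higherUnits v 2 := by
  have h1 := (h.isHigherUnit_one hv s hs).2
  refine ⟨by simp [hs], ?_⟩
  have h2 : ((s ^ 2 : (v.adicCompletion K)ˣ) : v.adicCompletion K) - 1 =
      (s - 1) * ((s - 1) + 2) := by
    rw [Units.val_pow_eq_pow_val]; ring
  have h3 : Valued.v ((s : v.adicCompletion K) - 1 + 2) ≤ WithZero.exp (-((1 : ℕ) : ℤ)) := by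
    refine (Valuation.map_add _ _ _).trans (max_le h1 ?_)
    rw [h.valued_two hv, WithZero.exp_le_exp]
    norm_num
  rw [h2, map_mul]
  refine (mul_le_mul' h1 h3).trans ?_
  rw [← WithZero.exp_add, WithZero.exp_le_exp]
  norm_num

include h hv in
/-- A square of a unit at the place above `2` that is `1` modulo `π ^ 3` is `1` modulo `π ^ 5`. -/
theorem sq_mem_higherUnits_five {s : (v.adicCompletion K)ˣ}
    (hs : Valued.v (s : v.adicCompletion K) = 1) (hs3 : s ^ 2 ∈ higherUnits v 3) :
    s ^ 2 ∈ higherUnits v 5 := by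
  have hsq : ∀ x : (v.adicCompletion K)ˣ, ((x ^ 2 : (v.adicCompletion K)ˣ) : v.adicCompletion K)
      - 1 = (x - 1) * ((x - 1) + 2) := fun x => by rw [Units.val_pow_eq_pow_val]; ring
  have h1 := h.isHigherUnit_one hv s hs
  -- If `s` had exact level one, both factors of `s ^ 2 - 1` would have valuation exactly one, and
  -- `s ^ 2` exact level two.
  have h2 : IsHigherUnit v 2 s := by
    refine ⟨hs, ?_⟩
    rcases h1.2.lt_or_eq with hlt | heq
    · exact (le_exp_of_lt_exp hlt).trans (by rw [WithZero.exp_le_exp]; norm_num)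
    · exfalso
      have h4 : Valued.v ((s : v.adicCompletion K) - 1 + 2) = WithZero.exp (-((1 : ℕ) : ℤ)) := by
        rw [← heq]
        refine Valuation.map_add_eq_of_lt_left _ ?_
        rw [heq, h.valued_two hv, WithZero.exp_lt_exp]
        norm_num
      have h5 := hs3.2
      rw [hsq, map_mul, heq, h4, ← WithZero.exp_add, WithZero.exp_le_exp] at h5
      norm_num at h5
  have key : ∀ x : (v.adicCompletion K)ˣ, IsHigherUnit v 3 x → x ^ 2 ∈ higherUnits v 5 := by
    intro x hx
    refine ⟨by simp [hx.1], ?_⟩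
    have h3 : Valued.v ((x : v.adicCompletion K) - 1 + 2) ≤ WithZero.exp (-((2 : ℕ) : ℤ)) := by
      refine (Valuation.map_add _ _ _).trans (max_le (hx.mono (by norm_num)).2 ?_)
      rw [h.valued_two hv]
      rfl
    rw [hsq, map_mul]
    refine (mul_le_mul' hx.2 h3).trans ?_
    rw [← WithZero.exp_add, WithZero.exp_le_exp]
    norm_num
  have hneg : Valued.v (((-1 : (v.adicCompletion K)ˣ) : v.adicCompletion K) - 1) =
      WithZero.exp (-((2 : ℕ) : ℤ)) := by
    have : ((-1 : (v.adicCompletion K)ˣ) : v.adicCompletion K) - 1 = -2 := by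
      push_cast; ring
    rw [this, Valuation.map_neg, h.valued_two hv]
    rfl
  -- As `-1` has exact level two, `s` or `-s` has level three. Both have the same square, whose
  -- level is then at least `3 + 2`.
  rcases h.isHigherUnit_mul_inv hv h2 (by simp) hneg with h6 | h6
  · exact key s h6
  · have := key _ h6
    rwa [mul_pow, inv_pow, neg_one_sq, inv_one, mul_one] at this

include h in
theorem toLocal_mem_higherUnits_iff {n : ℕ} (hn : n ≠ 0) (a : Kˣ) :
    toLocal v a ∈ higherUnits v n ↔ v.valuation K ((a : K) - 1) ≤ WithZero.exp (-(n : ℤ)) := by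
  rw [mem_higherUnits, IsHigherUnit, valued_toLocal_sub_one, valued_toLocal]
  exact ⟨fun h1 => h1.2, fun h1 =>
    ⟨valuation_eq_one_of_sub_one (h1.trans_lt (exp_neg_lt_one hn)), h1⟩⟩

include h hv in
theorem muFour_mem_higherUnits_iff {n : ℕ} (hn : n ≠ 0) :
    toLocal v (muFour i h.sq) ∈ higherUnits v n ↔ n ≤ 1 := by
  rw [h.toLocal_mem_higherUnits_iff hn]
  change v.valuation K (i - 1) ≤ _ ↔ _
  rw [h.valuation_pi hv, WithZero.exp_le_exp]
  omega

include h hv in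
theorem onePlusPiCubed_mem_higherUnits_iff {n : ℕ} (hn : n ≠ 0) :
    toLocal v (onePlusPiCubed i h.sq) ∈ higherUnits v n ↔ n ≤ 3 := by
  rw [h.toLocal_mem_higherUnits_iff hn]
  change v.valuation K (1 + (i - 1) ^ 3 - 1) ≤ _ ↔ _
  rw [add_sub_cancel_left, h.valuation_pi_pow hv, WithZero.exp_le_exp]
  omega

include h hv in
theorem unitFive_mem_higherUnits_iff {n : ℕ} (hn : n ≠ 0) :
    toLocal v (unitFive K) ∈ higherUnits v n ↔ n ≤ 4 := by
  rw [h.toLocal_mem_higherUnits_iff hn]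
  have : ((unitFive K : Kˣ) : K) - 1 = 2 * 2 := by
    change (5 : K) - 1 = _
    norm_num
  rw [this, map_mul, h.valuation_two hv, ← WithZero.exp_add, WithZero.exp_le_exp]
  omega

include h hv in
theorem mem_higherUnits_of_mem_squaresSup {n : ℕ} (hn : 2 ≤ n) {x : (v.adicCompletion K)ˣ}
    (hx : x ∈ squaresSup v n) (hx1 : Valued.v (x : v.adicCompletion K) = 1) :
    x ∈ higherUnits v 2 := by
  obtain ⟨s, hs1, hs⟩ := exists_of_mem_squaresSup hx hx1
  have := mul_mem (show x * (s ^ 2)⁻¹ ∈ higherUnits v 2 from IsHigherUnit.mono hn hs)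
    (h.sq_mem_higherUnits_two hv hs1)
  rwa [inv_mul_cancel_right] at this

include h hv in
theorem mem_higherUnits_five_of_mem_squaresSup {x : (v.adicCompletion K)ˣ}
    (hx : x ∈ squaresSup v 5) (hx3 : x ∈ higherUnits v 3) : x ∈ higherUnits v 5 := by
  obtain ⟨s, hs1, hs⟩ := exists_of_mem_squaresSup hx hx3.1
  have h3 : s ^ 2 ∈ higherUnits v 3 := by
    have := mul_mem hx3 (inv_mem (show x * (s ^ 2)⁻¹ ∈ higherUnits v 3 from
      IsHigherUnit.mono (by norm_num) hs))
    rwa [mul_inv_rev, inv_inv, ← mul_assoc, mul_comm x, mul_inv_cancel_right] at this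
  have := mul_mem hs (h.sq_mem_higherUnits_five hv hs1 h3)
  rwa [inv_mul_cancel_right] at this

include h hv in
theorem exists_character_two :
    ∃ f : (v.adicCompletion K)ˣ →* Circle, (∀ x, f x ^ 2 = 1) ∧ TrivialOn v 2 f ∧
      f (toLocal v (muFour i h.sq)) = -1 := by
  have hi : toLocal v (muFour i h.sq) ∉ squaresSup v 2 := by
    intro hi
    have h1 := h.mem_higherUnits_of_mem_squaresSup hv le_rfl hi
      (by rw [valued_toLocal]; exact h.valuation_i v)
    have := (h.muFour_mem_higherUnits_iff hv two_ne_zero).1 h1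
    omega
  obtain ⟨f, hf1, hfi, hf2⟩ := exists_monoidHom_eq_neg_one _ (sq_mem_squaresSup 2) hi
  exact ⟨f, hf2, fun u hu => hf1 u (Subgroup.mem_sup_right hu), hfi⟩

include h hv in
-- The classes of `i`, `1 + π ^ 3` and `5` are independent modulo squares and level five: unit
-- squares have level two, which excludes an odd power of `i`, and `5` and `5 (1 + π ^ 3)` have
-- level three but not five, so neither is a square modulo level five.
theorem exists_character_five :
    ∃ f : (v.adicCompletion K)ˣ →* Circle, (∀ x, f x ^ 2 = 1) ∧ TrivialOn v 5 f ∧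
      f (toLocal v (unitFive K)) = -1 ∧ f (toLocal v (onePlusPiCubed i h.sq)) = 1 ∧
      f (toLocal v (muFour i h.sq)) = 1 := by
  set w := toLocal v (onePlusPiCubed i h.sq) with hw
  set I := toLocal v (muFour i h.sq) with hI
  set g := toLocal v (unitFive K) with hg
  have hw3 : w ∈ higherUnits v 3 := (h.onePlusPiCubed_mem_higherUnits_iff hv (by norm_num)).2 le_rfl
  have hg4 : g ∈ higherUnits v 4 := (h.unitFive_mem_higherUnits_iff hv (by norm_num)).2 le_rfl
  have hg3 : g ∈ higherUnits v 3 := IsHigherUnit.mono (by norm_num) hg4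
  have hI1 : I ∈ higherUnits v 1 := (h.muFour_mem_higherUnits_iff hv one_ne_zero).2 le_rfl
  have hsq2 : ∀ x : (v.adicCompletion K)ˣ, x ^ 2 ∈ squaresSup v 5 ⊔ Subgroup.zpowers w :=
    fun x => Subgroup.mem_sup_left (sq_mem_squaresSup 5 x)
  have hx2 : ∀ x ∈ higherUnits v 3, x ∉ higherUnits v 5 → x ∉ squaresSup v 5 ∧
      x * I ∉ squaresSup v 5 := by
    refine fun x hx3 hx5 => ⟨fun hx => hx5 (h.mem_higherUnits_five_of_mem_squaresSup hv hx hx3),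
      fun hx => ?_⟩
    have h1 : Valued.v ((x * I : (v.adicCompletion K)ˣ) : v.adicCompletion K) = 1 := by
      rw [Units.val_mul, map_mul, hx3.1, hI1.1, mul_one]
    have h2 := mul_mem (inv_mem (show x ∈ higherUnits v 2 from IsHigherUnit.mono (by norm_num) hx3))
      (h.mem_higherUnits_of_mem_squaresSup hv (by norm_num) hx h1)
    rw [inv_mul_cancel_left] at h2
    have := (h.muFour_mem_higherUnits_iff hv two_ne_zero).1 h2
    omega
  have hg5 : g ∉ higherUnits v 5 := by
    rw [hg, h.unitFive_mem_higherUnits_iff hv (by norm_num)]; norm_num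
  have hgw5 : g * w ∉ higherUnits v 5 := by
    intro h1
    have h2 := mul_mem (inv_mem hg4) (show g * w ∈ higherUnits v 4 from
      IsHigherUnit.mono (by norm_num) h1)
    rw [inv_mul_cancel_left] at h2
    have := (h.onePlusPiCubed_mem_higherUnits_iff hv (by norm_num)).1 h2
    omega
  have hgH : g ∉ squaresSup v 5 ⊔ Subgroup.zpowers w ⊔ Subgroup.zpowers I := by
    intro h1
    rcases mem_or_mul_mem_of_mem_sup_zpowers hsq2 h1 with h2 | h2
    · rcases mem_or_mul_mem_of_mem_sup_zpowers (sq_mem_squaresSup 5) h2 with h3 | h3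
      · exact (hx2 g hg3 hg5).1 h3
      · exact (hx2 _ (mul_mem hg3 hw3) hgw5).1 h3
    · rcases mem_or_mul_mem_of_mem_sup_zpowers (sq_mem_squaresSup 5) h2 with h3 | h3
      · exact (hx2 g hg3 hg5).2 h3
      · rw [mul_right_comm] at h3
        exact (hx2 _ (mul_mem hg3 hw3) hgw5).2 h3
  obtain ⟨f, hf1, hfg, hf2⟩ := exists_monoidHom_eq_neg_one _
    (fun x => Subgroup.mem_sup_left (hsq2 x)) hgH
  exact ⟨f, hf2, fun u hu => hf1 u (Subgroup.mem_sup_left (Subgroup.mem_sup_left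
    (Subgroup.mem_sup_right hu))), hfg, hf1 w (Subgroup.mem_sup_left (Subgroup.mem_sup_right
    (Subgroup.mem_zpowers w))), hf1 I (Subgroup.mem_sup_right (Subgroup.mem_zpowers I))⟩

end IsGaussian
end TwoAdicExistence

/-! ### From local characters to an idele class character -/

section GlobalCharacter

variable {K : Type*} [Field K] [NumberField K] {i : K} {c : K ≃ₐ[ℚ] K} (h : IsGaussian i c)

theorem prod_apply_eq_of_eq_one {ι M : Type*} {G : ι → Type*} [CommMonoid M] [∀ j, Group (G j)]
    {P : Finset ι} (φ : ∀ j, G j →* M) (hφ : ∀ j ∉ P, φ j = 1) (y : ∀ j, G j) (j : ι)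
    (hy : ∀ k ≠ j, y k = 1) : ∏ k ∈ P, φ k (y k) = φ j (y j) := by
  refine Finset.prod_eq_single j (fun k _ hk => by rw [hy k hk, map_one]) fun hj => ?_
  rw [hφ j hj, MonoidHom.one_apply]

namespace IsGaussian

include h in
/-- Quadratic local characters at finitely many places whose product is trivial at `i` come from an
idele class character. -/
theorem exists_char_of_local {P : Finset (HeightOneSpectrum (𝓞 K))}
    {n : HeightOneSpectrum (𝓞 K) → ℕ}
    {φ : ∀ v : HeightOneSpectrum (𝓞 K), (v.adicCompletion K)ˣ →* Circle}
    (hφ2 : ∀ v x, φ v x ^ 2 = 1) (hφn : ∀ v, TrivialOn v (n v) (φ v)) (hφP : ∀ v ∉ P, φ v = 1)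
    (hφi : ∏ v ∈ P, φ v (toLocal v (muFour i h.sq)) = 1) :
    ∃ χ : IdeleClassCharacter K, χ ^ 2 = 1 ∧
      ∀ v x, Valued.v (x : v.adicCompletion K) = 1 → localChar χ v x = φ v x := by
  have := isPrincipalIdealRing_of_sq_eq_neg_one h.finrank h.sq h.conj
  let Ψ : (IntegralAdeles K)ˣ →* Circle := ∏ v ∈ P, (φ v).comp (unitAt v)
  have hΨ : ∀ u, Ψ u = ∏ v ∈ P, φ v (unitAt v u) := fun u => by
    rw [MonoidHom.finsetProd_apply]; rfl
  have hΨ2 : ∀ u, Ψ u ^ 2 = 1 := fun u => by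
    rw [hΨ, ← Finset.prod_pow]
    exact Finset.prod_eq_one fun v _ => hφ2 v _
  have hΨc : Continuous Ψ := by
    refine continuous_of_continuousAt_one Ψ ?_
    rw [ContinuousAt, map_one]
    refine tendsto_const_nhds.congr' ?_
    have h1 : ∀ᶠ u in nhds (1 : (IntegralAdeles K)ˣ), ∀ v ∈ P, IsHigherUnit v (n v) (unitAt v u) :=
      (Filter.eventually_all_finset P).2 fun v _ => eventually_isHigherUnit v (n v)
    filter_upwards [h1] with u hu
    rw [hΨ]
    exact (Finset.prod_eq_one fun v hv => hφn v _ (hu v hv)).symm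
  -- The global units are the powers of `i`, so `hφi` is exactly the condition needed for the
  -- extension.
  obtain ⟨χ, hχ⟩ := exists_extension Ψ hΨc (fun a u hau => by
    have hu : ∀ v, unitAt v u = toLocal v a := fun v => by
      refine Units.ext ?_
      rw [← adeleAt_integralIdele, ← hau]
      rfl
    obtain ⟨k, rfl⟩ := h.eq_zpow_of_valuation a fun v => by
      rw [← valued_toLocal, ← hu, valued_unitAt]
    simp only [hΨ, hu, map_pow, Finset.prod_pow, hφi, one_pow])
  refine ⟨χ, Subtype.ext (DFunLike.ext _ _ fun x => ?_), fun v x hx => ?_⟩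
  · obtain ⟨a, u, rfl⟩ := exists_principal_mul_integral x
    change χ.1 _ ^ 2 = 1
    rw [map_mul, χ.2 a, one_mul, hχ, hΨ2]
  · obtain ⟨u, hu, -, huv, huw⟩ := exists_integralIdele_eq_localIdele v hx
    change χ.1 (localIdele v x) = _
    rw [← hu, hχ, hΨ, prod_apply_eq_of_eq_one φ hφP (fun w => unitAt w u) v huw, huv]

include h in
/-- The value at `i` of a nontrivial quadratic tame character. -/
theorem tame_apply_muFour {v : HeightOneSpectrum (𝓞 K)} (hcv : conjPlace c v ≠ v)
    {f : (v.adicCompletion K)ˣ →* Circle} (hf2 : ∀ x, f x ^ 2 = 1)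
    (hf : TrivialOn v 1 f) (hf0 : ¬ TrivialOn v 0 f) :
    f (toLocal v (muFour i h.sq)) = if resChar v % 8 = 5 then -1 else 1 := by
  have h1 := (apply_toLocal_eq_one_iff_isSquare hf hf2 hf0 (b := muFour i h.sq) (coe_intI h.sq).symm
    (intI_notMem h.sq v)).trans (h.isSquare_intI_iff hcv)
  split_ifs with h5
  · exact (circle_eq_one_or_neg_one (hf2 _)).resolve_left fun h2 => h1.1 h2 h5
  · exact h1.2 h5

/-- The value at `i` of the local component at `v` of a normalized character of conductor
exponent `n`, where `s` is the value at `i` of the component at the place above `2`. -/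
def localSign (v : HeightOneSpectrum (𝓞 K)) (n : ℕ) (s : Circle) : Circle :=
  if n = 0 then 1 else (if resChar v % 8 = 5 then -1 else 1) * if resChar v = 2 then s else 1

include h in
-- At exponent `2` the sign at `i` must be `-1`, while at exponent `5` both signs occur; this is the
-- freedom used to meet the product formula.
theorem exists_local {v : HeightOneSpectrum (𝓞 K)} {n : ℕ}
    (h2 : n ≠ 0 → resChar v = 2 → n = 2 ∨ n = 5)
    (hne : n ≠ 0 → resChar v ≠ 2 → conjPlace c v ≠ v ∧ n = 1) {s : Circle} (hs : s = 1 ∨ s = -1)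
    (hs2 : resChar v = 2 → n = 2 → s = -1) :
    ∃ f : (v.adicCompletion K)ˣ →* Circle, (∀ x, f x ^ 2 = 1) ∧ TrivialOn v n f ∧
      (n ≠ 0 → ¬ TrivialOn v (n - 1) f) ∧ (n = 0 → f = 1) ∧
      (resChar v = 2 → f (toLocal v (onePlusPiCubed i h.sq)) = 1) ∧
      f (toLocal v (muFour i h.sq)) = localSign v n s := by
  by_cases hn : n = 0
  · exact ⟨1, fun _ => one_pow 2, fun _ _ => rfl, fun h0 => absurd hn h0, fun _ => rfl,
      fun _ => rfl, by simp [localSign, hn]⟩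
  by_cases hv : resChar v = 2
  · have hw3 : toLocal v (onePlusPiCubed i h.sq) ∈ higherUnits v 2 :=
      (h.onePlusPiCubed_mem_higherUnits_iff hv two_ne_zero).2 (by norm_num)
    have hI1 : toLocal v (muFour i h.sq) ∈ higherUnits v 1 :=
      (h.muFour_mem_higherUnits_iff hv one_ne_zero).2 le_rfl
    have hg4 : toLocal v (unitFive K) ∈ higherUnits v 4 :=
      (h.unitFive_mem_higherUnits_iff hv (by norm_num)).2 le_rfl
    obtain ⟨f, hf2, hft, hfi⟩ := h.exists_character_two hv
    rcases h2 hn hv with rfl | rfl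
    · refine ⟨f, hf2, hft, fun _ h0 => ?_, fun h0 => absurd h0 hn, fun _ => hft _ hw3, ?_⟩
      · rw [h0 _ hI1] at hfi
        exact circle_neg_one_ne_one hfi.symm
      · simp [localSign, hv, hs2 hv rfl, hfi]
    · obtain ⟨g, hg2, hgt, hg5, hgw, hgi⟩ := h.exists_character_five hv
      rcases hs with rfl | rfl
      · refine ⟨g, hg2, hgt, fun _ h0 => ?_, fun h0 => absurd h0 hn, fun _ => hgw, ?_⟩
        · rw [h0 _ hg4] at hg5
          exact circle_neg_one_ne_one hg5.symm
        · simp [localSign, hv, hgi]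
      -- Multiplying by the character of exponent `2` flips the sign at `i`. It leaves the values at
      -- `5` and `1 + π ^ 3` alone, since these have level at least two.
      · refine ⟨g * f, fun x => ?_, fun u hu => ?_, fun _ h0 => ?_, fun h0 => absurd h0 hn,
          fun _ => ?_, ?_⟩
        · rw [MonoidHom.mul_apply, mul_pow, hf2, hg2, one_mul]
        · rw [MonoidHom.mul_apply, hgt u hu, hft u (hu.mono (by norm_num)), one_mul]
        · have h1 := h0 _ hg4
          rw [MonoidHom.mul_apply, hg5, hft _ (IsHigherUnit.mono (by norm_num) hg4), mul_one] at h1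
          exact circle_neg_one_ne_one h1
        · rw [MonoidHom.mul_apply, hgw, hft _ hw3, one_mul]
        · simp [localSign, hv, hgi, hfi]
  · obtain ⟨hcv, rfl⟩ := hne hn hv
    obtain ⟨f, hf2, hf1, hf0⟩ := exists_tame_character hv
    refine ⟨f, hf2, hf1, fun _ => hf0, fun h0 => absurd h0 hn, fun h0 => absurd h0 hv, ?_⟩
    rw [h.tame_apply_muFour hcv hf2 hf1 hf0]
    simp [localSign, hv]

end IsGaussian
end GlobalCharacter

/-! ### The parity criterion -/

section Existence

variable {K : Type*} [Field K] [NumberField K] {i : K} {c : K ≃ₐ[ℚ] K} (h : IsGaussian i c)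

open Classical in
theorem numFiveModEight_eq {f : Ideal (𝓞 K)} {P : Finset (HeightOneSpectrum (𝓞 K))}
    (hP : ∀ v, v ∈ P ↔ v.asIdeal ∣ f) :
    numFiveModEight f = (P.filter fun v => resChar v % 8 = 5).card := by
  rw [numFiveModEight, ← Set.ncard_coe_finset]
  congr 1
  ext v
  simp only [Finset.coe_filter, Set.mem_ofPred_eq, hP]
  refine and_congr_right fun _ => ⟨?_, fun h5 => ⟨_, prime_resChar v, h5, above_resChar v⟩⟩
  rintro ⟨p, hp, h5, hv⟩
  rwa [(above_iff v hp).1 hv]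

theorem prod_sign_mul {f : Ideal (𝓞 K)} {P : Finset (HeightOneSpectrum (𝓞 K))}
    (hP : ∀ v, v ∈ P ↔ v.asIdeal ∣ f) (s : HeightOneSpectrum (𝓞 K) → Circle) :
    ∏ v ∈ P, ((if resChar v % 8 = 5 then -1 else 1) * if resChar v = 2 then s v else 1) =
      (-1) ^ numFiveModEight f * ∏ v ∈ P, if resChar v = 2 then s v else 1 := by
  classical
  rw [Finset.prod_mul_distrib, numFiveModEight_eq hP, Finset.prod_ite, Finset.prod_const,
    Finset.prod_const_one, mul_one]

theorem neg_one_pow_eq_one_iff {n : ℕ} : (-1 : Circle) ^ n = 1 ↔ Even n :=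
  neg_one_pow_eq_one_iff_even circle_neg_one_ne_one

namespace IsGaussian

theorem prod_two_eq_one {f : Ideal (𝓞 K)} {P : Finset (HeightOneSpectrum (𝓞 K))}
    (hP : ∀ v, v ∈ P ↔ v.asIdeal ∣ f) (s : HeightOneSpectrum (𝓞 K) → Circle)
    (h2 : ∀ v : HeightOneSpectrum (𝓞 K), v.asIdeal ∣ f → ¬ Above v 2) :
    (∏ v ∈ P, if resChar v = 2 then s v else 1) = 1 :=
  Finset.prod_eq_one fun v hv =>
    if_neg fun hv2 => h2 v ((hP v).1 hv) ((above_iff v Nat.prime_two).2 hv2)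

include h in
theorem prod_two_eq {P : Finset (HeightOneSpectrum (𝓞 K))}
    (s : HeightOneSpectrum (𝓞 K) → Circle) {v : HeightOneSpectrum (𝓞 K)}
    (hv : v ∈ P) (hv2 : resChar v = 2) :
    (∏ v ∈ P, if resChar v = 2 then s v else 1) = s v := by
  rw [Finset.prod_eq_single v (fun w _ hw => if_neg fun hw2 => hw (h.eq_of_two hw2 hv2))
    (fun hv' => absurd hv hv'), if_pos hv2]

include h in
-- Product formula at `i`: the odd places of the conductor contribute `(-1) ^ r`, and a place above
-- `2` with exponent `2` contributes another `-1`.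
theorem parity_of_exists {S : Set (HeightOneSpectrum (𝓞 K))} {χ : IdeleClassCharacter K}
    (hχ : χ ^ 2 = 1) (hn : IsNormalized i h.sq S χ) :
    ((∀ v : HeightOneSpectrum (𝓞 K), v.asIdeal ∣ conductorIdeal χ → ¬ Above v 2) →
        Even (numFiveModEight (conductorIdeal χ))) ∧
      ((∃ v : HeightOneSpectrum (𝓞 K), v.asIdeal ∣ conductorIdeal χ ∧ Above v 2 ∧
        ordAt v (conductorIdeal χ) = 2) → Odd (numFiveModEight (conductorIdeal χ))) := by
  classical
  obtain ⟨T, hT, hprod⟩ := h.prod_toLocal_eq_one hχ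
  have h1 := hprod (muFour i h.sq) h.valuation_i
  set P := T.filter fun v => conductorExponent χ v ≠ 0 with hPdef
  have hP : ∀ v, v ∈ P ↔ v.asIdeal ∣ conductorIdeal χ := fun v => by
    rw [dvd_conductorIdeal_iff hχ, hPdef, Finset.mem_filter, and_iff_right_iff_imp]
    intro hv
    by_contra hvT
    exact hv (hT v hvT)
  have h2 : ∏ v ∈ P, localValue χ v (muFour i h.sq) = 1 := by
    rw [← h1]
    refine Finset.prod_subset (Finset.filter_subset _ _) fun v hvT hvP => ?_
    have h0 : conductorExponent χ v = 0 := by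
      by_contra h0
      exact hvP (Finset.mem_filter.2 ⟨hvT, h0⟩)
    exact (conductorExponent_eq_zero_iff hχ).1 h0 _
      (isHigherUnit_zero_iff.2 (by rw [valued_toLocal]; exact h.valuation_i v))
  have h3 : ∀ v ∈ P, localValue χ v (muFour i h.sq) = (if resChar v % 8 = 5 then -1 else 1) *
      if resChar v = 2 then localValue χ v (muFour i h.sq) else 1 := by
    intro v hv
    by_cases hv2 : resChar v = 2
    · simp [hv2]
    · have h0 := (Finset.mem_filter.1 hv).2
      rw [if_neg hv2, mul_one]
      exact h.tame_apply_muFour (((h.isNormalized_iff hχ).1 hn).1 v hv2 h0).2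
        (localChar_sq_eq_one hχ v)
        ((conductorExponent_le_iff' hχ).1 (conductorExponent_le_one hχ hv2))
        (fun ht => h0 ((conductorExponent_eq_zero_iff hχ).2 ht))
  rw [Finset.prod_congr rfl h3, prod_sign_mul hP] at h2
  refine ⟨fun h4 => ?_, fun ⟨v, hv, hv2, hv3⟩ => ?_⟩
  · rwa [prod_two_eq_one hP _ h4, mul_one, neg_one_pow_eq_one_iff] at h2
  · rw [h.prod_two_eq _ ((hP v).2 hv) ((above_iff v Nat.prime_two).1 hv2), (hn.2 v hv2).1 hv3,
      ← pow_succ, neg_one_pow_eq_one_iff] at h2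
    exact Nat.not_even_iff_odd.1 fun h5 => (Nat.even_add_one.1 h2) h5

theorem isQuadratic_of_ne_one {χ : IdeleClassCharacter K} (hχ : χ ^ 2 = 1) (h1 : χ ≠ 1) :
    IsQuadratic χ := orderOf_eq_prime hχ h1

theorem conductorIdeal_one : conductorIdeal (1 : IdeleClassCharacter K) = ⊤ := by
  rw [conductorIdeal, ← Ideal.one_eq_top]
  exact finprod_eq_one_of_forall_eq_one fun v => by rw [conductorExponent_one, pow_zero]

include h in
theorem exists_of_parity {S : Set (HeightOneSpectrum (𝓞 K))} {f : Ideal (𝓞 K)} (hf : f ≠ ⊥)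
    (hf1 : f ≠ ⊤) (hcond : IdealConditions S f)
    (heven : (∀ v : HeightOneSpectrum (𝓞 K), v.asIdeal ∣ f → ¬ Above v 2) →
      Even (numFiveModEight f))
    (hodd : (∃ v : HeightOneSpectrum (𝓞 K), v.asIdeal ∣ f ∧ Above v 2 ∧ ordAt v f = 2) →
      Odd (numFiveModEight f)) :
    ∃ χ : IdeleClassCharacter K, IsQuadratic χ ∧ conductorIdeal χ = f ∧
      IsNormalized i h.sq S χ := by
  classical
  rw [h.idealConditions_iff] at hcond
  have hfin : {v : HeightOneSpectrum (𝓞 K) | v.asIdeal ∣ f}.Finite := Ideal.finite_factors hf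
  set P := hfin.toFinset with hPdef
  have hP : ∀ v, v ∈ P ↔ v.asIdeal ∣ f := fun v => by rw [hPdef, Set.Finite.mem_toFinset]; rfl
  -- The sign at `i` above `2` is chosen to cancel the odd places. For exponent `2` it must be `-1`,
  -- which is what `hodd` supplies.
  set s : Circle := (-1) ^ numFiveModEight f with hs
  have hs1 : s = 1 ∨ s = -1 := neg_one_pow_eq_or _ _
  have key : ∀ v : HeightOneSpectrum (𝓞 K), ∃ φ : (v.adicCompletion K)ˣ →* Circle,
      (∀ x, φ x ^ 2 = 1) ∧ TrivialOn v (ordAt v f) φ ∧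
      (ordAt v f ≠ 0 → ¬ TrivialOn v (ordAt v f - 1) φ) ∧ (ordAt v f = 0 → φ = 1) ∧
      (resChar v = 2 → φ (toLocal v (onePlusPiCubed i h.sq)) = 1) ∧
      φ (toLocal v (muFour i h.sq)) = localSign v (ordAt v f) s := fun v => by
    refine h.exists_local (fun h0 => (hcond v ((dvd_iff_ordAt_ne_zero v).2 h0)).1)
      (fun h0 hv => ((hcond v ((dvd_iff_ordAt_ne_zero v).2 h0)).2 hv).2) hs1 fun hv h2 => ?_
    rw [hs]
    refine (hodd ⟨v, (dvd_iff_ordAt_ne_zero v).2 ?_, (above_iff v Nat.prime_two).2 hv,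
      h2⟩).neg_one_pow
    omega
  choose φ hφ2 hφn hφn' hφ1 hφw hφi using key
  have hprod : ∏ v ∈ P, φ v (toLocal v (muFour i h.sq)) = 1 := by
    have h1 : ∀ v ∈ P, φ v (toLocal v (muFour i h.sq)) =
        (if resChar v % 8 = 5 then -1 else 1) * if resChar v = 2 then s else 1 := fun v hv => by
      rw [hφi, localSign, if_neg ((dvd_iff_ordAt_ne_zero v).1 ((hP v).1 hv))]
    rw [Finset.prod_congr rfl h1, prod_sign_mul hP (fun _ => s)]
    by_cases h2 : ∀ v : HeightOneSpectrum (𝓞 K), v.asIdeal ∣ f → ¬ Above v 2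
    · rw [prod_two_eq_one hP _ h2, mul_one, (heven h2).neg_one_pow]
    · push Not at h2
      obtain ⟨v, hv, hv2⟩ := h2
      rw [h.prod_two_eq _ ((hP v).2 hv) ((above_iff v Nat.prime_two).1 hv2), hs, ← mul_pow,
        neg_mul_neg, one_mul, one_pow]
  have hφP : ∀ v ∉ P, φ v = 1 := fun v hv => hφ1 v (by
    by_contra h0
    exact hv ((hP v).2 ((dvd_iff_ordAt_ne_zero v).2 h0)))
  obtain ⟨χ, hχ, hloc⟩ := h.exists_char_of_local hφ2 hφn hφP hprod
  have htriv : ∀ v n, TrivialOn v n (localChar χ v) ↔ TrivialOn v n (φ v) := fun v n =>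
    forall₂_congr fun u hu => by rw [hloc v u hu.1]
  have hexp : ∀ v, conductorExponent χ v = ordAt v f := fun v => by
    refine le_antisymm ((conductorExponent_le_iff' hχ).2 ((htriv v _).2 (hφn v))) ?_
    by_contra hlt
    have h0 : ordAt v f ≠ 0 := by omega
    refine hφn' v h0 ((htriv v _).1 ((conductorExponent_le_iff' hχ).1 ?_))
    omega
  have hcf := conductorIdeal_eq hf hexp
  refine ⟨χ, isQuadratic_of_ne_one hχ fun h1 => hf1 ?_, hcf, (h.isNormalized_iff hχ).2
    ⟨fun v hv h0 => ?_, fun v hv => ?_⟩⟩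
  · rw [← hcf, h1, conductorIdeal_one]
  · rw [hexp] at h0
    have := (hcond v ((dvd_iff_ordAt_ne_zero v).2 h0)).2 hv
    exact ⟨this.1, this.2.1⟩
  · rw [localValue_eq, hloc, hφw v hv]
    rw [valued_toLocal]
    exact (show IsHigherUnit v 1 _ from
      (h.onePlusPiCubed_mem_higherUnits_iff hv one_ne_zero).2 (by norm_num)).1 ▸
        (valued_toLocal v _).symm

end IsGaussian
end Existence

/-! ### Consequences for invariance under conjugation and for twists -/

section Uniqueness

variable {K : Type*} [Field K] [NumberField K] {i : K} {c : K ≃ₐ[ℚ] K} (h : IsGaussian i c)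

theorem IsQuadratic.sq_eq_one {χ : IdeleClassCharacter K} (hχ : IsQuadratic χ) : χ ^ 2 = 1 := by
  rw [← (show orderOf χ = 2 from hχ), pow_orderOf_eq_one]

theorem IsQuadratic.ne_one {χ : IdeleClassCharacter K} (hχ : IsQuadratic χ) : χ ≠ 1 := by
  rintro rfl
  rw [IsQuadratic, orderOf_one] at hχ
  exact absurd hχ (by norm_num)

theorem conjChar_mul (σ : K ≃ₐ[ℚ] K) (χ ψ : IdeleClassCharacter K) :
    conjChar σ (χ * ψ) = conjChar σ χ * conjChar σ ψ := rfl

theorem conjChar_one (σ : K ≃ₐ[ℚ] K) : conjChar σ (1 : IdeleClassCharacter K) = 1 := rfl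

namespace IsGaussian

include h in
theorem isNormalized_one (S : Set (HeightOneSpectrum (𝓞 K))) : IsNormalized i h.sq S 1 :=
  (h.isNormalized_iff (one_pow 2)).2
    ⟨fun v _ h0 => absurd (conductorExponent_one v) h0, fun _ _ => rfl⟩

include h in
/-- A quadratic normalized character is not invariant under conjugation. -/
theorem conjChar_ne {S : Set (HeightOneSpectrum (𝓞 K))} (hS : IsChoiceOfSplitPlaces S)
    {χ : IdeleClassCharacter K} (hχ : IsQuadratic χ) (hn : IsNormalized i h.sq S χ) :
    conjChar c χ ≠ χ := by
  intro hc
  have := h.eq_one_of_conj hS hχ.sq_eq_one (one_pow 2) hn (h.isNormalized_one S)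
    (by rwa [mul_one])
  rw [mul_one] at this
  exact hχ.ne_one this

include h in
theorem exists_conjChar_eq_mul {S : Set (HeightOneSpectrum (𝓞 K))} (hS : IsChoiceOfSplitPlaces S)
    {χ : IdeleClassCharacter K} (hχ : IsQuadratic χ) (hn : IsNormalized i h.sq S χ) :
    ∃ δ : IdeleClassCharacter K, IsQuadratic δ ∧ conjChar c χ = χ * δ := by
  refine ⟨χ⁻¹ * conjChar c χ, isQuadratic_of_ne_one ?_ fun h1 => ?_, by rw [mul_inv_cancel_left]⟩
  · rw [mul_pow, inv_pow, hχ.sq_eq_one, inv_one, one_mul, pow_two, ← conjChar_mul, ← pow_two,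
      hχ.sq_eq_one, conjChar_one]
  · exact h.conjChar_ne hS hχ hn (inv_mul_eq_one.1 h1).symm

include h in
theorem eq_of_eq_mul_isBaseChange {S : Set (HeightOneSpectrum (𝓞 K))}
    (hS : IsChoiceOfSplitPlaces S) {χ η μ : IdeleClassCharacter K} (hχ : χ ^ 2 = 1) (hη : η ^ 2 = 1)
    (hχn : IsNormalized i h.sq S χ) (hηn : IsNormalized i h.sq S η) (hμ : IsBaseChange μ)
    (hχη : χ = η * μ) : χ = η := by
  -- As `η ^ 2 = 1`, the quotient of `χ` by `η` is also their product, which is then invariant.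
  have h1 : χ * η = μ := by rw [hχη, mul_right_comm, ← pow_two, hη, one_mul]
  have h2 := h.eq_one_of_conj hS hχ hη hχn hηn (by rw [h1, h.conjChar_eq_of_isBaseChange hμ])
  rw [hχη, ← h1, h2, mul_one]

end IsGaussian
end Uniqueness

end IdeleClass

end

/-! ### Assembly of the four statements -/

open IdeleClass in
theorem theorem4p4 (K : Type*) [Field K] [NumberField K]
    (hK : Module.finrank ℚ K = 2) (i : K) (hi : i ^ 2 = -1)
    (c : K ≃ₐ[ℚ] K) (hc : c ≠ 1)
    (S : Set (HeightOneSpectrum (𝓞 K))) (hS : IsChoiceOfSplitPlaces S) :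
    -- (I)
    (∀ χ : IdeleClassCharacter K, IsQuadratic χ →
      ∃ μ : IdeleClassCharacter K, IsBaseChange μ ∧ (χ * μ) ^ 2 = 1 ∧
        IsNormalized i hi S (χ * μ)) ∧
    -- (II)
    (∀ χ : IdeleClassCharacter K, IsQuadratic χ → conductorIdeal χ ≠ ⊤ → IsNormalized i hi S χ →
      ¬ IsBaseChange χ ∧
        ∃ δ : IdeleClassCharacter K, IsQuadratic δ ∧ conjChar c χ = χ * δ) ∧
    -- (III)
    (∀ χ η : IdeleClassCharacter K, IsQuadratic χ → IsQuadratic η →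
      IsNormalized i hi S χ → IsNormalized i hi S η → χ ≠ η →
      ¬ ∃ μ : IdeleClassCharacter K, IsBaseChange μ ∧ χ = η * μ) ∧
    -- (IV)
    (∀ f : Ideal (𝓞 K), f ≠ ⊥ → f ≠ ⊤ → IdealConditions S f →
      ((∃ χ : IdeleClassCharacter K, IsQuadratic χ ∧ conductorIdeal χ = f ∧ IsNormalized i hi S χ) ↔
        ((∀ v : HeightOneSpectrum (𝓞 K), v.asIdeal ∣ f → ¬ Above v 2) →
            Even (numFiveModEight f)) ∧
          ((∃ v : HeightOneSpectrum (𝓞 K), v.asIdeal ∣ f ∧ Above v 2 ∧ ordAt v f = 2) →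
            Odd (numFiveModEight f)))) := by
  have h : IsGaussian i c := ⟨hK, hi, conj_i hK hi hc⟩
  refine ⟨fun χ hχ => h.exists_twist_isNormalized hS hχ.sq_eq_one,
    fun χ hχ _ hn => ⟨fun hb => h.conjChar_ne hS hχ hn (h.conjChar_eq_of_isBaseChange hb),
      h.exists_conjChar_eq_mul hS hχ hn⟩, ?_, fun f hf hf1 hcond => ⟨?_, ?_⟩⟩
  · rintro χ η hχ hη hχn hηn hne ⟨μ, hμ, hχη⟩
    exact hne (h.eq_of_eq_mul_isBaseChange hS hχ.sq_eq_one hη.sq_eq_one hχn hηn hμ hχη)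
  · rintro ⟨χ, hχ, rfl, hn⟩
    exact h.parity_of_exists hχ.sq_eq_one hn
  · exact fun ⟨heven, hodd⟩ => h.exists_of_parity hf hf1 hcond heven hodd
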